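/- **Theorem (Para-linearization of NLS).** *Equation.* Let $f(z_0,z_1,z_2)=\sum_{p=2}^{\overline q}\sum_{|\alpha|+|\beta|=p}C_{\alpha,\beta}\,z_0^{\alpha_0}\bar z_0^{\beta_0}z_1^{\alpha_1}\bar z_1^{\beta_1}z_2^{\alpha_2}\bar z_2^{\beta_2}$ be a polynomial with $C_{\alpha,\beta}\in\mathbb C$ such that for all $(z_0,z_1,z_2)\in\mathbb C^3$: (1) $f(z_0,z_1,z_2)=f(z_0,-z_1,z_2)$; (2) $\partial_{z_2}f(z_0,z_1,z_2)\in\mathbb R$ (Wirtinger derivative); (3) $f(z_0,z_1,z_2)=\overline{f(\bar z_0,\bar z_1,\bar z_2)}$. Let $m_1,\dots,m_M\in[-\frac12,\frac12]$, $\langle\xi\rangle=\sqrt{1+\xi^2}$, $\lambda e^{ijx}=\big((ij)^2+\sum_{k=1}^M m_k\langle j\rangle^{-2k-1}\big)e^{ijx}$, $\Lambda=\mathrm{diag}(\lambda,\lambda)$, $E=\mathrm{diag}(1,-1)$, and consider on $\mathbb T=\mathbb R/2\pi\mathbb Z$ the vector NLS $$\partial_tU=iE\Big[\Lambda U+\Big(f(u,u_x,u_{xx}),\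 \overline{f(u,u_x,u_{xx})}\Big)^{T}\Big],\qquad U=(u,\bar u).\tag{1}$$ *Notation.* $\hat u(j)$ are the coefficients of $u$ in the basis $e^{ijx}/\sqrt{2\pi}$, $\|u\|_{H^s}^2=\sum_j|\hat u(j)|^2\langle j\rangle^{2s}$, and $\Pi_n$ ($n\in\mathbb N$) is the projector on $\mathrm{span}\{e^{inx},e^{-inx}\}$. $I\subset\mathbb R$ is a fixed nondegenerate interval containing $0$. $C^K_*(I,H^s)$ is the space of $U$ with $\partial_t^kU\in C(I,H^{s-2k})$ for $0\le k\le K$; $\|U(t)\|_{K,s}=\sum_{k\le K}\|\partial_t^kU(t)\|_{H^{s-2k}}$; $B^K_s(I,r)=\{U\in C^K_*(I,H^s(\mathbb T;\mathbb C^2)):\sup_{t\in I}\|U(t)\|_{K,s}<r\}$. $S(u^+,u^-)=(u^-,u^+)$, $(\tau V)(x)=V(-x)$. $U$ is called *real* if $SU=\overline U$, and *even* if $\tau U=U$. *Symbols.* $\widetilde\Gamma^m_q$ is the set of symmetric $q$-linear maps $a$ from $C^\infty(\mathbb T;\mathbb C^2)^q$ to smooth functions of $(x,\xi)\in\mathbb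 T\times\mathbb R$, with $a(\mathcal U)=\sum_{\vec n}a(\Pi_{\vec n}\mathcal U)$, such that for some $\mu>0$ and all $\alpha,\beta$ there is $C$ with $|\partial_x^\alpha\partial_\xi^\beta a(\Pi_{\vec n}\mathcal U;x,\xi)|\le C\langle\vec n\rangle^{\mu+\alpha}\langle\xi\rangle^{m-\beta}\prod_j\|\Pi_{n_j}U_j\|_{L^2}$, where $\langle\vec n\rangle=\sqrt{1+|\vec n|^2}$, and $\Pi_{n_0}a(\Pi_{\vec n}\mathcal U)\ne0$ implies $\sum_{j=0}^q\pm n_j=0$ for some choice of signs. $\Gamma^m_{K,N}[r]$ is the set of functions $a(U;x,\xi)$, $2\pi$-periodic in $x$, depending on time only through $U=U(t)$, such that for some $s_0$: for all $k\le K$, $s\ge s_0$ there are $C>0$, $0<r(s)<r$ such that for $U\in B^K_{s_0}(I,r(s))\cap C^k_*(I,H^s)$ the derivatives below exist, are continuous, and, for all $\alpha\le s-s_0$ and all $\beta$, $|\partial_t^k\partial_x^\alpha\partial_\xi^\beta a(U(t);x,\xi)|\le C\langle\xi\rangle^{m-\beta}\|U(t)\|_{k,s_0}^{N-1}\|U(t)\|_{k,s}$.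 $\Sigma\Gamma^m[r,N]$ is the set of $a(U)=\sum_{q=1}^{N-1}a_q(U,\dots,U)+a_N(U)$ with $a_q\in\widetilde\Gamma^m_q$, $a_N\in\Gamma^m_{K,N}[r]$ (on Sobolev functions $a_q(U,\dots,U)=\sum_{\vec n}a_q(\Pi_{\vec n}(U,\dots,U))$). $\Sigma\mathcal F[r,N]\subset\Sigma\Gamma^0[r,N]$ is the subset of those with all terms independent of $\xi$. *Smoothing operators.* $\widetilde{\mathcal R}^{-\rho}_q$ is the set of $(q+1)$-linear maps $R(U_1,\dots,U_q)U_{q+1}$ from $C^\infty(\mathbb T;\mathbb C^2)^q\times C^\infty(\mathbb T;\mathbb C)$ to $C^\infty(\mathbb T;\mathbb C)$, symmetric in $U_1,\dots,U_q$ and equal to the sum of their spectral pieces, such that for some $\mu\ge0$, $C>0$ $$\|\Pi_{n_0}R(\Pi_{\vec n}\mathcal U)\Pi_{n_{q+1}}U_{q+1}\|_{L^2}\le C\,\frac{\max_2(\langle n_1\rangle,\dots,\langle n_{q+1}\rangle)^{\rho+\mu}}{\max(\langle n_1\rangle,\dots,\langle n_{q+1}\rangle)^{\rho}}\prod_{j=1}^{q+1}\|\Pi_{n_j}U_j\|_{L^2}$$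 ($\max_2$ is the second largest), the left side being nonzero only if $\sum_{j=0}^{q+1}\pm n_j=0$ for some choice of signs. $\mathcal R^{-\rho}_{K,N}[r]$ is the set of maps $R(V)u$, linear in $u$, depending on time only through $V=V(t)$, such that for some $s_0$ and all $s\ge s_0$ there is $C$ such that for $V\in B^K_{s_0}(I,r)\cap C^K_*(I,H^s)$, $u\in C^K_*(I,H^s)$ one has $R(V)u\in C^K_*(I,H^{s+\rho})$ and, for $k\le K$, $t\in I$, $\|\partial_t^k(R(V)u)(t)\|_{H^{s-2k+\rho}}\le C\sum_{k'+k''=k}\big[\|u\|_{k'',s}\|V\|_{k',s_0}^N+\|u\|_{k'',s_0}\|V\|_{k',s_0}^{N-1}\|V\|_{k',s}\big]$. $\Sigma\mathcal R^{-\rho}[r,N]$ is the set of $R(V)=\sum_{q=1}^{N-1}R_q(V,\dots,V)+R_N(V)$ with $R_q\in\widetilde{\mathcal R}^{-\rho}_q$, $R_N\in\mathcal R^{-\rho}_{K,N}[r]$. *Quantization.* Fix $0<\delta<1$ and admissible cut-off functions $\chi_q\in C^\infty(\mathbb R^q\times\mathbb R;\mathbb R)$ ($q\ge1$) and $\chi\in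 C^\infty(\mathbb R\times\mathbb R;\mathbb R)$: even in each argument, supported in $|\xi'|\le\delta\langle\xi\rangle$, equal to $1$ for $|\xi'|\le\frac\delta2\langle\xi\rangle$, with derivatives of order $n$ bounded by $C_n\langle\xi\rangle^{-n}$. Then $\mathrm{Op}^W(c)u$ has $k$-th Fourier coefficient $\frac1{\sqrt{2\pi}}\sum_j\hat c(k-j,\frac{k+j}2)\hat u(j)$, and for $a\in\Sigma\Gamma^m[r,N]$, $\mathrm{Op}^{BW}(a(U))=\sum_{q=1}^{N-1}\mathrm{Op}^W\big(\sum_{\vec n}\chi_q(\vec n,\xi)a_q(\Pi_{\vec n}(U,\dots,U);x,\xi)\big)+\mathrm{Op}^W\big(\frac1{\sqrt{2\pi}}\sum_{\eta\in\mathbb Z}\chi(\eta,\xi)\hat a_N(U;\eta,\xi)e^{i\eta x}\big)$; matrices of symbols are quantized entrywise. *(R,R,P).* A matrix of symbols $A(U;x,\xi)$ is (R,R,P) if for real $U$: $\overline{A(U;x,-\xi)}=SA(U;x,\xi)S$, $SA(U;x,\xi)=A(SU;x,\xi)S$, and, when $U$ is also even, $A(U;x,\xi)=A(U;-x,-\xi)$.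 A matrix of operators $R(U)$ is (R,R,P) if for real $U$: $\overline{R(U)[V]}=SR(U)[S\overline V]$, $SR(U)=R(SU)S$, and, when $U$ is also even, $R(U)\circ\tau=\tau\circ R(U)$. **Statement.** For every integer $N\ge1$, every $K\in\mathbb N$, every $r>0$ and every $\rho>0$ there are $s_0>2K+\frac52$ (serving as the index $s_0$ of all the classes), an (R,R,P) matrix $A$ with entries in $\Sigma\Gamma^2[r,N]$ and an (R,R,P) matrix $R$ with entries in $\Sigma\mathcal R^{-\rho}[r,N]$ such that, for real $U$ with $\|U\|_{H^{s_0}}<r$, the right-hand side of (1) equals $iE[\Lambda U+\mathrm{Op}^{BW}(A(U;x,\xi))U+R(U)U]$; hence for real $U\in B^K_{s_0}(I,r)$ the system (1) is equivalent to $$\partial_tU=iE\big[\Lambda U+\mathrm{Op}^{BW}(A(U;x,\xi))U+R(U)U\big].$$ Moreover (also term by term in the expansions) $A(U;x,\xi)=A_2(U;x)(i\xi)^2+A_1(U;x)(i\xi)+A_0(U;x)$, where the $A_l$ have entries in $\Sigma\mathcal F[r,N]$ and, for real $U$ with $\|U\|_{H^{s_0}}<r$, $A_l=\begin{pmatrix}a_l&b_l\\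 \overline{b_l}&\overline{a_l}\end{pmatrix}$ and $a_2(U;x)\in\mathbb R$ for all $x$. -/

import Mathlib

open Filter Topology
open scoped ContDiff ComplexConjugate

noncomputable section

namespace ParaNLS

/-! ### Functions on the circle and Sobolev spaces -/

/-- The Japanese bracket `⟨x⟩ = √(1 + x²)`. -/
def jb (x : ℝ) : ℝ := Real.sqrt (1 + x ^ 2)

/-- A (generalised) function on `𝕋 = ℝ/2πℤ`, represented by its Fourier coefficients `û(j)` with
respect to the orthonormal basis `e^{ijx}/√(2π)`. -/
abbrev Fn : Type := ℤ → ℂ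

/-- `ℂ²`-valued (generalised) functions on `𝕋`; component `0` is `u⁺`, component `1` is `u⁻`. -/
abbrev Fn2 : Type := Fin 2 → Fn

/-- `u(x) = (2π)^{-1/2} ∑_j û(j) e^{ijx}`. -/
def evalFn (u : Fn) (x : ℝ) : ℂ :=
  ((Real.sqrt (2 * Real.pi) : ℝ) : ℂ)⁻¹ * ∑' j : ℤ, u j * Complex.exp (Complex.I * j * x)

/-- `ĝ(j) = (2π)^{-1/2} ∫_0^{2π} g(x) e^{-ijx} dx` for a `2π`-periodic function `g`. -/
def fourierFn (g : ℝ → ℂ) : Fn := fun j =>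
  ((Real.sqrt (2 * Real.pi) : ℝ) : ℂ)⁻¹ *
    ∫ x in (0 : ℝ)..(2 * Real.pi), g x * Complex.exp (-(Complex.I * j * x))

/-- The derivative `∂ₓ`. -/
def dx (u : Fn) : Fn := fun j => Complex.I * j * u j

/-- The complex conjugate function `x ↦ conj (u x)`. -/
def conjFn (u : Fn) : Fn := fun j => conj (u (-j))

/-- The reflection `(τ u)(x) = u(-x)`. -/
def tauFn (u : Fn) : Fn := fun j => u (-j)

def conjFn2 (U : Fn2) : Fn2 := fun i => conjFn (U i)

def tauFn2 (U : Fn2) : Fn2 := fun i => tauFn (U i)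

/-- The involution `S (u⁺, u⁻) = (u⁻, u⁺)`. -/
def swapFn2 (U : Fn2) : Fn2 := ![U 1, U 0]

/-- `S U = conj U`, that is `u⁻ = conj u⁺`. -/
def IsRealPair (U : Fn2) : Prop := swapFn2 U = conjFn2 U

/-- `u ∈ H^s(𝕋; ℂ)`. -/
def MemHs (s : ℝ) (u : Fn) : Prop := Summable fun j : ℤ => ‖u j‖ ^ 2 * jb j ^ (2 * s)

/-- The `H^s` norm (`s = 0` is the `L²` norm). -/
def hsNorm (s : ℝ) (u : Fn) : ℝ := Real.sqrt (∑' j : ℤ, ‖u j‖ ^ 2 * jb j ^ (2 * s))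

/-- `U ∈ H^s(𝕋; ℂ²)`. -/
def MemHs2 (s : ℝ) (U : Fn2) : Prop := ∀ i, MemHs s (U i)

/-- The norm of `H^s(𝕋; ℂ²)`. -/
def hsNorm2 (s : ℝ) (U : Fn2) : ℝ := Real.sqrt (∑ i, hsNorm s (U i) ^ 2)

/-! ### Functions of time -/

/-- An interval of `ℝ` that contains the origin and is not reduced to a point. -/
structure IsTimeInterval (I : Set ℝ) : Prop where
  ordConnected : I.OrdConnected
  zero_mem : (0 : ℝ) ∈ I
  nontrivial : I.Nontrivial

/-- `∂_t^k u(t)`, taken on each Fourier coefficient. -/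
def dt (I : Set ℝ) (k : ℕ) (u : ℝ → Fn) (t : ℝ) : Fn :=
  fun j => iteratedDerivWithin k (fun τ => u τ j) I t

def dt2 (I : Set ℝ) (k : ℕ) (U : ℝ → Fn2) (t : ℝ) : Fn2 :=
  fun i => dt I k (fun τ => U τ i) t

/-- `u ∈ C^K_*(I, H^s(𝕋; ℂ))`: for `k ≤ K` the derivative `∂_t^k u` is continuous with values in
`H^{s-2k}`. (A function whose Fourier coefficients are `C¹`, with coefficientwise derivative
continuous into `H^σ`, is differentiable in `H^σ` with that derivative, by integration.) -/
def MemCK (I : Set ℝ) (K : ℕ) (s : ℝ) (u : ℝ → Fn) : Prop :=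
  (∀ j, ContDiffOn ℝ K (fun t => u t j) I) ∧
  ∀ k ≤ K, ∀ t ∈ I, MemHs (s - 2 * k) (dt I k u t) ∧
    Tendsto (fun τ => hsNorm (s - 2 * k) (dt I k u τ - dt I k u t)) (𝓝[I] t) (𝓝 0)

/-- `U ∈ C^K_*(I, H^s(𝕋; ℂ²))`. -/
def MemCK2 (I : Set ℝ) (K : ℕ) (s : ℝ) (U : ℝ → Fn2) : Prop :=
  ∀ i, MemCK I K s (fun t => U t i)

/-- `‖u(t)‖_{K,s} = ∑_{k ≤ K} ‖∂_t^k u(t)‖_{H^{s-2k}}`. -/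
def normK (I : Set ℝ) (K : ℕ) (s : ℝ) (u : ℝ → Fn) (t : ℝ) : ℝ :=
  ∑ k ∈ Finset.range (K + 1), hsNorm (s - 2 * k) (dt I k u t)

def normK2 (I : Set ℝ) (K : ℕ) (s : ℝ) (U : ℝ → Fn2) (t : ℝ) : ℝ :=
  ∑ k ∈ Finset.range (K + 1), hsNorm2 (s - 2 * k) (dt2 I k U t)

/-- The ball `B^K_s(I, r)`: `sup_{t ∈ I} ‖U(t)‖_{K,s} < r`. -/
def MemBall (I : Set ℝ) (K : ℕ) (s r : ℝ) (U : ℝ → Fn2) : Prop :=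
  MemCK2 I K s U ∧ ∃ r' < r, ∀ t ∈ I, normK2 I K s U t ≤ r'

/-! ### Smooth functions and spectral projectors -/

lemma jb_nonneg (x : ℝ) : 0 ≤ jb x := Real.sqrt_nonneg _

/-- `C^∞(𝕋; ℂ)`: rapidly decreasing Fourier coefficients. -/
def CInf : Submodule ℂ Fn where
  carrier := {u | ∀ k : ℕ, ∃ C : ℝ, ∀ j : ℤ, ‖u j‖ * jb j ^ k ≤ C}
  zero_mem' := fun _ => ⟨0, fun _ => by simp⟩
  add_mem' := by
    intro u v hu hv k
    obtain ⟨C, hC⟩ := hu k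
    obtain ⟨D, hD⟩ := hv k
    refine ⟨C + D, fun j => ?_⟩
    have h0 : 0 ≤ jb j ^ k := pow_nonneg (jb_nonneg _) _
    calc ‖(u + v) j‖ * jb j ^ k ≤ (‖u j‖ + ‖v j‖) * jb j ^ k :=
          mul_le_mul_of_nonneg_right (norm_add_le _ _) h0
      _ ≤ C + D := by rw [add_mul]; exact add_le_add (hC j) (hD j)
  smul_mem' := by
    intro c u hu k
    obtain ⟨C, hC⟩ := hu k
    refine ⟨‖c‖ * C, fun j => ?_⟩
    have h : ‖(c • u) j‖ = ‖c‖ * ‖u j‖ := by simp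
    rw [h, mul_assoc]
    exact mul_le_mul_of_nonneg_left (hC j) (norm_nonneg _)

/-- `C^∞(𝕋; ℂ²)`. -/
abbrev CInf2 : Type := Fin 2 → CInf

/-- The spectral projector `Π_n` on the span of `e^{inx}, e^{-inx}`; its range consists of smooth
functions. -/
def proj (n : ℕ) (u : Fn) : CInf :=
  ⟨fun j => if j.natAbs = n then u j else 0, by
    intro k
    refine ⟨‖u n‖ * jb n ^ k + ‖u (-n)‖ * jb n ^ k, fun j => ?_⟩
    have h1 : 0 ≤ ‖u n‖ * jb n ^ k := mul_nonneg (norm_nonneg _) (pow_nonneg (jb_nonneg _) _)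
    have h2 : 0 ≤ ‖u (-n)‖ * jb n ^ k := mul_nonneg (norm_nonneg _) (pow_nonneg (jb_nonneg _) _)
    by_cases h : j.natAbs = n
    · rcases Int.natAbs_eq j with hj | hj
      · rw [h] at hj; subst hj; simpa [h] using h2
      · rw [h] at hj; subst hj; simpa [h, jb] using h1
    · simpa [h] using add_nonneg h1 h2⟩

def proj2 (n : ℕ) (U : Fn2) : CInf2 := fun i => proj n (U i)

def CInf2.toFn2 (U : CInf2) : Fn2 := fun i => (U i : Fn)

/-- The `L²` norm on `C^∞(𝕋; ℂ)`. -/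
def l2 (u : CInf) : ℝ := hsNorm 0 (u : Fn)

/-- The `L²` norm on `C^∞(𝕋; ℂ²)`. -/
def l2v (U : CInf2) : ℝ := hsNorm2 0 U.toFn2

/-- `Π_{n⃗} 𝒰 = (Π_{n₁} U₁, …, Π_{n_p} U_p)`. -/
def projTuple {p : ℕ} (n : Fin p → ℕ) (U : Fin p → Fn2) : Fin p → CInf2 :=
  fun i => proj2 (n i) (U i)

/-- The largest of finitely many numbers. -/
def maxOne {p : ℕ} (v : Fin p → ℝ) : ℝ := ⨆ i, v i

/-- The second largest (with multiplicity) of at least two numbers. -/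
def maxTwo {p : ℕ} (v : Fin p → ℝ) : ℝ :=
  ⨆ ij : {ij : Fin p × Fin p // ij.1 ≠ ij.2}, min (v ij.1.1) (v ij.1.2)

/-- There are signs with `∑_j σ_j n_j = 0`. -/
def SignRelation {p : ℕ} (n : Fin p → ℕ) : Prop :=
  ∃ σ : Fin p → ℤˣ, ∑ j, (σ j : ℤ) * (n j : ℤ) = 0

/-! ### Smoothing operators -/

/-- `(p+1)`-linear maps `(U₁, …, U_{p+1}) ↦ R(U₁, …, U_p) U_{p+1}` on smooth functions. -/
abbrev HomOp (p : ℕ) : Type :=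
  MultilinearMap ℂ (fun _ : Fin p => CInf2) (CInf →ₗ[ℂ] CInf)

/-- The class `R̃^{-ρ}_p` of `p`-homogeneous smoothing operators. The last condition says that `R` is
the sum of its spectral pieces. -/
structure IsHomSmoothing (ρ : ℝ) (p : ℕ) (R : HomOp p) : Prop where
  symm : ∀ (e : Equiv.Perm (Fin p)) (U : Fin p → CInf2), R (U ∘ e) = R U
  bound : ∃ μ : ℝ, 0 ≤ μ ∧ ∃ C : ℝ, 0 < C ∧
    ∀ (U : Fin p → CInf2) (u : CInf) (n : Fin p → ℕ) (n₀ m : ℕ),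
      l2 (proj n₀ (R (projTuple n fun i => (U i).toFn2) (proj m u) : Fn)) ≤
        C * (maxTwo (fun i => jb (Fin.snoc (α := fun _ => ℕ) n m i : ℕ)) ^ (ρ + μ) /
            maxOne (fun i => jb (Fin.snoc (α := fun _ => ℕ) n m i : ℕ)) ^ ρ) *
          ((∏ i, l2v (proj2 (n i) (U i).toFn2)) * l2 (proj m u))
  spectral : ∀ (U : Fin p → CInf2) (u : CInf) (n : Fin p → ℕ) (n₀ m : ℕ),
    proj n₀ (R (projTuple n fun i => (U i).toFn2) (proj m u) : Fn) ≠ 0 →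
      SignRelation (Fin.cons (α := fun _ => ℕ) n₀ (Fin.snoc (α := fun _ => ℕ) n m))
  expand : ∀ (U : Fin p → CInf2) (u : CInf) (k : ℤ),
    HasSum (fun nm : (Fin p → ℕ) × ℕ =>
      (R (projTuple nm.1 fun i => (U i).toFn2) (proj nm.2 u) : Fn) k) ((R U u : Fn) k)

/-- `R(U, …, U)u` for Sobolev functions: the extension by the sum of the spectral pieces. -/
def HomOp.eval {p : ℕ} (R : HomOp p) (U : Fn2) (u : Fn) : Fn := fun k =>
  ∑' nm : (Fin p → ℕ) × ℕ, (R (projTuple nm.1 fun _ => U) (proj nm.2 u) : Fn) k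

/-- The class `R^{-ρ}_{K,0,N}[r, aut]` of autonomous non-homogeneous smoothing operators
`(V, u) ↦ R(V)u`; for time dependent `V, u` it acts by `(R(V)u)(t) = R(V(t)) u(t)`. -/
structure IsNonhomSmoothing (I : Set ℝ) (ρ : ℝ) (K N : ℕ) (r s₀ : ℝ) (R : Fn2 → Fn → Fn) :
    Prop where
  linear : ∀ V, MemHs2 s₀ V → hsNorm2 s₀ V < r → ∀ u v, MemHs s₀ u → MemHs s₀ v →
    ∀ c : ℂ, R V (c • u + v) = c • R V u + R V v
  bound : ∀ s ≥ s₀, ∃ C : ℝ, 0 < C ∧ ∀ V : ℝ → Fn2, MemBall I K s₀ r V → MemCK2 I K s V →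
    ∀ u : ℝ → Fn, MemCK I K s u →
      MemCK I K (s + ρ) (fun t => R (V t) (u t)) ∧
      ∀ k ≤ K, ∀ t ∈ I,
        hsNorm (s - 2 * k + ρ) (dt I k (fun t => R (V t) (u t)) t) ≤
          ∑ kk ∈ Finset.HasAntidiagonal.antidiagonal k, C *
            (normK I kk.2 s u t * normK2 I kk.1 s₀ V t ^ N +
              normK I kk.2 s₀ u t * normK2 I kk.1 s₀ V t ^ (N - 1) * normK2 I kk.1 s V t)

/-- A multilinear expansion `∑_q R_q(V, …, V)u + R_N(V)u` of an operator. -/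
structure OpExp where
  hom : (q : ℕ) → HomOp q
  rem : Fn2 → Fn → Fn

/-- `R(V)u = ∑_{q=p}^{N-1} R_q(V, …, V)u + R_N(V)u`. -/
def OpExp.eval (p N : ℕ) (R : OpExp) (V : Fn2) (u : Fn) : Fn :=
  (∑ q ∈ Finset.Ico p N, (R.hom q).eval V u) + R.rem V u

/-- The class `ΣR^{-ρ}_{K,0,p}[r, N, aut]`. -/
def IsSigmaSmoothing (I : Set ℝ) (ρ : ℝ) (K p N : ℕ) (r s₀ : ℝ) (R : OpExp) : Prop :=
  (∀ q ∈ Finset.Ico p N, IsHomSmoothing ρ q (R.hom q)) ∧ IsNonhomSmoothing I ρ K N r s₀ R.rem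

/-! ### Symbols -/

/-- `p`-linear maps from smooth functions to functions of `(x, ξ)`. -/
abbrev HomSym (p : ℕ) : Type :=
  MultilinearMap ℂ (fun _ : Fin p => CInf2) (ℝ → ℝ → ℂ)

/-- The class `Γ̃^m_p` of `p`-homogeneous symbols. The last condition says that `a` is the sum of its
spectral pieces. -/
structure IsHomSymbol (m : ℝ) (p : ℕ) (a : HomSym p) : Prop where
  symm : ∀ (e : Equiv.Perm (Fin p)) (U : Fin p → CInf2), a (U ∘ e) = a U
  periodic : ∀ (U : Fin p → CInf2) (x ξ : ℝ), a U (x + 2 * Real.pi) ξ = a U x ξ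
  smooth : ∀ U : Fin p → CInf2, ContDiff ℝ ∞ (fun y : ℝ × ℝ => a U y.1 y.2)
  bound : ∃ μ : ℝ, 0 < μ ∧ ∀ α β : ℕ, ∃ C : ℝ, 0 < C ∧
    ∀ (U : Fin p → CInf2) (n : Fin p → ℕ) (x ξ : ℝ),
      ‖iteratedDeriv α (fun x' => iteratedDeriv β
          (fun ξ' => a (projTuple n fun i => (U i).toFn2) x' ξ') ξ) x‖ ≤
        C * Real.sqrt (1 + ∑ i, (n i : ℝ) ^ 2) ^ (μ + α) * jb ξ ^ (m - β) *
          ∏ i, l2v (proj2 (n i) (U i).toFn2)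
  spectral : ∀ (U : Fin p → CInf2) (n : Fin p → ℕ) (n₀ : ℕ) (ξ : ℝ),
    proj n₀ (fourierFn fun x => a (projTuple n fun i => (U i).toFn2) x ξ) ≠ 0 →
      SignRelation (Fin.cons (α := fun _ => ℕ) n₀ n)
  expand : ∀ (U : Fin p → CInf2) (x ξ : ℝ),
    HasSum (fun n : Fin p → ℕ => a (projTuple n fun i => (U i).toFn2) x ξ) (a U x ξ)

/-- `a(U, …, U; x, ξ)` for Sobolev functions: the extension by the sum of the spectral pieces. -/
def HomSym.eval {p : ℕ} (a : HomSym p) (U : Fn2) (x ξ : ℝ) : ℂ :=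
  ∑' n : Fin p → ℕ, a (projTuple n fun _ => U) x ξ

/-- `D κ α β` is the mixed partial derivative `∂_t^κ ∂_x^α ∂_ξ^β g` on `I × ℝ × ℝ`, for `κ ≤ k`,
`α ≤ A` and every `β`; all of these exist and are continuous. -/
structure IsJet (I : Set ℝ) (k : ℕ) (A : ℝ) (g : ℝ → ℝ → ℝ → ℂ)
    (D : ℕ → ℕ → ℕ → ℝ → ℝ → ℝ → ℂ) : Prop where
  base : ∀ t ∈ I, D 0 0 0 t = g t
  cont : ∀ κ ≤ k, ∀ α : ℕ, (α : ℝ) ≤ A → ∀ β,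
    ContinuousOn (fun y : ℝ × ℝ × ℝ => D κ α β y.1 y.2.1 y.2.2) (I ×ˢ Set.univ)
  deriv_t : ∀ κ < k, ∀ α : ℕ, (α : ℝ) ≤ A → ∀ β, ∀ t ∈ I, ∀ x ξ,
    HasDerivWithinAt (fun τ => D κ α β τ x ξ) (D (κ + 1) α β t x ξ) I t
  deriv_x : ∀ κ ≤ k, ∀ α : ℕ, (α : ℝ) + 1 ≤ A → ∀ β, ∀ t ∈ I, ∀ x ξ,
    HasDerivAt (fun x' => D κ α β t x' ξ) (D κ (α + 1) β t x ξ) x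
  deriv_xi : ∀ κ ≤ k, ∀ α : ℕ, (α : ℝ) ≤ A → ∀ β, ∀ t ∈ I, ∀ x ξ,
    HasDerivAt (fun ξ' => D κ α β t x ξ') (D κ α (β + 1) t x ξ) ξ

/-- The class `Γ^m_{K,0,p}[r, aut]` of autonomous non-homogeneous symbols; for time dependent `U`
the symbol is `a(U(t); x, ξ)`. -/
structure IsNonhomSymbol (I : Set ℝ) (m : ℝ) (K p : ℕ) (r s₀ : ℝ) (a : Fn2 → ℝ → ℝ → ℂ) :
    Prop where
  periodic : ∀ U, MemHs2 s₀ U → hsNorm2 s₀ U < r → ∀ x ξ, a U (x + 2 * Real.pi) ξ = a U x ξ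
  bound : ∀ k ≤ K, ∀ s ≥ s₀, ∃ C : ℝ, 0 < C ∧ ∃ rs : ℝ, 0 < rs ∧ rs < r ∧
    ∀ U : ℝ → Fn2, MemBall I K s₀ rs U → MemCK2 I k s U →
      ∃ D, IsJet I k (s - s₀) (fun t => a (U t)) D ∧
        ∀ α β : ℕ, (α : ℝ) ≤ s - s₀ → ∀ t ∈ I, ∀ x ξ,
          ‖D k α β t x ξ‖ ≤
            C * jb ξ ^ (m - β) * normK2 I k s₀ U t ^ (p - 1) * normK2 I k s U t

/-- A multilinear expansion `∑_q a_q(U, …, U; x, ξ) + a_N(U; x, ξ)` of a symbol. -/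
structure SymExp where
  hom : (q : ℕ) → HomSym q
  rem : Fn2 → ℝ → ℝ → ℂ

/-- `a(U; x, ξ) = ∑_{q=p}^{N-1} a_q(U, …, U; x, ξ) + a_N(U; x, ξ)`. -/
def SymExp.eval (p N : ℕ) (a : SymExp) (U : Fn2) (x ξ : ℝ) : ℂ :=
  (∑ q ∈ Finset.Ico p N, (a.hom q).eval U x ξ) + a.rem U x ξ

/-- The class `ΣΓ^m_{K,0,p}[r, N, aut]`. -/
def IsSigmaSymbol (I : Set ℝ) (m : ℝ) (K p N : ℕ) (r s₀ : ℝ) (a : SymExp) : Prop :=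
  (∀ q ∈ Finset.Ico p N, IsHomSymbol m q (a.hom q)) ∧ IsNonhomSymbol I m K N r s₀ a.rem

/-- The class `ΣF_{K,0,p}[r, N, aut]`: symbols of order `0` that do not depend on `ξ`. -/
def IsSigmaFunction (I : Set ℝ) (K p N : ℕ) (r s₀ : ℝ) (a : SymExp) : Prop :=
  IsSigmaSymbol I 0 K p N r s₀ a ∧
  (∀ q ∈ Finset.Ico p N, ∀ U x ξ η, a.hom q U x ξ = a.hom q U x η) ∧
  ∀ U, MemHs2 s₀ U → hsNorm2 s₀ U < r → ∀ x ξ η, a.rem U x ξ = a.rem U x η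

/-! ### The Bony-Weyl quantization -/

/-- Admissible cut-off functions on `ℝ^p × ℝ`. The last condition bounds all mixed partial
derivatives of total order `n` by `C ⟨ξ⟩^{-n}`. -/
structure IsAdmissibleCutoff (p : ℕ) (δ : ℝ) (χ : EuclideanSpace ℝ (Fin p) → ℝ → ℝ) : Prop where
  smooth : ContDiff ℝ ∞ (fun y : EuclideanSpace ℝ (Fin p) × ℝ => χ y.1 y.2)
  even_left : ∀ (y z : EuclideanSpace ℝ (Fin p)) (i : Fin p), z i = -y i →
    (∀ j, j ≠ i → z j = y j) → ∀ ξ, χ z ξ = χ y ξ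
  even_right : ∀ y ξ, χ y (-ξ) = χ y ξ
  support : ∀ y ξ, δ * jb ξ < ‖y‖ → χ y ξ = 0
  eq_one : ∀ y ξ, ‖y‖ ≤ δ / 2 * jb ξ → χ y ξ = 1
  bound : ∀ n : ℕ, ∃ C : ℝ, ∀ (y : EuclideanSpace ℝ (Fin p)) (ξ : ℝ),
    ‖iteratedFDeriv ℝ n (fun y : EuclideanSpace ℝ (Fin p) × ℝ => χ y.1 y.2) (y, ξ)‖ ≤
      C * jb ξ ^ (-(n : ℝ))

/-- The cut-off functions of the quantization: `hom p` on `ℝ^p × ℝ` for `p`-homogeneous symbols and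
`non` on `ℝ × ℝ` for non-homogeneous symbols. -/
structure Cutoffs where
  hom : (p : ℕ) → EuclideanSpace ℝ (Fin p) → ℝ → ℝ
  non : EuclideanSpace ℝ (Fin 1) → ℝ → ℝ

def Cutoffs.Admissible (χ : Cutoffs) (δ : ℝ) : Prop :=
  (∀ p, 1 ≤ p → IsAdmissibleCutoff p δ (χ.hom p)) ∧ IsAdmissibleCutoff 1 δ χ.non

/-- The Weyl quantization: the `k`-th Fourier coefficient of `Op^W(c)u` is
`(2π)^{-1/2} ∑_j ĉ(k - j, (k + j)/2) û(j)`. -/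
def opW (c : ℝ → ℝ → ℂ) (u : Fn) : Fn := fun k =>
  ((Real.sqrt (2 * Real.pi) : ℝ) : ℂ)⁻¹ *
    ∑' j : ℤ, fourierFn (fun x => c x (((k : ℝ) + j) / 2)) (k - j) * u j

/-- `a_χ(U, …, U; x, ξ) = ∑_n χ_p(n, ξ) a(Π_n U; x, ξ)` (a finite sum for each `ξ`). -/
def HomSym.truncate {p : ℕ} (χ : Cutoffs) (a : HomSym p) (U : Fn2) (x ξ : ℝ) : ℂ :=
  ∑' n : Fin p → ℕ,
    (χ.hom p (WithLp.toLp 2 fun i => (n i : ℝ)) ξ : ℂ) * a (projTuple n fun _ => U) x ξ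

/-- `b_χ(x, ξ) = (2π)^{-1/2} ∑_η χ(η, ξ) b̂(η, ξ) e^{iηx}` (a finite sum for each `ξ`). -/
def truncateNon (χ : Cutoffs) (b : ℝ → ℝ → ℂ) (x ξ : ℝ) : ℂ :=
  evalFn (fun η : ℤ => (χ.non (WithLp.toLp 2 fun _ => (η : ℝ)) ξ : ℂ) * fourierFn (fun x' => b x' ξ) η) x

/-- The Bony-Weyl quantization `Op^{BW}(a(U; ·))u` of a symbol with a multilinear expansion. -/
def SymExp.opBW (χ : Cutoffs) (p N : ℕ) (a : SymExp) (U : Fn2) (u : Fn) : Fn :=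
  (∑ q ∈ Finset.Ico p N, opW ((a.hom q).truncate χ U) u) + opW (truncateNon χ (a.rem U)) u

/-! ### Matrices, reality, reversibility and parity -/

def matEval (p N : ℕ) (A : Matrix (Fin 2) (Fin 2) SymExp) (U : Fn2) (x ξ : ℝ) :
    Matrix (Fin 2) (Fin 2) ℂ := Matrix.of fun i j => (A i j).eval p N U x ξ

def matOpBW (χ : Cutoffs) (p N : ℕ) (A : Matrix (Fin 2) (Fin 2) SymExp) (U V : Fn2) : Fn2 :=
  fun i => ∑ j, (A i j).opBW χ p N U (V j)

def matOp (p N : ℕ) (R : Matrix (Fin 2) (Fin 2) OpExp) (U V : Fn2) : Fn2 :=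
  fun i => ∑ j, (R i j).eval p N U (V j)

def swapMat : Matrix (Fin 2) (Fin 2) ℂ := !![0, 1; 1, 0]

/-- The phase space: `U ∈ 𝐇^s` (so `U = (u, conj u)`) with `‖U‖_{H^s} < r`. -/
def MemPhase (s r : ℝ) (U : Fn2) : Prop := MemHs2 s U ∧ hsNorm2 s U < r ∧ IsRealPair U

/-- (R,R,P) matrices of autonomous symbols: reality, reversibility and parity preserving. With
`U_S(t) = S U(-t)`, reversibility `S A(U; -t, x, ξ) = A(U_S; t, x, ξ) S` reads
`S A(U; x, ξ) = A(SU; x, ξ) S` when `A` depends on time through `U(t)` only. -/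
structure IsRRPSymbol (s r : ℝ) (A : Fn2 → ℝ → ℝ → Matrix (Fin 2) (Fin 2) ℂ) : Prop where
  reality : ∀ U, MemPhase s r U → ∀ x ξ,
    (A U x (-ξ)).map (fun z => conj z) = swapMat * A U x ξ * swapMat
  reversibility : ∀ U, MemPhase s r U → ∀ x ξ, swapMat * A U x ξ = A (swapFn2 U) x ξ * swapMat
  parity : ∀ U, MemPhase s r U → tauFn2 U = U → ∀ x ξ, A U x ξ = A U (-x) (-ξ)

/-- (R,R,P) autonomous operators: reality, reversibility and parity preserving. -/
structure IsRRPOperator (s r : ℝ) (M : Fn2 → Fn2 → Fn2) : Prop where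
  reality : ∀ U, MemPhase s r U → ∀ V, MemHs2 s V →
    conjFn2 (M U V) = swapFn2 (M U (swapFn2 (conjFn2 V)))
  reversibility : ∀ U, MemPhase s r U → ∀ V, MemHs2 s V →
    swapFn2 (M U V) = M (swapFn2 U) (swapFn2 V)
  parity : ∀ U, MemPhase s r U → tauFn2 U = U → ∀ V, MemHs2 s V →
    M U (tauFn2 V) = tauFn2 (M U V)

/-! ### The Schrödinger equation -/

/-- The function `f(z₀, z₁, z₂)` given by a polynomial in `z₀, z₁, z₂` (variables `inl`) and
`conj z₀, conj z₁, conj z₂` (variables `inr`). -/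
def polyFun (P : MvPolynomial (Fin 3 ⊕ Fin 3) ℂ) (z₀ z₁ z₂ : ℂ) : ℂ :=
  MvPolynomial.eval (Sum.elim ![z₀, z₁, z₂] ![conj z₀, conj z₁, conj z₂]) P

/-- The Wirtinger derivative `∂_z g = (∂_ξ g - i ∂_η g)/2`, `z = ξ + iη`. -/
def wirtinger (g : ℂ → ℂ) (z : ℂ) : ℂ :=
  (fderiv ℝ g z 1 - Complex.I * fderiv ℝ g z Complex.I) / 2

/-- The assumptions on the nonlinearity: it vanishes at order two at the origin, and it is
parity-preserving, of Schrödinger type and reversibility-preserving. -/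
structure IsAdmissibleNonlinearity (P : MvPolynomial (Fin 3 ⊕ Fin 3) ℂ) : Prop where
  order_two : ∀ d ∈ P.support, 2 ≤ d.degree
  parity : ∀ z₀ z₁ z₂, polyFun P z₀ z₁ z₂ = polyFun P z₀ (-z₁) z₂
  schrodinger : ∀ z₀ z₁ z₂, (wirtinger (fun w => polyFun P z₀ z₁ w) z₂).im = 0
  reversibility : ∀ z₀ z₁ z₂,
    polyFun P z₀ z₁ z₂ = conj (polyFun P (conj z₀) (conj z₁) (conj z₂))

/-- The function `f(u, u_x, u_xx)`. -/
def nonlin (P : MvPolynomial (Fin 3 ⊕ Fin 3) ℂ) (u : Fn) : Fn :=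
  fourierFn fun x => polyFun P (evalFn u x) (evalFn (dx u) x) (evalFn (dx (dx u)) x)

/-- `λ_j = (ij)² + p̂(j)`, `p̂(j) = ∑_{k=1}^M m_k / ⟨j⟩^{2k+1}`. -/
def lam {M : ℕ} (m : Fin M → ℝ) (j : ℤ) : ℂ :=
  (Complex.I * j) ^ 2 + ((∑ k : Fin M, m k / jb j ^ (2 * (k.val + 1) + 1) : ℝ) : ℂ)

/-- `iE[ΛU + G]` with `E = diag(1, -1)` and `Λ = diag(λ, λ)`. -/
def schrodingerField {M : ℕ} (m : Fin M → ℝ) (U G : Fn2) : Fn2 := fun i j =>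
  Complex.I * ((![1, -1] : Fin 2 → ℂ) i) * (lam m j * U i j + G i j)

/-- The right hand side `iE[ΛU + (f(u,u_x,u_xx), conj f(u,u_x,u_xx))]` of the vector NLS. -/
def nlsField {M : ℕ} (m : Fin M → ℝ) (P : MvPolynomial (Fin 3 ⊕ Fin 3) ℂ) (U : Fn2) : Fn2 :=
  schrodingerField m U ![nonlin P (U 0), conjFn (nonlin P (U 0))]

/-- The right hand side `iE[ΛU + Op^{BW}(A(U;x,ξ))U + R(U)U]` of the paralinearized system. -/
def paraField {M : ℕ} (m : Fin M → ℝ) (χ : Cutoffs) (p N : ℕ)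
    (A : Matrix (Fin 2) (Fin 2) SymExp) (R : Matrix (Fin 2) (Fin 2) OpExp) (U : Fn2) : Fn2 :=
  schrodingerField m U (matOpBW χ p N A U U + matOp p N R U U)

/-- `U` solves `∂_t U = X(U)` on `I`. -/
def IsSolution (I : Set ℝ) (X : Fn2 → Fn2) (U : ℝ → Fn2) : Prop :=
  ∀ t ∈ I, ∀ i j, HasDerivWithinAt (fun τ => U τ i j) (X (U t) i j) I t

end ParaNLS

end

open ParaNLS

/-! In Fourier variables the part of degree q+1 of f(u,u_x,u_xx) is a (q+1)-linear multiplier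
evaluated on the diagonal (U,…,U). Each slot carries a component and a frequency j_i, and the kernel
`mainKer` is symmetric in the slots and bounded by a constant times ∏⟨j_i⟩². Let `cutWt` be the
cut-off of the Bony-Weyl quantization, seen as a function of the q frequencies of the symbol and of
the frequency in the last slot, and let `symWt` be its sum over all permutations of the slots,
divided by q!. The proof splits every kernel κ as symWt·κ + (1 − symWt)·κ.

The first piece is exactly paradifferential. On the diagonal the slots may be permuted, so symWt·κ
acts as (q+1)·cutWt·κ (`mulT_cutWt_diag`). With ξ the Weyl frequency, i·j_{q+1} = iξ −
i(j_1+…+j_q)/2, and at most its square occurs, so the symbol is a polynomial of degree two in iξ,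
with no error term and no symbolic calculus (`isWeylCoeff_symB`, `polyExp_opBW`). The factor q+1 is
the one produced by differentiating a symmetric tensor; hence the top coefficient of the (0,0) entry
is ∂_{z_2}f, which is real by assumption (`paraCoef_two_im`).

The second piece is smoothing. If one frequency dominates all others, exactly the q! permutations
that bring it to the last slot contribute 1 and the others 0, so symWt = 1 (`symWt_eq_one`). On the
support of (1 − symWt)·κ the two largest frequencies are therefore comparable, and any number of
derivatives can be moved from the largest to another one (`KerBdd.est_smoothing`,
`isStrongSmoothing_mulT`, `isHomSmoothing_opHom`).

Since f is a polynomial, finitely many q occur: those below N give the homogeneous terms, and the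
remaining ones together form the non-homogeneous term.

All estimates are made in weighted ℓ¹ spaces of Fourier coefficients, where the norm of a tensor
product is the product of the norms. The embeddings H^{σ+1} ⊂ ℓ¹_σ ⊂ H^σ lose one derivative, which
the remainder repays because it smooths to every order. Time derivatives follow from the Leibniz
rule for continuous multilinear maps (`KerEst.cl1`). The (R,R,P) properties reduce to the behaviour
of the kernels under reversal of frequencies, exchange of components and conjugation, which is read
off the coefficients of f. -/

noncomputable section

namespace ParaNLS

/-! ### The Japanese bracket -/

lemma one_le_jb (x : ℝ) : 1 ≤ jb x := by
  unfold jb; rw [Real.one_le_sqrt]; nlinarith [sq_nonneg x]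

lemma jb_pos (x : ℝ) : 0 < jb x := lt_of_lt_of_le one_pos (one_le_jb x)

lemma jb_sq (x : ℝ) : jb x ^ 2 = 1 + x ^ 2 := Real.sq_sqrt (by positivity)

lemma jb_neg (x : ℝ) : jb (-x) = jb x := by simp [jb]

lemma jb_abs (x : ℝ) : jb |x| = jb x := by simp [jb]

lemma abs_le_jb (x : ℝ) : |x| ≤ jb x := Real.abs_le_sqrt (by linarith)

lemma jb_le_one_add_abs (x : ℝ) : jb x ≤ 1 + |x| := by
  apply Real.sqrt_le_iff.2 ⟨by positivity, ?_⟩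
  nlinarith [sq_abs x, abs_nonneg x]

lemma jb_add_le (x y : ℝ) : jb (x + y) ≤ jb x + |y| := by
  have h := abs_le_jb x
  apply Real.sqrt_le_iff.2 ⟨add_nonneg (jb_nonneg _) (abs_nonneg _), ?_⟩
  have h1 : x * y ≤ jb x * |y| := (le_abs_self _).trans (by rw [abs_mul]; gcongr)
  nlinarith [jb_sq x, sq_abs y]

lemma jb_natAbs (j : ℤ) : jb (j.natAbs : ℝ) = jb j := by
  rw [Nat.cast_natAbs, Int.cast_abs, jb_abs]

/-- A single bracket suffices, since ⟨x+y⟩ ≤ ⟨x⟩ + |y|. The sum must be nonempty because ⟨0⟩ = 1. -/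
lemma jb_sum_le {ι : Type*} (s : Finset ι) (hs : s.Nonempty) (f : ι → ℝ) :
    jb (∑ i ∈ s, f i) ≤ ∑ i ∈ s, jb (f i) := by
  classical
  induction hs using Finset.Nonempty.cons_induction with
  | singleton a => simp
  | cons a s ha hs ih =>
    rw [Finset.sum_cons, Finset.sum_cons, add_comm]
    refine (jb_add_le _ _).trans ?_
    have := abs_le_jb (f a)
    linarith

lemma jb_rpow_pos (x s : ℝ) : 0 < jb x ^ s := Real.rpow_pos_of_pos (jb_pos x) s

lemma jb_rpow_le {s t : ℝ} (x : ℝ) (h : s ≤ t) : jb x ^ s ≤ jb x ^ t :=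
  Real.rpow_le_rpow_of_exponent_le (one_le_jb x) h

lemma one_le_jb_rpow {s : ℝ} (x : ℝ) (h : 0 ≤ s) : 1 ≤ jb x ^ s :=
  Real.one_le_rpow (one_le_jb x) h

lemma summable_jb_neg_two : Summable fun j : ℤ => jb j ^ (-2 : ℝ) := by
  have h : Summable fun j : ℤ => 1 / |(j : ℝ)| ^ (2 : ℝ) :=
    Real.summable_one_div_int_pow.2 (by norm_num : 1 < 2) |>.congr (by intro j; simp)
  -- The term 1/|0|² has the value 0, so the index j = 0 needs a separate contribution of 1.
  have h2 := h.add (summable_of_ne_finset_zero (f := fun j : ℤ => if j = 0 then (1 : ℝ) else 0)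
    (s := {0}) (by intro b hb; simp at hb; simp [hb]))
  refine h2.of_nonneg_of_le (fun j => (jb_rpow_pos _ _).le) fun j => ?_
  rw [Real.rpow_neg (jb_nonneg _), ← one_div]
  by_cases hj : j = 0
  · subst hj; simp [jb]
  · have : (0 : ℝ) < |(j : ℝ)| := abs_pos.2 (by exact_mod_cast hj)
    rw [if_neg hj, add_zero]
    gcongr
    exact abs_le_jb _

/-! ### Products of summable families -/

/-- The elementary tensor `J ↦ ∏ i, v i (J i)`. -/
def tens {ι R : Type*} [CommMonoid R] {p : ℕ} (v : Fin p → ι → R) (J : Fin p → ι) : R :=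
  ∏ i, v i (J i)

lemma tens_comp_perm {ι R : Type*} [CommMonoid R] {p : ℕ} (v : Fin p → ι → R)
    (e : Equiv.Perm (Fin p)) (J : Fin p → ι) : tens (v ∘ e) (J ∘ e) = tens v J :=
  Equiv.prod_comp e fun i => v i (J i)

lemma norm_tens {ι : Type*} {p : ℕ} (v : Fin p → ι → ℂ) (J : Fin p → ι) :
    ‖tens v J‖ = tens (fun i l => ‖v i l‖) J := by simp [tens]

/-- `(Fin p → ι) × ι ≃ (Fin (p+1) → ι)` by appending the last entry. -/
def snocEquiv (p : ℕ) (ι : Type*) : (Fin p → ι) × ι ≃ (Fin (p + 1) → ι) where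
  toFun x := Fin.snoc x.1 x.2
  invFun J := (fun i => J i.castSucc, J (Fin.last p))
  left_inv x := by simp
  right_inv J := by
    ext i; refine Fin.lastCases ?_ (fun i => ?_) i <;> simp

@[simp] lemma snocEquiv_apply {p : ℕ} {ι : Type*} (x : (Fin p → ι) × ι) :
    snocEquiv p ι x = Fin.snoc x.1 x.2 := rfl

lemma hasSum_tens_of_nonneg {ι : Type*} {p : ℕ} (v : Fin p → ι → ℝ) (a : Fin p → ℝ)
    (h0 : ∀ i l, 0 ≤ v i l) (h : ∀ i, HasSum (v i) (a i)) : HasSum (tens v) (∏ i, a i) := by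
  induction p with
  | zero =>
    have h1 : (tens v) = fun _ : Fin 0 → ι => (1 : ℝ) := by funext J; simp [tens]
    rw [h1, Finset.univ_eq_empty, Finset.prod_empty]
    exact hasSum_unique _
  | succ p ih =>
    have h1 := ih (fun i => v i.castSucc) (fun i => a i.castSucc) (fun i => h0 _) (fun i => h _)
    have h2 := h (Fin.last p)
    have hs := h1.summable.mul_of_nonneg h2.summable
      (fun J => Finset.prod_nonneg fun i _ => h0 _ _) (fun l => h0 _ l)
    have h3 := h1.mul h2 hs
    rw [Fin.prod_univ_castSucc, ← (snocEquiv p ι).hasSum_iff]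
    have hc : tens v ∘ snocEquiv p ι =
        fun x => tens (fun i : Fin p => v i.castSucc) x.1 * v (Fin.last p) x.2 := by
      funext x; simp [tens, Fin.prod_univ_castSucc]
    rw [hc]
    exact h3

lemma summable_norm_tens {ι : Type*} {p : ℕ} (v : Fin p → ι → ℂ)
    (h : ∀ i, Summable fun l => ‖v i l‖) : Summable fun J => ‖tens v J‖ := by
  simp_rw [norm_tens]
  exact (hasSum_tens_of_nonneg _ _ (fun i l => norm_nonneg _) fun i => (h i).hasSum).summable

lemma hasSum_tens {ι : Type*} {p : ℕ} (v : Fin p → ι → ℂ)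
    (h : ∀ i, Summable fun l => ‖v i l‖) : HasSum (tens v) (∏ i, ∑' l, v i l) := by
  induction p with
  | zero =>
    have h1 : (tens v) = fun _ : Fin 0 → ι => (1 : ℂ) := by funext J; simp [tens]
    rw [h1, Finset.univ_eq_empty, Finset.prod_empty]
    exact hasSum_unique _
  | succ p ih =>
    have h1 := ih (fun i => v i.castSucc) (fun i => h _)
    have h2 := (h (Fin.last p)).of_norm.hasSum
    have hs : Summable fun x : (Fin p → ι) × ι =>
        tens (fun i : Fin p => v i.castSucc) x.1 * v (Fin.last p) x.2 :=
      summable_mul_of_summable_norm (summable_norm_tens _ fun i => h i.castSucc) (h (Fin.last p))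
    have h3 := h1.mul h2 hs
    rw [Fin.prod_univ_castSucc, ← (snocEquiv p ι).hasSum_iff]
    have hc : tens v ∘ snocEquiv p ι =
        fun x => tens (fun i : Fin p => v i.castSucc) x.1 * v (Fin.last p) x.2 := by
      funext x; simp [tens, Fin.prod_univ_castSucc]
    rw [hc]
    exact h3

/-! ### Weighted `ℓ¹` spaces -/

/-- Membership in the weighted `ℓ¹` space. -/
def MemW {ι : Type*} (w : ι → ℝ) (f : ι → ℂ) : Prop := Summable fun i => w i * ‖f i‖

/-- The weighted `ℓ¹` norm. -/
def nW {ι : Type*} (w : ι → ℝ) (f : ι → ℂ) : ℝ := ∑' i, w i * ‖f i‖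

/-- A positive weight. -/
class IsWeight {ι : Type*} (w : ι → ℝ) : Prop where
  pos : ∀ i, 0 < w i

lemma MemW.smul {ι : Type*} (w : ι → ℝ) {f : ι → ℂ} (c : ℂ) (hf : MemW w f) : MemW w (c • f) := by
  refine (Summable.mul_left ‖c‖ hf).congr fun i => ?_
  simp [mul_left_comm]

section weighted
variable {ι : Type*} (w : ι → ℝ) [hw : IsWeight w]

lemma nW_nonneg (f : ι → ℂ) : 0 ≤ nW w f :=
  tsum_nonneg fun i => mul_nonneg (hw.pos i).le (norm_nonneg _)

lemma MemW.add {f g : ι → ℂ} (hf : MemW w f) (hg : MemW w g) : MemW w (f + g) := by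
  refine (Summable.add hf hg).of_nonneg_of_le
    (fun i => mul_nonneg (hw.pos i).le (norm_nonneg _)) fun i => ?_
  rw [← mul_add]
  exact mul_le_mul_of_nonneg_left (norm_add_le _ _) (hw.pos i).le

/-- The weighted `ℓ¹` space as a submodule. -/
def subW : Submodule ℂ (ι → ℂ) where
  carrier := {f | MemW w f}
  zero_mem' := by simp [MemW]
  add_mem' := MemW.add w
  smul_mem' c _ h := MemW.smul w c h

/-- The weighted `ℓ¹` space. -/
def WL1 : Type _ := subW w

instance : AddCommGroup (WL1 w) := inferInstanceAs (AddCommGroup (subW w))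
instance : Module ℂ (WL1 w) := inferInstanceAs (Module ℂ (subW w))
instance : Norm (WL1 w) := ⟨fun f => nW w f.1⟩

lemma WL1.norm_def (f : WL1 w) : ‖f‖ = nW w f.1 := rfl

lemma WL1.core : NormedSpace.Core ℂ (WL1 w) where
  norm_nonneg f := nW_nonneg w _
  norm_smul c f := by
    have h : (c • f).1 = c • f.1 := rfl
    rw [WL1.norm_def, WL1.norm_def, h, nW, nW, ← tsum_mul_left]
    exact tsum_congr fun i => by simp [mul_left_comm]
  norm_triangle f g := by
    have h : (f + g).1 = f.1 + g.1 := rfl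
    rw [WL1.norm_def, WL1.norm_def, WL1.norm_def, h, nW, nW, nW, ← Summable.tsum_add f.2 g.2]
    refine Summable.tsum_le_tsum (fun i => ?_) (MemW.add w f.2 g.2) (Summable.add f.2 g.2)
    rw [← mul_add]
    exact mul_le_mul_of_nonneg_left (norm_add_le _ _) (hw.pos i).le
  norm_eq_zero_iff f := by
    constructor
    · intro h
      have h2 : HasSum (fun i => w i * ‖f.1 i‖) 0 := by
        rw [← h]; exact Summable.hasSum f.2
      rw [hasSum_zero_iff_of_nonneg fun i => mul_nonneg (hw.pos i).le (norm_nonneg _)] at h2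
      apply Subtype.ext
      funext i
      have := congrFun h2 i
      simp only [Pi.zero_apply, mul_eq_zero, (hw.pos i).ne', false_or, norm_eq_zero] at this
      exact this
    · rintro rfl
      have h : (0 : WL1 w).1 = 0 := rfl
      simp [WL1.norm_def, h, nW]

instance : NormedAddCommGroup (WL1 w) := NormedAddCommGroup.ofCore (WL1.core w)
instance : NormedSpace ℂ (WL1 w) := NormedSpace.ofCore (WL1.core w)

end weighted

section weighted
variable {ι : Type*} (w : ι → ℝ) [hw : IsWeight w]

/-- The element of the weighted `ℓ¹` space given by a sequence (zero if it is not a member). -/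
def toW (f : ι → ℂ) : WL1 w := by
  classical exact if h : MemW w f then ⟨f, h⟩ else 0

lemma toW_val {w : ι → ℝ} [IsWeight w] {f : ι → ℂ} (h : MemW w f) : (toW w f).1 = f := by
  simp [toW, h]

lemma toW_coe (f : WL1 w) : toW w f.1 = f :=
  Subtype.ext (toW_val f.2)

lemma WL1.add_val (f g : WL1 w) : (f + g).1 = f.1 + g.1 := rfl
lemma WL1.sub_val (f g : WL1 w) : (f - g).1 = f.1 - g.1 := rfl
lemma WL1.smul_val (c : ℂ) (f : WL1 w) : (c • f).1 = c • f.1 := rfl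
lemma WL1.rsmul_val (c : ℝ) (f : WL1 w) : (c • f).1 = (c : ℂ) • f.1 := rfl

lemma WL1.sum_val {κ : Type*} (s : Finset κ) (f : κ → WL1 w) :
    (∑ k ∈ s, f k).1 = ∑ k ∈ s, (f k).1 := map_sum (subW w).subtype f s

lemma norm_coord_le (f : WL1 w) (i : ι) : w i * ‖f.1 i‖ ≤ ‖f‖ :=
  Summable.le_tsum (show MemW w f.1 from f.2) i
    fun j _ => mul_nonneg (hw.pos j).le (norm_nonneg _)

/-- The coordinate functional. -/
def coordW (i : ι) : WL1 w →L[ℂ] ℂ :=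
  LinearMap.mkContinuous ⟨⟨fun f => f.1 i, fun _ _ => rfl⟩, fun _ _ => rfl⟩ (w i)⁻¹ fun f => by
    rw [inv_mul_eq_div, le_div_iff₀ (hw.pos i), mul_comm]
    exact norm_coord_le w f i

/-- This multiplier turns a finite sum of norms into the value of one linear functional. -/
lemma exists_mul_eq_norm (z : ℂ) : ∃ c : ℂ, ‖c‖ ≤ 1 ∧ c * z = ‖z‖ := by
  by_cases h : z = 0
  · exact ⟨0, by simp, by simp [h]⟩
  · refine ⟨conj z / ‖z‖, ?_, ?_⟩
    · simp [h]
    · have : (‖z‖ : ℂ) ≠ 0 := by simpa using h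
      rw [div_mul_eq_mul_div, mul_comm, Complex.mul_conj, Complex.normSq_eq_norm_sq,
        div_eq_iff this]
      push_cast; ring

/-- Finite partial sums of the norm of the Taylor remainder are values of scalar functions whose
derivatives are at most ε near t, by norm continuity of `v'`. The mean value inequality bounds them
uniformly in the finite set. -/
lemma hasDerivWithinAt_of_coord {I : Set ℝ} (hI : I.OrdConnected) {v v' : ℝ → WL1 w}
    (h : ∀ t ∈ I, ∀ i, HasDerivWithinAt (fun τ => (v τ).1 i) ((v' t).1 i) I t)
    (hc : ContinuousOn v' I) {t : ℝ} (ht : t ∈ I) : HasDerivWithinAt v (v' t) I t := by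
  rw [hasDerivWithinAt_iff_isLittleO, Asymptotics.isLittleO_iff]
  intro ε hε
  obtain ⟨δ, hδ, hb⟩ := Metric.continuousWithinAt_iff.1 (hc t ht) ε hε
  have hball : ∀ᶠ τ in 𝓝[I] t, τ ∈ I ∩ Metric.ball t δ := by
    filter_upwards [self_mem_nhdsWithin, mem_nhdsWithin_of_mem_nhds (Metric.ball_mem_nhds t hδ)]
      with τ h1 h2 using ⟨h1, h2⟩
  filter_upwards [hball] with τ hτ
  have hconv : Convex ℝ (I ∩ Metric.ball t δ) := hI.convex.inter (convex_ball t δ)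
  rw [WL1.norm_def]
  refine (show MemW w (v τ - v t - (τ - t) • v' t).1 from
    (v τ - v t - (τ - t) • v' t).2).tsum_le_of_sum_le fun F => ?_
  set z : ι → ℂ := (v τ - v t - (τ - t) • v' t).1 with hz
  choose c hc1 hc2 using fun i => exists_mul_eq_norm (z i)
  -- The factors `c i` are frozen at the final time τ, so φ is one differentiable scalar function
  -- and φ τ − φ t is exactly the partial sum of the norm.
  let φ : ℝ → ℂ := fun s => ∑ i ∈ F, (w i : ℂ) * (c i * ((v s).1 i - s * (v' t).1 i))
  have hφ : ∀ s ∈ I ∩ Metric.ball t δ, HasDerivWithinAt φ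
      (∑ i ∈ F, (w i : ℂ) * (c i * ((v' s).1 i - (v' t).1 i))) (I ∩ Metric.ball t δ) s := by
    intro s hs
    refine HasDerivWithinAt.fun_sum fun i _ => ?_
    refine HasDerivWithinAt.const_mul _ (HasDerivWithinAt.const_mul _ ?_)
    have h1 := (h s hs.1 i).mono (s := I ∩ Metric.ball t δ) Set.inter_subset_left
    have h2 : HasDerivWithinAt (fun s : ℝ => (s : ℂ) * (v' t).1 i) ((v' t).1 i)
        (I ∩ Metric.ball t δ) s := by
      simpa using ((hasDerivAt_id s).ofReal_comp.mul_const ((v' t).1 i)).hasDerivWithinAt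
    exact h1.sub h2
  have hbd : ∀ s ∈ I ∩ Metric.ball t δ,
      ‖∑ i ∈ F, (w i : ℂ) * (c i * ((v' s).1 i - (v' t).1 i))‖ ≤ ε := by
    intro s hs
    have hlt := (hb hs.1 hs.2).le
    rw [dist_eq_norm] at hlt
    refine le_trans ?_ hlt
    rw [WL1.norm_def]
    refine (norm_sum_le _ _).trans (le_trans ?_ (Summable.sum_le_tsum F
      (fun i _ => mul_nonneg (hw.pos i).le (norm_nonneg _))
      (show MemW w (v' s - v' t).1 from (v' s - v' t).2)))
    refine Finset.sum_le_sum fun i _ => ?_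
    rw [norm_mul, norm_mul, Complex.norm_real, Real.norm_of_nonneg (hw.pos i).le, WL1.sub_val,
      Pi.sub_apply]
    refine mul_le_mul_of_nonneg_left ?_ (hw.pos i).le
    exact mul_le_of_le_one_left (norm_nonneg _) (hc1 i)
  have key := hconv.norm_image_sub_le_of_norm_hasDerivWithin_le hφ hbd
    ⟨ht, Metric.mem_ball_self hδ⟩ hτ
  have heq : φ τ - φ t = ((∑ i ∈ F, w i * ‖z i‖ : ℝ) : ℂ) := by
    simp only [φ, ← Finset.sum_sub_distrib]
    push_cast
    refine Finset.sum_congr rfl fun i _ => ?_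
    rw [← hc2 i, hz, WL1.sub_val, WL1.sub_val, WL1.rsmul_val]
    simp only [Pi.sub_apply, Pi.smul_apply, smul_eq_mul]
    push_cast; ring
  rw [heq, Complex.norm_real] at key
  exact (le_abs_self _).trans key

end weighted

/-! ### Time dependent families of sequences -/

/-- The coefficientwise derivative of order `κ` in time. -/
def dtI {ι : Type*} (I : Set ℝ) (κ : ℕ) (v : ℝ → ι → ℂ) (t : ℝ) : ι → ℂ :=
  fun i => iteratedDerivWithin κ (fun τ => v τ i) I t

/-- `k` continuous derivatives in time with values in a weighted `ℓ¹` space. -/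
structure CL1 {ι : Type*} (I : Set ℝ) (k : ℕ) (w : ι → ℝ) [IsWeight w] (v : ℝ → ι → ℂ) :
    Prop where
  smooth : ∀ i, ContDiffOn ℝ k (fun t => v t i) I
  mem : ∀ κ ≤ k, ∀ t ∈ I, MemW w (dtI I κ v t)
  cont : ∀ κ ≤ k, ContinuousOn (fun t => toW w (dtI I κ v t)) I

lemma IsTimeInterval.uniqueDiffOn {I : Set ℝ} (hI : IsTimeInterval I) : UniqueDiffOn ℝ I := by
  apply uniqueDiffOn_convex hI.ordConnected.convex
  obtain ⟨a, ha, b, hb, hab⟩ := hI.nontrivial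
  rcases lt_or_gt_of_ne hab with h | h
  · refine ⟨(a + b) / 2, interior_mono (hI.ordConnected.out ha hb) ?_⟩
    rw [interior_Icc]; constructor <;> linarith
  · refine ⟨(a + b) / 2, interior_mono (hI.ordConnected.out hb ha) ?_⟩
    rw [interior_Icc]; constructor <;> linarith

/-- Unique differentiability on the interval identifies any chain of successive derivatives with the
iterated derivatives. -/
lemma contDiffOn_of_hasDerivWithinAt_chain {I : Set ℝ} (hI : IsTimeInterval I) {k : ℕ}
    {f : ℝ → ℂ} {Ψ : ℕ → ℝ → ℂ} (h0 : ∀ t ∈ I, f t = Ψ 0 t)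
    (hd : ∀ κ < k, ∀ t ∈ I, HasDerivWithinAt (Ψ κ) (Ψ (κ + 1) t) I t)
    (hc : ContinuousOn (Ψ k) I) :
    ContDiffOn ℝ k f I ∧ ∀ κ ≤ k, ∀ t ∈ I, iteratedDerivWithin κ f I t = Ψ κ t := by
  have hU := hI.uniqueDiffOn
  have h1 : ∀ κ ≤ k, ∀ t ∈ I, iteratedDerivWithin κ f I t = Ψ κ t := by
    intro κ
    induction κ with
    | zero => intro _ t ht; simpa using h0 t ht
    | succ κ ih =>
      intro hκ t ht
      rw [iteratedDerivWithin_succ, derivWithin_congr (ih (by omega)) (ih (by omega) t ht)]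
      exact (hd κ (by omega) t ht).derivWithin (hU t ht)
  refine ⟨?_, h1⟩
  have hcont : ∀ κ ≤ k, ContinuousOn (Ψ κ) I := by
    intro κ hκ
    rcases hκ.eq_or_lt with rfl | hlt
    · exact hc
    · exact fun t ht => (hd κ hlt t ht).continuousWithinAt
  apply contDiffOn_of_continuousOn_differentiableOn_deriv
  · intro m hm
    have hm' : m ≤ k := by exact_mod_cast hm
    exact (hcont m hm').congr (h1 m hm')
  · intro m hm
    have hm' : m < k := by exact_mod_cast hm
    intro t ht
    exact ((hd m hm' t ht).differentiableWithinAt).congr (h1 m hm'.le) (h1 m hm'.le t ht)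

/-- The working criterion for `CL1`: it is enough to exhibit the successive derivatives as elements
of the weighted space. -/
lemma CL1.of_chain {ι : Type*} {w : ι → ℝ} [IsWeight w] {I : Set ℝ} (hI : IsTimeInterval I)
    {k : ℕ} {u : ℝ → ι → ℂ} {Φ : ℕ → ℝ → WL1 w} (h0 : ∀ t ∈ I, u t = (Φ 0 t).1)
    (hd : ∀ κ < k, ∀ t ∈ I, HasDerivWithinAt (Φ κ) (Φ (κ + 1) t) I t)
    (hc : ContinuousOn (Φ k) I) :
    CL1 I k w u ∧ ∀ κ ≤ k, ∀ t ∈ I, dtI I κ u t = (Φ κ t).1 := by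
  have h1 : ∀ i, ContDiffOn ℝ k (fun t => u t i) I ∧
      ∀ κ ≤ k, ∀ t ∈ I, iteratedDerivWithin κ (fun t => u t i) I t = (Φ κ t).1 i := by
    intro i
    refine contDiffOn_of_hasDerivWithinAt_chain hI (Ψ := fun κ t => (Φ κ t).1 i)
      (fun t ht => by rw [h0 t ht]) (fun κ hκ t ht => ?_) ?_
    · exact ((coordW w i).restrictScalars ℝ).hasFDerivAt.comp_hasDerivWithinAt t (hd κ hκ t ht)
    · exact (coordW w i).continuous.comp_continuousOn hc
  have h2 : ∀ κ ≤ k, ∀ t ∈ I, dtI I κ u t = (Φ κ t).1 :=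
    fun κ hκ t ht => funext fun i => (h1 i).2 κ hκ t ht
  have hcont : ∀ κ ≤ k, ContinuousOn (Φ κ) I := by
    intro κ hκ
    rcases hκ.eq_or_lt with rfl | hlt
    · exact hc
    · exact fun t ht => (hd κ hlt t ht).continuousWithinAt
  refine ⟨⟨fun i => (h1 i).1, fun κ hκ t ht => ?_, fun κ hκ => ?_⟩, h2⟩
  · rw [h2 κ hκ t ht]; exact (Φ κ t).2
  · refine (hcont κ hκ).congr fun t ht => ?_
    rw [h2 κ hκ t ht, toW_coe]

/-- Conversely, the coefficientwise derivatives are derivatives in norm, so that the chain rule for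
continuous multilinear maps applies. -/
lemma CL1.hasDerivWithinAt {ι : Type*} {w : ι → ℝ} [IsWeight w] {I : Set ℝ}
    (hI : IsTimeInterval I) {k : ℕ} {v : ℝ → ι → ℂ} (h : CL1 I k w v) {κ : ℕ} (hκ : κ < k)
    {t : ℝ} (ht : t ∈ I) :
    HasDerivWithinAt (fun t => toW w (dtI I κ v t)) (toW w (dtI I (κ + 1) v t)) I t := by
  refine hasDerivWithinAt_of_coord w hI.ordConnected (v' := fun t => toW w (dtI I (κ + 1) v t))
    (fun t ht i => ?_) (h.cont (κ + 1) hκ) ht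
  have h1 := ((h.smooth i).differentiableOn_iteratedDerivWithin (m := κ)
    (by exact_mod_cast hκ) hI.uniqueDiffOn t ht).hasDerivWithinAt
  rw [← iteratedDerivWithin_succ] at h1
  rw [toW_val (h.mem (κ + 1) hκ t ht)]
  refine h1.congr (fun τ hτ => ?_) ?_
  · rw [toW_val (h.mem κ hκ.le τ hτ)]; rfl
  · rw [toW_val (h.mem κ hκ.le t ht)]; rfl

/-! ### Multilinear Fourier multipliers -/

/-- Indices of the Fourier coefficients of a `ℂ²`-valued function. -/
abbrev Idx : Type := Fin 2 × ℤ

/-- The Fourier coefficients of a `ℂ²`-valued function as a single family. -/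
def un (U : Fn2) : Idx → ℂ := fun J => U J.1 J.2

/-- The weight `⟨j⟩^σ` on `Idx`. -/
def wt2 (σ : ℝ) : Idx → ℝ := fun J => jb J.2 ^ σ

/-- The weight `⟨j⟩^σ` on `ℤ`. -/
def wt1 (σ : ℝ) : ℤ → ℝ := fun j => jb j ^ σ

instance (σ : ℝ) : IsWeight (wt2 σ) := ⟨fun _ => jb_rpow_pos _ _⟩
instance (σ : ℝ) : IsWeight (wt1 σ) := ⟨fun _ => jb_rpow_pos _ _⟩

/-- The total frequency. -/
def frq {p : ℕ} (J : Fin p → Idx) : ℤ := ∑ i, (J i).2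

lemma frq_snoc {p : ℕ} (J : Fin p → Idx) (l : Idx) :
    frq (Fin.snoc J l : Fin (p + 1) → Idx) = frq J + l.2 := by
  simp [frq, Fin.sum_univ_castSucc]

lemma frq_comp_perm {p : ℕ} (J : Fin p → Idx) (e : Equiv.Perm (Fin p)) : frq (J ∘ e) = frq J :=
  Equiv.sum_comp e fun i => (J i).2

/-- Used with two maps: the total frequency, to pass between multi-indices and Fourier coefficients,
and the moduli of the frequencies, to pass to spectral pieces. -/
lemma hasSum_fiber {α β : Type*} [DecidableEq β] (f : α → β) {F : α → ℂ} (hF : Summable F) :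
    HasSum (fun b => ∑' a, if f a = b then F a else 0) (∑' a, F a) := by
  have h := hF.hasSum.tsum_fiberwise f
  have h2 : (fun b => ∑' a, if f a = b then F a else 0) =
      fun b => ∑' a : ↑(f ⁻¹' {b}), F a := by
    funext b
    rw [tsum_subtype]
    refine tsum_congr fun a => ?_
    by_cases hb : f a = b
    · rw [Set.indicator_of_mem (by exact hb), if_pos hb]
    · rw [Set.indicator_of_notMem (by exact hb), if_neg hb]
  rw [h2]
  exact h

lemma hasSum_fiber_real {α β : Type*} [DecidableEq β] (f : α → β) {F : α → ℝ} (hF : Summable F) :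
    HasSum (fun b => ∑' a, if f a = b then F a else 0) (∑' a, F a) := by
  have h := hF.hasSum.tsum_fiberwise f
  have h2 : (fun b => ∑' a, if f a = b then F a else 0) =
      fun b => ∑' a : ↑(f ⁻¹' {b}), F a := by
    funext b
    rw [tsum_subtype]
    refine tsum_congr fun a => ?_
    by_cases hb : f a = b
    · rw [Set.indicator_of_mem (by exact hb), if_pos hb]
    · rw [Set.indicator_of_notMem (by exact hb), if_neg hb]
  rw [h2]
  exact h

lemma Summable.ite_of_norm {α : Type*} {F : α → ℂ} (h : Summable fun a => ‖F a‖)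
    (P : α → Prop) [DecidablePred P] : Summable fun a => ‖if P a then F a else 0‖ :=
  h.of_nonneg_of_le (fun _ => norm_nonneg _) fun a => by split_ifs <;> simp

/-- The `p`-linear Fourier multiplier with kernel `𝒦`. -/
def mulT {p : ℕ} (𝒦 : (Fin p → Idx) → ℂ) (v : Fin p → Idx → ℂ) : ℤ → ℂ := fun k =>
  ∑' J : Fin p → Idx, if frq J = k then 𝒦 J * tens v J else 0

/-- The weight is constant on each set of multi-indices with given total frequency, so the triangle
inequality on these sets gives the bound. -/
lemma mulT_memW_of_summable {p : ℕ} {𝒦 : (Fin p → Idx) → ℂ} {v : Fin p → Idx → ℂ} {θ : ℝ}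
    (hθ : 0 ≤ θ) (h : Summable fun J => jb (frq J) ^ θ * ‖𝒦 J * tens v J‖) :
    MemW (wt1 θ) (mulT 𝒦 v) ∧
      nW (wt1 θ) (mulT 𝒦 v) ≤ ∑' J, jb (frq J) ^ θ * ‖𝒦 J * tens v J‖ := by
  have h0 : Summable fun J => ‖𝒦 J * tens v J‖ :=
    h.of_nonneg_of_le (fun _ => norm_nonneg _) fun _ =>
      le_mul_of_one_le_left (norm_nonneg _) (one_le_jb_rpow _ hθ)
  have h1 := hasSum_fiber_real frq h
  have hle : ∀ k : ℤ, wt1 θ k * ‖mulT 𝒦 v k‖ ≤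
      ∑' J, if frq J = k then jb (frq J) ^ θ * ‖𝒦 J * tens v J‖ else 0 := by
    intro k
    have h2 : ∀ J : Fin p → Idx, (if frq J = k then jb (frq J) ^ θ * ‖𝒦 J * tens v J‖ else 0) =
        wt1 θ k * ‖if frq J = k then 𝒦 J * tens v J else 0‖ := by
      intro J; split_ifs with hk
      · rw [hk]; rfl
      · simp
    simp_rw [h2]
    rw [tsum_mul_left]
    exact mul_le_mul_of_nonneg_left (norm_tsum_le_tsum_norm (Summable.ite_of_norm h0 _))
      (jb_rpow_pos _ _).le
  have hm : MemW (wt1 θ) (mulT 𝒦 v) := h1.summable.of_nonneg_of_le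
    (fun k => mul_nonneg (jb_rpow_pos _ _).le (norm_nonneg _)) hle
  exact ⟨hm, h1.tsum_eq ▸ Summable.tsum_le_tsum hle hm h1.summable⟩

/-- A tame estimate for the kernel of a multilinear Fourier multiplier. -/
structure KerEst {p : ℕ} (𝒦 : (Fin p → Idx) → ℂ) (θ σ ν C : ℝ) : Prop where
  nonneg : 0 ≤ θ
  le : ν ≤ σ
  const_nonneg : 0 ≤ C
  bound : ∀ J, ‖𝒦 J‖ * jb (frq J) ^ θ ≤ C * ∑ a, ∏ i, wt2 (if i = a then σ else ν) (J i)

lemma MemW.wt2_mono {σ ν : ℝ} (h : ν ≤ σ) {f : Idx → ℂ} (hf : MemW (wt2 σ) f) :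
    MemW (wt2 ν) f :=
  Summable.of_nonneg_of_le (fun _ => mul_nonneg (jb_rpow_pos _ _).le (norm_nonneg _))
    (fun _ => mul_le_mul_of_nonneg_right (jb_rpow_le _ h) (norm_nonneg _)) hf

lemma MemW.nW_mono {σ ν : ℝ} (h : ν ≤ σ) {f : Idx → ℂ} (hf : MemW (wt2 σ) f) :
    nW (wt2 ν) f ≤ nW (wt2 σ) f :=
  Summable.tsum_le_tsum (fun _ => mul_le_mul_of_nonneg_right (jb_rpow_le _ h) (norm_nonneg _))
    (hf.wt2_mono h) hf

namespace KerEst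
variable {p : ℕ} {𝒦 : (Fin p → Idx) → ℂ} {θ σ ν C : ℝ} (h : KerEst 𝒦 θ σ ν C)
include h

/-- In ℓ¹ the norm of an elementary tensor factorizes. The sum over `a` lets the high weight fall on
one factor at a time, which is what makes the estimate tame. -/
lemma summable_aux {v : Fin p → Idx → ℂ} (hv : ∀ i, MemW (wt2 σ) (v i)) :
    (Summable fun J => jb (frq J) ^ θ * ‖𝒦 J * tens v J‖) ∧
      ∑' J, jb (frq J) ^ θ * ‖𝒦 J * tens v J‖ ≤
        C * ∑ a, ∏ i, nW (wt2 (if i = a then σ else ν)) (v i) := by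
  have h1 : ∀ a : Fin p, HasSum
      (tens fun i J => wt2 (if i = a then σ else ν) J * ‖v i J‖)
      (∏ i, nW (wt2 (if i = a then σ else ν)) (v i)) := fun a =>
    hasSum_tens_of_nonneg _ _ (fun i J => mul_nonneg (jb_rpow_pos _ _).le (norm_nonneg _))
      fun i => by
        refine Summable.hasSum ?_
        split_ifs
        · exact hv i
        · exact (hv i).wt2_mono h.le
  have h2 := (hasSum_sum (s := Finset.univ) fun a _ => h1 a).mul_left C
  have hle : ∀ J, jb (frq J) ^ θ * ‖𝒦 J * tens v J‖ ≤
      C * ∑ a, tens (fun i J => wt2 (if i = a then σ else ν) J * ‖v i J‖) J := by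
    intro J
    have h3 := mul_le_mul_of_nonneg_right (h.bound J) (norm_nonneg (tens v J))
    calc _ = ‖𝒦 J‖ * jb (frq J) ^ θ * ‖tens v J‖ := by rw [norm_mul]; ring
      _ ≤ _ := h3
      _ = _ := by
        rw [mul_assoc, Finset.sum_mul]
        congr 1
        refine Finset.sum_congr rfl fun a _ => ?_
        rw [norm_tens, tens, tens, ← Finset.prod_mul_distrib]
  have hs : Summable fun J => jb (frq J) ^ θ * ‖𝒦 J * tens v J‖ :=
    h2.summable.of_nonneg_of_le
      (fun J => mul_nonneg (jb_rpow_pos _ _).le (norm_nonneg _)) hle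
  exact ⟨hs, h2.tsum_eq ▸ Summable.tsum_le_tsum hle hs h2.summable⟩

lemma summable_norm {v : Fin p → Idx → ℂ} (hv : ∀ i, MemW (wt2 σ) (v i)) :
    Summable fun J => ‖𝒦 J * tens v J‖ :=
  (h.summable_aux hv).1.of_nonneg_of_le (fun _ => norm_nonneg _) fun _ =>
    le_mul_of_one_le_left (norm_nonneg _) (one_le_jb_rpow _ h.nonneg)

lemma memW {v : Fin p → Idx → ℂ} (hv : ∀ i, MemW (wt2 σ) (v i)) :
    MemW (wt1 θ) (mulT 𝒦 v) :=
  (mulT_memW_of_summable h.nonneg (h.summable_aux hv).1).1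

lemma nW_le {v : Fin p → Idx → ℂ} (hv : ∀ i, MemW (wt2 σ) (v i)) :
    nW (wt1 θ) (mulT 𝒦 v) ≤ C * ∑ a, ∏ i, nW (wt2 (if i = a then σ else ν)) (v i) :=
  (mulT_memW_of_summable h.nonneg (h.summable_aux hv).1).2.trans (h.summable_aux hv).2

end KerEst

/-- Evaluation of the elementary tensor at `J` as a multilinear map. -/
def tensMul {p : ℕ} {ι : Type*} (J : Fin p → ι) :
    MultilinearMap ℂ (fun _ : Fin p => ι → ℂ) ℂ :=
  (MultilinearMap.mkPiAlgebra ℂ (Fin p) ℂ).compLinearMap fun i => LinearMap.proj (J i)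

lemma tensMul_apply {p : ℕ} {ι : Type*} (J : Fin p → ι) (v : Fin p → ι → ℂ) :
    tensMul J v = tens v J := by simp [tensMul, tens]

lemma mulT_update_add {p : ℕ} {𝒦 : (Fin p → Idx) → ℂ} [DecidableEq (Fin p)]
    (v : Fin p → Idx → ℂ) (i : Fin p)
    (x y : Idx → ℂ) (hx : Summable fun J => ‖𝒦 J * tens (Function.update v i x) J‖)
    (hy : Summable fun J => ‖𝒦 J * tens (Function.update v i y) J‖) :
    mulT 𝒦 (Function.update v i (x + y)) =
      mulT 𝒦 (Function.update v i x) + mulT 𝒦 (Function.update v i y) := by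
  funext k
  rw [Pi.add_apply]
  unfold mulT
  rw [← Summable.tsum_add (Summable.ite_of_norm hx _).of_norm (Summable.ite_of_norm hy _).of_norm]
  refine tsum_congr fun J => ?_
  split_ifs
  · simp_rw [← tensMul_apply, MultilinearMap.map_update_add, mul_add]
  · simp

lemma mulT_update_smul {p : ℕ} {𝒦 : (Fin p → Idx) → ℂ} [DecidableEq (Fin p)]
    (v : Fin p → Idx → ℂ) (i : Fin p) (c : ℂ) (x : Idx → ℂ) :
    mulT 𝒦 (Function.update v i (c • x)) = c • mulT 𝒦 (Function.update v i x) := by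
  funext k
  rw [Pi.smul_apply]
  unfold mulT
  rw [smul_eq_mul, ← tsum_mul_left]
  refine tsum_congr fun J => ?_
  split_ifs
  · simp_rw [← tensMul_apply, MultilinearMap.map_update_smul, smul_eq_mul]; ring
  · simp

/-- The multilinear Fourier multiplier as a continuous multilinear map of weighted `ℓ¹` spaces. -/
def KerEst.toCMM {p : ℕ} {𝒦 : (Fin p → Idx) → ℂ} {θ σ ν C : ℝ} (h : KerEst 𝒦 θ σ ν C) :
    ContinuousMultilinearMap ℂ (fun _ : Fin p => WL1 (wt2 σ)) (WL1 (wt1 θ)) :=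
  MultilinearMap.mkContinuous
    { toFun := fun v => ⟨mulT 𝒦 fun i => (v i).1, h.memW fun i => (v i).2⟩
      map_update_add' := by
        intro _ v i x y
        have hu : ∀ z : WL1 (wt2 σ), (fun j => (Function.update v i z j).1) =
            Function.update (fun j => (v j).1) i z.1 := by
          intro z; funext j; rw [Function.apply_update (fun _ (z : WL1 (wt2 σ)) => z.1)]
        apply Subtype.ext
        change mulT 𝒦 (fun j => (Function.update v i (x + y) j).1) =
          mulT 𝒦 (fun j => (Function.update v i x j).1) +
            mulT 𝒦 (fun j => (Function.update v i y j).1)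
        rw [hu, hu, hu, WL1.add_val]
        apply mulT_update_add <;>
        · refine h.summable_norm fun j => ?_
          rw [← hu]
          exact (Function.update v i _ j).2
      map_update_smul' := by
        intro _ v i c x
        have hu : ∀ z : WL1 (wt2 σ), (fun j => (Function.update v i z j).1) =
            Function.update (fun j => (v j).1) i z.1 := by
          intro z; funext j; rw [Function.apply_update (fun _ (z : WL1 (wt2 σ)) => z.1)]
        apply Subtype.ext
        change mulT 𝒦 (fun j => (Function.update v i (c • x) j).1) =
          c • mulT 𝒦 (fun j => (Function.update v i x j).1)
        rw [hu, hu, WL1.smul_val]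
        apply mulT_update_smul }
    -- There are p choices of the factor carrying the high weight, and in each of them the low norms
    -- are replaced by high ones.
    (C * p) (by
      intro v
      refine (h.nW_le fun i => (v i).2).trans ?_
      rw [mul_assoc]
      refine mul_le_mul_of_nonneg_left ?_ h.const_nonneg
      refine (Finset.sum_le_card_nsmul _ _ (∏ i, ‖v i‖) fun a _ => ?_).trans_eq (by simp)
      refine Finset.prod_le_prod (fun i _ => nW_nonneg _ _) fun i _ => ?_
      split_ifs
      · exact le_rfl
      · exact MemW.nW_mono h.le (v i).2)

lemma KerEst.toCMM_val {p : ℕ} {𝒦 : (Fin p → Idx) → ℂ} {θ σ ν C : ℝ} (h : KerEst 𝒦 θ σ ν C)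
    (v : Fin p → WL1 (wt2 σ)) : (h.toCMM v).1 = mulT 𝒦 fun i => (v i).1 := rfl

/-! ### The Leibniz rule for time derivatives of multilinear multipliers -/

/-- The number of times `g` takes the value `i`. -/
def cnt {κ p : ℕ} (g : Fin κ → Fin p) (i : Fin p) : ℕ := (Finset.univ.filter (g · = i)).card

lemma cnt_le {κ p : ℕ} (g : Fin κ → Fin p) (i : Fin p) : cnt g i ≤ κ :=
  (Finset.card_filter_le _ _).trans_eq (by simp)

lemma sum_cnt {κ p : ℕ} (g : Fin κ → Fin p) : ∑ i, cnt g i = κ := by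
  have := Finset.card_eq_sum_card_fiberwise (f := g) (s := Finset.univ) (t := Finset.univ)
    (by intro x _; simp)
  simpa [cnt] using this.symm

lemma cnt_snoc {κ p : ℕ} (g : Fin κ → Fin p) (a : Fin p) :
    cnt (Fin.snoc g a : Fin (κ + 1) → Fin p) = Function.update (cnt g) a (cnt g a + 1) := by
  funext i
  simp only [cnt, Finset.card_filter, Fin.sum_univ_castSucc, Fin.snoc_castSucc, Fin.snoc_last,
    Function.update_apply]
  by_cases h : i = a
  · subst h; simp
  · simp [h, Ne.symm h]

/-- Time derivatives of a multilinear Fourier multiplier. -/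
lemma KerEst.cl1 {p : ℕ} {𝒦 : (Fin p → Idx) → ℂ} {θ σ ν C : ℝ} (h : KerEst 𝒦 θ σ ν C)
    {I : Set ℝ} (hI : IsTimeInterval I) {k : ℕ} {v : Fin p → ℝ → Idx → ℂ}
    (hv : ∀ i, CL1 I k (wt2 σ) (v i)) :
    CL1 I k (wt1 θ) (fun t => mulT 𝒦 fun i => v i t) ∧
      ∀ κ ≤ k, ∀ t ∈ I, dtI I κ (fun t => mulT 𝒦 fun i => v i t) t =
        ∑ g : Fin κ → Fin p, mulT 𝒦 fun i => dtI I (cnt g i) (v i) t := by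
  -- The Leibniz rule is indexed by words `g`: the letter `g n` is the factor hit by the n-th
  -- derivative. This avoids multinomial coefficients.
  let Φ : ℕ → ℝ → WL1 (wt1 θ) := fun κ t =>
    ∑ g : Fin κ → Fin p, h.toCMM fun i => toW (wt2 σ) (dtI I (cnt g i) (v i) t)
  have hval : ∀ κ ≤ k, ∀ t ∈ I, (Φ κ t).1 =
      ∑ g : Fin κ → Fin p, mulT 𝒦 fun i => dtI I (cnt g i) (v i) t := by
    intro κ hκ t ht
    simp only [Φ, WL1.sum_val, h.toCMM_val]
    refine Finset.sum_congr rfl fun g _ => ?_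
    congr 1
    funext i
    exact toW_val ((hv i).mem _ ((cnt_le g i).trans hκ) t ht)
  have key := CL1.of_chain hI (Φ := Φ) (k := k) (u := fun t => mulT 𝒦 fun i => v i t) ?_ ?_ ?_
  · exact ⟨key.1, fun κ hκ t ht => (key.2 κ hκ t ht).trans (hval κ hκ t ht)⟩
  · intro t ht
    rw [hval 0 (Nat.zero_le _) t ht]
    simp only [Fintype.sum_unique]
    refine congrArg (mulT 𝒦) ?_
    funext i j
    simp [cnt, dtI]
  · intro κ hκ t ht
    have hd : HasDerivWithinAt (Φ κ) (∑ g : Fin κ → Fin p, ∑ a : Fin p,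
        h.toCMM (Function.update (fun i => toW (wt2 σ) (dtI I (cnt g i) (v i) t)) a
          (toW (wt2 σ) (dtI I (cnt g a + 1) (v a) t)))) I t := by
      refine HasDerivWithinAt.fun_sum fun g _ => ?_
      have h1 : HasDerivWithinAt (fun t i => toW (wt2 σ) (dtI I (cnt g i) (v i) t))
          (fun i => toW (wt2 σ) (dtI I (cnt g i + 1) (v i) t)) I t :=
        hasDerivWithinAt_pi.2 fun i =>
          (hv i).hasDerivWithinAt hI ((cnt_le g i).trans_lt hκ) ht
      have h2 := ((h.toCMM.hasFDerivAt
        (fun i => toW (wt2 σ) (dtI I (cnt g i) (v i) t))).restrictScalars ℝ).comp_hasDerivWithinAt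
          t h1
      simp only [ContinuousLinearMap.coe_restrictScalars',
        ContinuousMultilinearMap.linearDeriv_apply] at h2
      exact h2
    convert hd using 1
    simp only [Φ]
    -- One more derivative appends one letter to the word.
    rw [← (snocEquiv κ (Fin p)).sum_comp, Fintype.sum_prod_type]
    refine Finset.sum_congr rfl fun g _ => Finset.sum_congr rfl fun a _ => ?_
    congr 1
    funext i
    rw [snocEquiv_apply, cnt_snoc]
    by_cases hi : i = a
    · subst hi; simp
    · simp [hi]
  · refine continuousOn_finsetSum _ fun g _ => ?_
    exact h.toCMM.cont.comp_continuousOn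
      (continuousOn_pi.2 fun i => (hv i).cont _ (cnt_le g i))

/-! ### Fourier series with summable coefficients -/

/-- The normalisation `(2π)^{-1/2}`. -/
def nrm : ℂ := ((Real.sqrt (2 * Real.pi) : ℝ) : ℂ)⁻¹

lemma sqrt_two_pi_pos : 0 < Real.sqrt (2 * Real.pi) := Real.sqrt_pos.2 (by positivity)

lemma norm_nrm_le : ‖nrm‖ ≤ 1 := by
  unfold nrm
  rw [norm_inv, Complex.norm_real, Real.norm_of_nonneg sqrt_two_pi_pos.le]
  apply inv_le_one_of_one_le₀
  rw [Real.one_le_sqrt]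
  nlinarith [Real.pi_gt_three]

lemma conj_nrm : conj nrm = nrm := by simp [nrm]

lemma nrm_sq : nrm * nrm * (2 * Real.pi) = 1 := by
  unfold nrm
  have h : ((Real.sqrt (2 * Real.pi) : ℝ) : ℂ) * ((Real.sqrt (2 * Real.pi) : ℝ) : ℂ) =
      2 * Real.pi := by
    rw [← Complex.ofReal_mul, Real.mul_self_sqrt (by positivity)]; push_cast; ring
  rw [← mul_inv, h]
  have : (2 * Real.pi : ℂ) ≠ 0 := by
    exact_mod_cast (by positivity : (2 * Real.pi : ℝ) ≠ 0)
  exact inv_mul_cancel₀ this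

lemma evalFn_eq (u : Fn) (x : ℝ) :
    evalFn u x = nrm * ∑' j : ℤ, u j * Complex.exp (Complex.I * j * x) := rfl

lemma norm_exp_I_int_mul (j : ℤ) (x : ℝ) : ‖Complex.exp (Complex.I * j * x)‖ = 1 := by
  have : Complex.I * j * x = ((j * x : ℝ) : ℂ) * Complex.I := by push_cast; ring
  rw [this, Complex.norm_exp_ofReal_mul_I]

lemma MemW.wt1_mono {σ ν : ℝ} (h : ν ≤ σ) {f : Fn} (hf : MemW (wt1 σ) f) : MemW (wt1 ν) f :=
  Summable.of_nonneg_of_le (fun _ => mul_nonneg (jb_rpow_pos _ _).le (norm_nonneg _))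
    (fun _ => mul_le_mul_of_nonneg_right (jb_rpow_le _ h) (norm_nonneg _)) hf

lemma MemW.nW1_mono {σ ν : ℝ} (h : ν ≤ σ) {f : Fn} (hf : MemW (wt1 σ) f) :
    nW (wt1 ν) f ≤ nW (wt1 σ) f :=
  Summable.tsum_le_tsum (fun _ => mul_le_mul_of_nonneg_right (jb_rpow_le _ h) (norm_nonneg _))
    (hf.wt1_mono h) hf

lemma memW_zero_iff {u : Fn} : MemW (wt1 0) u ↔ Summable fun j => ‖u j‖ := by
  simp [MemW, wt1]

lemma nW_zero (u : Fn) : nW (wt1 0) u = ∑' j, ‖u j‖ := by simp [nW, wt1]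

lemma summable_evalFn {u : Fn} (h : MemW (wt1 0) u) (x : ℝ) :
    Summable fun j : ℤ => u j * Complex.exp (Complex.I * j * x) :=
  Summable.of_norm (by simpa [norm_exp_I_int_mul] using memW_zero_iff.1 h)

lemma norm_evalFn_le {u : Fn} (h : MemW (wt1 0) u) (x : ℝ) : ‖evalFn u x‖ ≤ nW (wt1 0) u := by
  rw [evalFn_eq, norm_mul, nW_zero]
  refine (mul_le_of_le_one_left (norm_nonneg _) norm_nrm_le).trans ?_
  have h1 : Summable fun j : ℤ => ‖u j * Complex.exp (Complex.I * j * x)‖ := by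
    simpa [norm_exp_I_int_mul] using memW_zero_iff.1 h
  refine (norm_tsum_le_tsum_norm h1).trans_eq ?_
  simp [norm_exp_I_int_mul]

lemma evalFn_periodic (u : Fn) (x : ℝ) : evalFn u (x + 2 * Real.pi) = evalFn u x := by
  rw [evalFn_eq, evalFn_eq]
  congr 1
  refine tsum_congr fun j => ?_
  congr 1
  have : Complex.I * j * ((x + 2 * Real.pi : ℝ) : ℂ) =
      Complex.I * j * x + j * (2 * Real.pi * Complex.I) := by push_cast; ring
  rw [this, Complex.exp_add, Complex.exp_int_mul_two_pi_mul_I, mul_one]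

lemma continuous_evalFn {u : Fn} (h : MemW (wt1 0) u) : Continuous (evalFn u) := by
  unfold evalFn
  refine continuous_const.mul (continuous_tsum (u := fun j => ‖u j‖) (fun j => by fun_prop)
    (memW_zero_iff.1 h) fun j x => by simp [norm_exp_I_int_mul])

lemma norm_dx (u : Fn) (j : ℤ) : ‖dx u j‖ ≤ jb j * ‖u j‖ := by
  simp only [dx, norm_mul, Complex.norm_I, one_mul, Complex.norm_intCast]
  exact mul_le_mul_of_nonneg_right (abs_le_jb _) (norm_nonneg _)

lemma wt1_mul_norm_dx_le (u : Fn) (θ : ℝ) (j : ℤ) :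
    wt1 θ j * ‖dx u j‖ ≤ wt1 (θ + 1) j * ‖u j‖ := by
  refine (mul_le_mul_of_nonneg_left (norm_dx u j) (jb_rpow_pos _ _).le).trans_eq ?_
  simp only [wt1]
  rw [Real.rpow_add_one (jb_pos _).ne', mul_assoc]

lemma MemW.dx {θ : ℝ} {u : Fn} (h : MemW (wt1 (θ + 1)) u) : MemW (wt1 θ) (dx u) :=
  Summable.of_nonneg_of_le (fun _ => mul_nonneg (jb_rpow_pos _ _).le (norm_nonneg _))
    (wt1_mul_norm_dx_le u θ) h

lemma MemW.nW_dx_le {θ : ℝ} {u : Fn} (h : MemW (wt1 (θ + 1)) u) :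
    nW (wt1 θ) (ParaNLS.dx u) ≤ nW (wt1 (θ + 1)) u :=
  Summable.tsum_le_tsum (wt1_mul_norm_dx_le u θ) h.dx h

lemma MemW.dx_iterate {α : ℕ} {u : Fn} (h : MemW (wt1 α) u) :
    MemW (wt1 0) (ParaNLS.dx^[α] u) ∧ nW (wt1 0) (ParaNLS.dx^[α] u) ≤ nW (wt1 α) u := by
  induction α generalizing u with
  | zero => simpa using h
  | succ α ih =>
    have h' : MemW (wt1 ((α : ℝ) + 1)) u := by simpa using h
    rw [Function.iterate_succ_apply]
    have h1 := ih h'.dx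
    refine ⟨h1.1, h1.2.trans ?_⟩
    simpa using h'.nW_dx_le

lemma dx_add (u v : Fn) : dx (u + v) = dx u + dx v := by
  funext j; simp [dx, mul_add]

lemma dx_smul (c : ℂ) (u : Fn) : dx (c • u) = c • dx u := by
  funext j; simp [dx, mul_left_comm]

lemma dx_iterate_add (α : ℕ) (u v : Fn) : dx^[α] (u + v) = dx^[α] u + dx^[α] v := by
  induction α generalizing u v with
  | zero => rfl
  | succ α ih => simp [Function.iterate_succ_apply, dx_add, ih]

lemma dx_iterate_smul (α : ℕ) (c : ℂ) (u : Fn) : dx^[α] (c • u) = c • dx^[α] u := by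
  induction α generalizing u with
  | zero => rfl
  | succ α ih => simp [Function.iterate_succ_apply, dx_smul, ih]

lemma evalFn_add {u v : Fn} (hu : MemW (wt1 0) u) (hv : MemW (wt1 0) v) (x : ℝ) :
    evalFn (u + v) x = evalFn u x + evalFn v x := by
  rw [evalFn_eq, evalFn_eq, evalFn_eq, ← mul_add,
    ← Summable.tsum_add (summable_evalFn hu x) (summable_evalFn hv x)]
  simp [add_mul]

lemma evalFn_smul (c : ℂ) (u : Fn) (x : ℝ) : evalFn (c • u) x = c * evalFn u x := by
  have h : ∀ j : ℤ, (c • u) j * Complex.exp (Complex.I * j * x) =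
      c * (u j * Complex.exp (Complex.I * j * x)) := fun j => by
    rw [Pi.smul_apply, smul_eq_mul, mul_assoc]
  rw [evalFn_eq, evalFn_eq, tsum_congr h, tsum_mul_left]
  ring

lemma evalFn_zero (x : ℝ) : evalFn 0 x = 0 := by simp [evalFn]

lemma memW_sum {κ ι : Type*} {w : ι → ℝ} [IsWeight w] {s : Finset κ} {f : κ → ι → ℂ}
    (h : ∀ i ∈ s, MemW w (f i)) : MemW w (∑ i ∈ s, f i) :=
  (subW w).sum_mem h

lemma nW_sum_le {κ ι : Type*} {w : ι → ℝ} [IsWeight w] {s : Finset κ} {f : κ → ι → ℂ}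
    (h : ∀ i ∈ s, MemW w (f i)) : nW w (∑ i ∈ s, f i) ≤ ∑ i ∈ s, nW w (f i) := by
  have h1 := norm_sum_le s fun i => toW w (f i)
  rw [WL1.norm_def, WL1.sum_val] at h1
  rw [Finset.sum_congr rfl fun i hi => (toW_val (h i hi)).symm]
  refine h1.trans (Finset.sum_le_sum fun i hi => ?_)
  rw [WL1.norm_def, toW_val (h i hi)]

lemma evalFn_sum {κ : Type*} {s : Finset κ} {f : κ → Fn} (h : ∀ i ∈ s, MemW (wt1 0) (f i))
    (x : ℝ) : evalFn (∑ i ∈ s, f i) x = ∑ i ∈ s, evalFn (f i) x := by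
  classical
  induction s using Finset.induction_on with
  | empty => simp [evalFn_zero]
  | insert a s ha ih =>
    rw [Finset.sum_insert ha, Finset.sum_insert ha, evalFn_add (h a (by simp))
      (memW_sum fun i hi => h i (by simp [hi])), ih fun i hi => h i (by simp [hi])]

lemma hasDerivAt_evalFn {u : Fn} (h : MemW (wt1 1) u) (x : ℝ) :
    HasDerivAt (evalFn u) (evalFn (dx u) x) x := by
  have h0 : MemW (wt1 0) u := h.wt1_mono zero_le_one
  have h1 : MemW (wt1 0) (dx u) := MemW.dx (by simpa using h)
  unfold evalFn
  refine HasDerivAt.const_mul _ ?_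
  refine hasDerivAt_tsum (u := fun j => ‖dx u j‖) (y₀ := 0) (memW_zero_iff.1 h1)
    (g := fun (j : ℤ) (x : ℝ) => u j * Complex.exp (Complex.I * j * x))
    (g' := fun (j : ℤ) (x : ℝ) => dx u j * Complex.exp (Complex.I * j * x))
    (fun j y => ?_) (fun j y => by simp [norm_exp_I_int_mul]) (summable_evalFn h0 0) x
  have h2 : HasDerivAt (fun x : ℝ => Complex.I * j * (x : ℂ)) (Complex.I * j) y := by
    simpa using (hasDerivAt_id y).ofReal_comp.const_mul (Complex.I * j)
  have h3 := h2.cexp.const_mul (u j)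
  exact h3.congr_deriv (by simp only [dx]; ring)

lemma integral_exp_int (n : ℤ) :
    ∫ x in (0 : ℝ)..(2 * Real.pi), Complex.exp (Complex.I * n * x) =
      if n = 0 then 2 * Real.pi else 0 := by
  split_ifs with h
  · subst h; simp
  · have hc : Complex.I * (n : ℂ) ≠ 0 := mul_ne_zero Complex.I_ne_zero (by exact_mod_cast h)
    rw [integral_exp_mul_complex hc]
    have : Complex.I * n * ((2 * Real.pi : ℝ) : ℂ) = n * (2 * Real.pi * Complex.I) := by
      push_cast; ring
    rw [this, Complex.exp_int_mul_two_pi_mul_I]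
    simp

/-- Termwise integration, dominated by the summable coefficients, and orthogonality of exponentials.
The two normalisations (2π)^{-1/2} cancel the length of the period. -/
lemma fourierFn_evalFn {u : Fn} (h : MemW (wt1 0) u) : fourierFn (evalFn u) = u := by
  funext k
  have hs : HasSum (fun j : ℤ => ∫ x in (0 : ℝ)..(2 * Real.pi),
      nrm * (u j * Complex.exp (Complex.I * j * x)) * Complex.exp (-(Complex.I * k * x)))
      (∫ x in (0 : ℝ)..(2 * Real.pi), evalFn u x * Complex.exp (-(Complex.I * k * x))) := by
    refine intervalIntegral.hasSum_integral_of_dominated_convergence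
      (fun j _ => ‖u j‖) (fun j => ?_) (fun j => ?_) ?_ ?_ ?_
    · exact (by fun_prop : Continuous fun x : ℝ =>
        nrm * (u j * Complex.exp (Complex.I * j * x)) *
          Complex.exp (-(Complex.I * k * x))).aestronglyMeasurable
    · refine Eventually.of_forall fun x _ => ?_
      have h2 : Complex.exp (-(Complex.I * k * x)) =
          Complex.exp (Complex.I * ((-k : ℤ) : ℂ) * x) := by push_cast; ring_nf
      rw [h2, norm_mul, norm_mul, norm_mul, norm_exp_I_int_mul, norm_exp_I_int_mul, mul_one,
        mul_one]
      exact mul_le_of_le_one_left (norm_nonneg _) norm_nrm_le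
    · exact Eventually.of_forall fun x _ => memW_zero_iff.1 h
    · exact intervalIntegrable_const
    · refine Eventually.of_forall fun x _ => ?_
      exact ((summable_evalFn h x).hasSum.mul_left nrm).mul_right _
  have h3 : ∀ j : ℤ, ∫ x in (0 : ℝ)..(2 * Real.pi),
      nrm * (u j * Complex.exp (Complex.I * j * x)) * Complex.exp (-(Complex.I * k * x)) =
      if j = k then nrm * u k * (2 * Real.pi) else 0 := by
    intro j
    have h4 : ∀ x : ℝ, nrm * (u j * Complex.exp (Complex.I * j * x)) *
        Complex.exp (-(Complex.I * k * x)) =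
        nrm * u j * Complex.exp (Complex.I * ((j - k : ℤ) : ℂ) * x) := by
      intro x
      have h6 : Complex.I * ((j - k : ℤ) : ℂ) * x = Complex.I * j * x + -(Complex.I * k * x) := by
        push_cast; ring
      rw [h6, Complex.exp_add]
      ring
    simp_rw [h4]
    rw [intervalIntegral.integral_const_mul, integral_exp_int]
    by_cases hjk : j = k
    · subst hjk; simp
    · simp [hjk, sub_ne_zero.2 hjk]
  simp_rw [h3] at hs
  have h5 := hs.unique (hasSum_ite_eq k (nrm * u k * (2 * Real.pi)))
  unfold fourierFn
  rw [h5]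
  change nrm * (nrm * u k * (2 * Real.pi)) = u k
  linear_combination u k * nrm_sq

lemma iteratedDeriv_evalFn {α : ℕ} {u : Fn} (h : MemW (wt1 α) u) :
    iteratedDeriv α (evalFn u) = evalFn (dx^[α] u) := by
  induction α with
  | zero => simp
  | succ α ih =>
    have h' : MemW (wt1 α) u := h.wt1_mono (by push_cast; linarith)
    rw [iteratedDeriv_succ, ih h', Function.iterate_succ_apply']
    funext x
    refine (hasDerivAt_evalFn ?_ x).deriv
    clear ih h'
    induction α generalizing u with
    | zero => simpa using h
    | succ α ih =>
      rw [Function.iterate_succ_apply]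
      refine ih (MemW.dx ?_)
      convert h using 2
      push_cast; ring

lemma contDiff_evalFn {u : Fn} (h : ∀ α : ℕ, MemW (wt1 α) u) : ContDiff ℝ ∞ (evalFn u) := by
  apply contDiff_infty.2
  intro n
  induction n generalizing u with
  | zero => exact contDiff_zero.2 (continuous_evalFn (by simpa using h 0))
  | succ n ih =>
    have hd : ∀ x, HasDerivAt (evalFn u) (evalFn (dx u) x) x :=
      hasDerivAt_evalFn (by simpa using h 1)
    rw [show ((n + 1 : ℕ) : WithTop ℕ∞) = (n : WithTop ℕ∞) + 1 by push_cast; rfl,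
      contDiff_succ_iff_deriv]
    refine ⟨fun x => (hd x).differentiableAt, by simp, ?_⟩
    rw [show deriv (evalFn u) = evalFn (dx u) from funext fun x => (hd x).deriv]
    exact ih fun α => MemW.dx (by simpa using h (α + 1))

/-! ### Polynomials in `ξ` -/

/-- The monomial `(iξ)^l`. -/
def xiPow (l : ℕ) (ξ : ℝ) : ℂ := (Complex.I * ξ) ^ l

lemma contDiff_xiPow (l : ℕ) : ContDiff ℝ ∞ (xiPow l) := by
  unfold xiPow
  exact (contDiff_const.mul Complex.ofRealCLM.contDiff).pow l

lemma iteratedDeriv_xiPow (l β : ℕ) :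
    iteratedDeriv β (xiPow l) =
      fun ξ : ℝ => Complex.I ^ l * (l.descFactorial β : ℂ) * (ξ : ℂ) ^ (l - β) := by
  induction β with
  | zero => funext ξ; simp [xiPow, mul_pow]
  | succ β ih =>
    rw [iteratedDeriv_succ, ih]
    funext ξ
    have h1 : HasDerivAt (fun ξ : ℝ => Complex.I ^ l * (l.descFactorial β : ℂ) * (ξ : ℂ) ^ (l - β))
        (Complex.I ^ l * (l.descFactorial β : ℂ) * (((l - β : ℕ) : ℂ) * (ξ : ℂ) ^ (l - β - 1))) ξ := by
      have h2 := ((hasDerivAt_id ξ).ofReal_comp.pow (l - β)).const_mul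
        (Complex.I ^ l * (l.descFactorial β : ℂ))
      simpa using h2
    rw [h1.deriv, Nat.descFactorial_succ, Nat.sub_sub]
    push_cast; ring

lemma norm_iteratedDeriv_xiPow_le (l β : ℕ) {m : ℝ} (hm : (l : ℝ) ≤ m) (ξ : ℝ) :
    ‖iteratedDeriv β (xiPow l) ξ‖ ≤ (l.descFactorial β : ℝ) * jb ξ ^ (m - β) := by
  rw [iteratedDeriv_xiPow]
  simp only [norm_mul, norm_pow, Complex.norm_I, one_pow, one_mul, Complex.norm_natCast,
    Complex.norm_real, Real.norm_eq_abs]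
  -- Beyond the degree the derivative is zero, which is why the bound also holds when m − β is very
  -- negative.
  by_cases h : l < β
  · rw [Nat.descFactorial_of_lt h]; simp
  · push Not at h
    refine mul_le_mul_of_nonneg_left ?_ (Nat.cast_nonneg _)
    calc |ξ| ^ (l - β) ≤ jb ξ ^ (l - β) := by gcongr; exact abs_le_jb ξ
      _ = jb ξ ^ ((l - β : ℕ) : ℝ) := (Real.rpow_natCast _ _).symm
      _ ≤ jb ξ ^ (m - β) := jb_rpow_le ξ (by rw [Nat.cast_sub h]; linarith)

lemma hasDerivAt_iteratedDeriv_xiPow (l β : ℕ) (ξ : ℝ) :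
    HasDerivAt (iteratedDeriv β (xiPow l)) (iteratedDeriv (β + 1) (xiPow l) ξ) ξ := by
  rw [iteratedDeriv_succ]
  exact ((contDiff_xiPow l).differentiable_iteratedDeriv β
    (by exact_mod_cast WithTop.coe_lt_top _) ξ).hasDerivAt

lemma dtI_zero {ι : Type*} (I : Set ℝ) (v : ℝ → ι → ℂ) (t : ℝ) : dtI I 0 v t = v t := by
  funext i; simp [dtI]

/-! ### Jets of time dependent symbols -/

/-- The evaluation of the derivative of order `α` at `x`. -/
def evalW {θ : ℝ} (α : ℕ) (h : (α : ℝ) ≤ θ) (x : ℝ) : WL1 (wt1 θ) →L[ℂ] ℂ :=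
  LinearMap.mkContinuous
    { toFun := fun f => evalFn (dx^[α] f.1) x
      map_add' := fun f g => by
        rw [WL1.add_val, dx_iterate_add, evalFn_add (MemW.dx_iterate (MemW.wt1_mono h f.2)).1
          (MemW.dx_iterate (MemW.wt1_mono h g.2)).1]
      map_smul' := fun c f => by
        rw [WL1.smul_val, dx_iterate_smul, evalFn_smul]; rfl } 1 fun f => by
    rw [one_mul]
    have h1 := MemW.dx_iterate (MemW.wt1_mono h f.2)
    exact (norm_evalFn_le h1.1 x).trans (h1.2.trans (MemW.nW1_mono h f.2))

lemma evalW_apply {θ : ℝ} (α : ℕ) (h : (α : ℝ) ≤ θ) (x : ℝ) (f : WL1 (wt1 θ)) :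
    evalW α h x f = evalFn (dx^[α] f.1) x := rfl

/-- Joint continuity follows from continuity in x together with a Lipschitz bound in the function
that is uniform in x. -/
lemma continuous_evalW {θ : ℝ} (α : ℕ) (h : (α : ℝ) ≤ θ) :
    Continuous fun y : WL1 (wt1 θ) × ℝ => evalW α h y.2 y.1 := by
  refine continuous_prod_of_continuous_lipschitzWith _ 1 (fun f => ?_) fun x => ?_
  · exact continuous_evalFn (MemW.dx_iterate (MemW.wt1_mono h f.2)).1
  · refine (evalW α h x).lipschitz.weaken ?_
    exact LinearMap.mkContinuous_norm_le _ zero_le_one _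

/-- The three kinds of derivatives act separately: those in t on the coefficients, those in x as
Fourier multipliers, those in ξ on the monomials. Evaluation at a point is continuous on ℓ¹ of order
α, so it commutes with ∂_t. -/
lemma isJet_of_cl1 {I : Set ℝ} (hI : IsTimeInterval I) {k : ℕ} {A : ℝ} {L : ℕ}
    {G : Fin L → ℝ → Fn} (hG : ∀ l, ∀ α : ℕ, (α : ℝ) ≤ A → CL1 I k (wt1 α) (G l)) :
    IsJet I k A (fun t x ξ => ∑ l, evalFn (G l t) x * xiPow l ξ) fun κ α β t x ξ =>
      ∑ l, evalFn (dx^[α] (dtI I κ (G l) t)) x * iteratedDeriv β (xiPow l) ξ where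
  base := by
    intro t ht
    funext x ξ
    simp [dtI_zero, iteratedDeriv_zero]
  cont := by
    intro κ hκ α hα β
    refine continuousOn_finsetSum _ fun l _ => ContinuousOn.mul ?_ ?_
    · have h1 : ContinuousOn (fun y : ℝ × ℝ × ℝ =>
          (toW (wt1 α) (dtI I κ (G l) y.1), y.2.1)) (I ×ˢ Set.univ) :=
        (((hG l α hα).cont κ hκ).comp continuousOn_fst fun y hy => hy.1).prodMk
          (by fun_prop)
      refine ((continuous_evalW α le_rfl).comp_continuousOn h1).congr fun y hy => ?_
      simp only [Function.comp, evalW_apply]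
      rw [toW_val ((hG l α hα).mem κ hκ _ hy.1)]
    · exact (((contDiff_xiPow l).continuous_iteratedDeriv β
        (by exact_mod_cast le_top)).comp (by fun_prop)).continuousOn
  deriv_t := by
    intro κ hκ α hα β t ht x ξ
    refine HasDerivWithinAt.fun_sum fun l _ => HasDerivWithinAt.mul_const ?_ _
    have h1 := ((evalW α le_rfl x).restrictScalars ℝ).hasFDerivAt.comp_hasDerivWithinAt t
      ((hG l α hα).hasDerivWithinAt hI hκ ht)
    simp only [ContinuousLinearMap.coe_restrictScalars', evalW_apply] at h1
    rw [toW_val ((hG l α hα).mem _ hκ t ht)] at h1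
    refine h1.congr (fun τ hτ => ?_) ?_
    · simp only [Function.comp, evalW_apply]
      rw [toW_val ((hG l α hα).mem _ hκ.le τ hτ)]
    · simp only [Function.comp, evalW_apply]
      rw [toW_val ((hG l α hα).mem _ hκ.le t ht)]
  deriv_x := by
    intro κ hκ α hα β t ht x ξ
    refine HasDerivAt.fun_sum fun l _ => HasDerivAt.mul_const ?_ _
    have h1 := (hG l (α + 1) (by exact_mod_cast hα)).mem κ hκ t ht
    rw [Function.iterate_succ_apply']
    refine hasDerivAt_evalFn ?_ x
    clear hα
    generalize dtI I κ (G l) t = u at h1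
    induction α generalizing u with
    | zero => simpa using h1
    | succ α ih =>
      rw [Function.iterate_succ_apply]
      exact ih _ (MemW.dx (by convert h1 using 2; push_cast; ring))
  deriv_xi := by
    intro κ hκ α hα β t ht x ξ
    exact HasDerivAt.fun_sum fun l _ => (hasDerivAt_iteratedDeriv_xiPow l β ξ).const_mul _

/-! ### Sobolev spaces and weighted `ℓ¹` spaces -/

/-- The constant of the embedding of `H^{σ+1}` into the weighted `ℓ¹` space of order `σ`. -/
def sobC : ℝ := Real.sqrt (∑' j : ℤ, jb j ^ (-2 : ℝ))

lemma sobC_nonneg : 0 ≤ sobC := Real.sqrt_nonneg _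

lemma hsNorm_nonneg (s : ℝ) (u : Fn) : 0 ≤ hsNorm s u := Real.sqrt_nonneg _

lemma hsNorm2_nonneg (s : ℝ) (U : Fn2) : 0 ≤ hsNorm2 s U := Real.sqrt_nonneg _

lemma rpow_two_mul (x s : ℝ) : jb x ^ (2 * s) = (jb x ^ s) ^ 2 := by
  rw [mul_comm, Real.rpow_mul (jb_nonneg _)]; norm_num

lemma MemHs.mono {s t : ℝ} (h : s ≤ t) {u : Fn} (hu : MemHs t u) : MemHs s u :=
  Summable.of_nonneg_of_le (fun _ => mul_nonneg (sq_nonneg _) (jb_rpow_pos _ _).le)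
    (fun _ => mul_le_mul_of_nonneg_left (jb_rpow_le _ (by linarith)) (sq_nonneg _)) hu

lemma hsNorm_mono {s t : ℝ} (h : s ≤ t) {u : Fn} (hu : MemHs t u) : hsNorm s u ≤ hsNorm t u :=
  Real.sqrt_le_sqrt (Summable.tsum_le_tsum
    (fun _ => mul_le_mul_of_nonneg_left (jb_rpow_le _ (by linarith)) (sq_nonneg _))
    (hu.mono h) hu)

/-- Cauchy-Schwarz against ⟨j⟩^{-1}, which is square summable; this costs one derivative. -/
lemma MemHs.memW {σ s : ℝ} (h : σ + 1 ≤ s) {u : Fn} (hu : MemHs s u) :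
    MemW (wt1 σ) u ∧ nW (wt1 σ) u ≤ sobC * hsNorm s u := by
  have hpq : (2 : ℝ).HolderConjugate 2 := Real.HolderConjugate.two_two
  have key := Real.summable_and_inner_le_Lp_mul_Lq_tsum_of_nonneg hpq
    (f := fun j : ℤ => jb j ^ (-1 : ℝ)) (g := fun j : ℤ => jb j ^ s * ‖u j‖)
    (fun j => (jb_rpow_pos _ _).le) (fun j => mul_nonneg (jb_rpow_pos _ _).le (norm_nonneg _))
    (summable_jb_neg_two.congr fun j => by
      rw [← Real.rpow_mul (jb_nonneg _)]; norm_num)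
    (Summable.congr hu fun j => by
      rw [Real.rpow_two, mul_pow, rpow_two_mul, mul_comm])
  have hle : ∀ j : ℤ, wt1 σ j * ‖u j‖ ≤ jb j ^ (-1 : ℝ) * (jb j ^ s * ‖u j‖) := by
    intro j
    rw [← mul_assoc, ← Real.rpow_add (jb_pos _)]
    exact mul_le_mul_of_nonneg_right (jb_rpow_le _ (by linarith)) (norm_nonneg _)
  have hm : MemW (wt1 σ) u := key.1.of_nonneg_of_le
    (fun _ => mul_nonneg (jb_rpow_pos _ _).le (norm_nonneg _)) hle
  refine ⟨hm, (Summable.tsum_le_tsum hle hm key.1).trans (key.2.trans_eq ?_)⟩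
  rw [sobC, hsNorm, Real.sqrt_eq_rpow, Real.sqrt_eq_rpow]
  congr 2
  · refine tsum_congr fun j => ?_
    rw [← Real.rpow_mul (jb_nonneg _)]; norm_num
  · refine tsum_congr fun j => ?_
    rw [Real.rpow_two, mul_pow, rpow_two_mul, mul_comm]

/-- The embedding ℓ¹ ⊂ ℓ², without loss: every square is at most the norm times the term. -/
lemma MemW.memHs {s : ℝ} {u : Fn} (hu : MemW (wt1 s) u) :
    MemHs s u ∧ hsNorm s u ≤ nW (wt1 s) u := by
  have h0 : ∀ j : ℤ, ‖u j‖ ^ 2 * jb j ^ (2 * s) = (wt1 s j * ‖u j‖) ^ 2 := by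
    intro j; rw [rpow_two_mul, wt1]; ring
  have hle : ∀ j : ℤ, ‖u j‖ ^ 2 * jb j ^ (2 * s) ≤ nW (wt1 s) u * (wt1 s j * ‖u j‖) := by
    intro j
    rw [h0, sq]
    refine mul_le_mul_of_nonneg_right ?_ (mul_nonneg (jb_rpow_pos _ _).le (norm_nonneg _))
    exact Summable.le_tsum hu j fun _ _ => mul_nonneg (jb_rpow_pos _ _).le (norm_nonneg _)
  have hm : MemHs s u := Summable.of_nonneg_of_le
    (fun _ => mul_nonneg (sq_nonneg _) (jb_rpow_pos _ _).le) hle (Summable.mul_left _ hu)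
  refine ⟨hm, Real.sqrt_le_iff.2 ⟨nW_nonneg _ _, ?_⟩⟩
  refine (Summable.tsum_le_tsum hle hm (Summable.mul_left _ hu)).trans_eq ?_
  rw [tsum_mul_left, sq]; rfl

lemma hsNorm_le_hsNorm2 (s : ℝ) (U : Fn2) (i : Fin 2) : hsNorm s (U i) ≤ hsNorm2 s U := by
  apply Real.le_sqrt_of_sq_le
  exact Finset.single_le_sum (f := fun i => hsNorm s (U i) ^ 2) (fun i _ => sq_nonneg _)
    (Finset.mem_univ i)

lemma un_memW_iff {σ : ℝ} {U : Fn2} : MemW (wt2 σ) (un U) ↔ ∀ i, MemW (wt1 σ) (U i) := by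
  unfold MemW
  rw [summable_prod_of_nonneg (f := fun J => wt2 σ J * ‖un U J‖)
    fun _ => mul_nonneg (jb_rpow_pos _ _).le (norm_nonneg _)]
  exact ⟨fun h => h.1, fun h => ⟨h, (hasSum_fintype _).summable⟩⟩

lemma nW_un {σ : ℝ} {U : Fn2} (h : MemW (wt2 σ) (un U)) :
    nW (wt2 σ) (un U) = ∑ i, nW (wt1 σ) (U i) := by
  unfold nW
  rw [Summable.tsum_prod h, tsum_fintype]
  rfl

lemma MemHs2.memW {σ s : ℝ} (h : σ + 1 ≤ s) {U : Fn2} (hU : MemHs2 s U) :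
    MemW (wt2 σ) (un U) ∧ nW (wt2 σ) (un U) ≤ 2 * sobC * hsNorm2 s U := by
  have h1 : MemW (wt2 σ) (un U) := un_memW_iff.2 fun i => ((hU i).memW h).1
  refine ⟨h1, ?_⟩
  rw [nW_un h1, Fin.sum_univ_two]
  have h2 : ∀ i, nW (wt1 σ) (U i) ≤ sobC * hsNorm2 s U := fun i =>
    ((hU i).memW h).2.trans (mul_le_mul_of_nonneg_left (hsNorm_le_hsNorm2 s U i) sobC_nonneg)
  linarith [h2 0, h2 1]

lemma un_single_memW_iff {σ : ℝ} {e : Fin 2} {u : Fn} :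
    MemW (wt2 σ) (un (Pi.single e u)) ↔ MemW (wt1 σ) u := by
  rw [un_memW_iff]
  constructor
  · intro h; simpa using h e
  · intro h i
    by_cases hi : i = e
    · subst hi; simpa using h
    · simp only [ne_eq, hi, not_false_eq_true, Pi.single_eq_of_ne]
      exact (subW (wt1 σ)).zero_mem

lemma nW_un_single {σ : ℝ} {e : Fin 2} {u : Fn} (h : MemW (wt1 σ) u) :
    nW (wt2 σ) (un (Pi.single e u)) = nW (wt1 σ) u := by
  rw [nW_un (un_single_memW_iff.2 h), Finset.sum_eq_single e]
  · simp
  · intro b _ hb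
    simp [hb, nW]
  · simp

lemma dtI_single (I : Set ℝ) (κ : ℕ) (e : Fin 2) (u : ℝ → Fn) (t : ℝ) :
    dtI I κ (fun t => un (Pi.single e (u t))) t = un (Pi.single e (dt I κ u t)) := by
  funext J
  by_cases h : J.1 = e
  · simp [dtI, un, dt, ← h]
  · simp [dtI, un, h]

lemma continuousOn_toW {ι : Type*} {w : ι → ℝ} [IsWeight w] {I : Set ℝ} {f : ℝ → ι → ℂ}
    (hm : ∀ t ∈ I, MemW w (f t))
    (hc : ∀ t ∈ I, Tendsto (fun τ => nW w (f τ - f t)) (𝓝[I] t) (𝓝 0)) :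
    ContinuousOn (fun t => toW w (f t)) I := by
  intro t ht
  rw [ContinuousWithinAt, tendsto_iff_norm_sub_tendsto_zero]
  refine (hc t ht).congr' ?_
  filter_upwards [self_mem_nhdsWithin] with τ hτ
  rw [WL1.norm_def, WL1.sub_val, toW_val (hm τ hτ), toW_val (hm t ht)]

lemma tendsto_nW_of_continuousOn {ι : Type*} {w : ι → ℝ} [IsWeight w] {I : Set ℝ}
    {f : ℝ → ι → ℂ} (hm : ∀ t ∈ I, MemW w (f t)) (hc : ContinuousOn (fun t => toW w (f t)) I)
    {t : ℝ} (ht : t ∈ I) : Tendsto (fun τ => nW w (f τ - f t)) (𝓝[I] t) (𝓝 0) := by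
  have h := hc t ht
  rw [ContinuousWithinAt, tendsto_iff_norm_sub_tendsto_zero] at h
  refine h.congr' ?_
  filter_upwards [self_mem_nhdsWithin] with τ hτ
  rw [WL1.norm_def, WL1.sub_val, toW_val (hm τ hτ), toW_val (hm t ht)]

lemma MemHs.sub {s : ℝ} {u v : Fn} (hu : MemHs s u) (hv : MemHs s v) : MemHs s (u - v) := by
  refine Summable.of_nonneg_of_le (fun _ => mul_nonneg (sq_nonneg _) (jb_rpow_pos _ _).le)
    (fun j => ?_) ((Summable.add hu hv).mul_left 2)
  rw [← add_mul, ← mul_assoc]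
  refine mul_le_mul_of_nonneg_right ?_ (jb_rpow_pos _ _).le
  have h := norm_sub_le (u j) (v j)
  have h2 : ‖(u - v) j‖ = ‖u j - v j‖ := rfl
  rw [h2]
  nlinarith [norm_nonneg (u j - v j), sq_nonneg (‖u j‖ - ‖v j‖)]

/-- The derivative of order κ lives in H^{s−2κ}; one weight serves all κ ≤ k when it fits the worst
case κ = k. -/
lemma MemCK.cl1 {I : Set ℝ} {K k : ℕ} {s σ : ℝ} {u : ℝ → Fn} (h : MemCK I K s u) (hk : k ≤ K)
    (hσ : σ + 1 ≤ s - 2 * k) : CL1 I k (wt1 σ) u := by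
  have hle : ∀ κ ≤ k, σ + 1 ≤ s - 2 * κ := fun κ hκ => by
    have : (κ : ℝ) ≤ k := by exact_mod_cast hκ
    linarith
  have hmem : ∀ κ ≤ k, ∀ t ∈ I, MemW (wt1 σ) (dtI I κ u t) := fun κ hκ t ht =>
    ((h.2 κ (hκ.trans hk) t ht).1.memW (hle κ hκ)).1
  refine ⟨fun j => (h.1 j).of_le (by exact_mod_cast hk), hmem, fun κ hκ => ?_⟩
  refine continuousOn_toW (hmem κ hκ) fun t ht => ?_
  have h1 := (h.2 κ (hκ.trans hk) t ht).2.const_mul sobC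
  rw [mul_zero] at h1
  refine tendsto_of_tendsto_of_tendsto_of_le_of_le' tendsto_const_nhds h1
    (Eventually.of_forall fun τ => nW_nonneg _ _) ?_
  filter_upwards [self_mem_nhdsWithin] with τ hτ
  have h2 : MemHs (s - 2 * κ) (dt I κ u τ - dt I κ u t) :=
    (h.2 κ (hκ.trans hk) τ hτ).1.sub (h.2 κ (hκ.trans hk) t ht).1
  exact (h2.memW (hle κ hκ)).2

/-- For each k only the top derivative is used, in its own weight s − 2k; hence the hypothesis for
every k rather than for K alone. -/
lemma memCK_of_cl1 {I : Set ℝ} {K : ℕ} {s : ℝ} {u : ℝ → Fn}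
    (h : ∀ k ≤ K, CL1 I k (wt1 (s - 2 * k)) u) : MemCK I K s u := by
  refine ⟨(h K le_rfl).smooth, fun k hk t ht => ⟨((h k hk).mem k le_rfl t ht).memHs.1, ?_⟩⟩
  refine tendsto_of_tendsto_of_tendsto_of_le_of_le' tendsto_const_nhds
    (tendsto_nW_of_continuousOn ((h k hk).mem k le_rfl) ((h k hk).cont k le_rfl) ht)
    (Eventually.of_forall fun τ => hsNorm_nonneg _ _) ?_
  filter_upwards [self_mem_nhdsWithin] with τ hτ
  exact (MemW.memHs ((subW _).sub_mem ((h k hk).mem k le_rfl τ hτ)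
    ((h k hk).mem k le_rfl t ht))).2

lemma cl1_un {I : Set ℝ} {k : ℕ} {σ : ℝ} {U : ℝ → Fn2}
    (h : ∀ i, CL1 I k (wt1 σ) fun t => U t i) : CL1 I k (wt2 σ) fun t => un (U t) := by
  have hun : ∀ κ t, dtI I κ (fun t => un (U t)) t = un fun i => dtI I κ (fun t => U t i) t :=
    fun κ t => rfl
  have hmem : ∀ κ ≤ k, ∀ t ∈ I, MemW (wt2 σ) (dtI I κ (fun t => un (U t)) t) := by
    intro κ hκ t ht
    rw [hun]
    exact un_memW_iff.2 fun i => (h i).mem κ hκ t ht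
  refine ⟨fun J => by simpa only [un] using (h J.1).smooth J.2, hmem, fun κ hκ => ?_⟩
  refine continuousOn_toW (hmem κ hκ) fun t ht => ?_
  have h1 : Tendsto (fun τ => ∑ i, nW (wt1 σ)
      (dtI I κ (fun t => U t i) τ - dtI I κ (fun t => U t i) t)) (𝓝[I] t) (𝓝 0) := by
    have := tendsto_finsetSum (Finset.univ : Finset (Fin 2)) fun i _ =>
      tendsto_nW_of_continuousOn ((h i).mem κ hκ) ((h i).cont κ hκ) ht
    simpa using this
  refine h1.congr' ?_
  filter_upwards [self_mem_nhdsWithin] with τ hτ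
  exact (nW_un (U := fun i => dtI I κ (fun t => U t i) τ - dtI I κ (fun t => U t i) t)
    ((subW (wt2 σ)).sub_mem (hmem κ hκ τ hτ) (hmem κ hκ t ht))).symm

lemma MemCK2.cl1 {I : Set ℝ} {K k : ℕ} {s σ : ℝ} {U : ℝ → Fn2} (h : MemCK2 I K s U)
    (hk : k ≤ K) (hσ : σ + 1 ≤ s - 2 * k) : CL1 I k (wt2 σ) fun t => un (U t) :=
  cl1_un fun i => (h i).cl1 hk hσ

lemma CL1.single {I : Set ℝ} {k : ℕ} {σ : ℝ} {u : ℝ → Fn} (h : CL1 I k (wt1 σ) u)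
    (e : Fin 2) : CL1 I k (wt2 σ) fun t => un (Pi.single e (u t)) := by
  refine cl1_un fun i => ?_
  by_cases hi : i = e
  · subst hi; simpa using h
  · have h0 : (fun t => (Pi.single e (u t) : Fn2) i) = fun _ => 0 := by
      funext t; simp [hi]
    rw [h0]
    have hz : ∀ κ t, dtI I κ (fun _ : ℝ => (0 : Fn)) t = 0 := by
      intro κ t; funext j; simp [dtI]
    refine ⟨fun j => contDiffOn_const, fun κ _ t _ => ?_, fun κ _ => ?_⟩
    · rw [hz]; exact (subW (wt1 σ)).zero_mem
    · simp_rw [hz]; exact continuousOn_const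

lemma hsNorm_dt_le_normK {I : Set ℝ} {κ k : ℕ} (h : κ ≤ k) (s : ℝ) (u : ℝ → Fn) (t : ℝ) :
    hsNorm (s - 2 * κ) (dt I κ u t) ≤ normK I k s u t :=
  Finset.single_le_sum (f := fun κ : ℕ => hsNorm (s - 2 * κ) (dt I κ u t))
    (fun _ _ => hsNorm_nonneg _ _) (Finset.mem_range.2 (Nat.lt_succ_of_le h))

lemma hsNorm2_dt_le_normK2 {I : Set ℝ} {κ k : ℕ} (h : κ ≤ k) (s : ℝ) (U : ℝ → Fn2) (t : ℝ) :
    hsNorm2 (s - 2 * κ) (dt2 I κ U t) ≤ normK2 I k s U t :=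
  Finset.single_le_sum (f := fun κ : ℕ => hsNorm2 (s - 2 * κ) (dt2 I κ U t))
    (fun _ _ => hsNorm2_nonneg _ _) (Finset.mem_range.2 (Nat.lt_succ_of_le h))

lemma normK2_nonneg (I : Set ℝ) (k : ℕ) (s : ℝ) (U : ℝ → Fn2) (t : ℝ) : 0 ≤ normK2 I k s U t :=
  Finset.sum_nonneg fun _ _ => hsNorm2_nonneg _ _

lemma normK_nonneg (I : Set ℝ) (k : ℕ) (s : ℝ) (u : ℝ → Fn) (t : ℝ) : 0 ≤ normK I k s u t :=
  Finset.sum_nonneg fun _ _ => hsNorm_nonneg _ _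

lemma normK2_mono {I : Set ℝ} {k K : ℕ} (h : k ≤ K) (s : ℝ) (U : ℝ → Fn2) (t : ℝ) :
    normK2 I k s U t ≤ normK2 I K s U t :=
  Finset.sum_le_sum_of_subset_of_nonneg (Finset.range_mono (by omega))
    fun _ _ _ => hsNorm2_nonneg _ _

lemma nW_dtI_un_le {I : Set ℝ} {κ k K : ℕ} (hκ : κ ≤ k) (hk : k ≤ K) {σ s : ℝ}
    (hσ : σ + 1 ≤ s - 2 * κ) {U : ℝ → Fn2} (h : MemCK2 I K s U) {t : ℝ} (ht : t ∈ I) :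
    nW (wt2 σ) (dtI I κ (fun t => un (U t)) t) ≤ 2 * sobC * normK2 I k s U t := by
  have h1 : MemHs2 (s - 2 * κ) (dt2 I κ U t) := fun i => ((h i).2 κ (hκ.trans hk) t ht).1
  refine (h1.memW hσ).2.trans (mul_le_mul_of_nonneg_left (hsNorm2_dt_le_normK2 hκ s U t) ?_)
  exact mul_nonneg zero_le_two sobC_nonneg

lemma nW_dtI_single_le {I : Set ℝ} {κ k K : ℕ} (hκ : κ ≤ k) (hk : k ≤ K) {σ s : ℝ}
    (hσ : σ + 1 ≤ s - 2 * κ) {u : ℝ → Fn} (h : MemCK I K s u) (e : Fin 2) {t : ℝ} (ht : t ∈ I) :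
    nW (wt2 σ) (dtI I κ (fun t => un (Pi.single e (u t))) t) ≤ 2 * sobC * normK I k s u t := by
  have h1 := ((h.2 κ (hκ.trans hk) t ht).1).memW hσ
  rw [dtI_single, nW_un_single h1.1]
  refine h1.2.trans ((mul_le_mul_of_nonneg_left (hsNorm_dt_le_normK hκ s u t) sobC_nonneg).trans ?_)
  nlinarith [mul_nonneg sobC_nonneg (normK_nonneg I k s u t)]

lemma MemCK2.mono {I : Set ℝ} {k K : ℕ} {s s' : ℝ} {U : ℝ → Fn2} (h : MemCK2 I K s U)
    (hk : k ≤ K) (hs : s' ≤ s) : MemCK2 I k s' U := by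
  refine fun i => ⟨fun j => ((h i).1 j).of_le (by exact_mod_cast hk), fun κ hκ t ht => ?_⟩
  have h1 := (h i).2 κ (hκ.trans hk) t ht
  refine ⟨h1.1.mono (by linarith), ?_⟩
  refine tendsto_of_tendsto_of_tendsto_of_le_of_le' tendsto_const_nhds h1.2
    (Eventually.of_forall fun τ => hsNorm_nonneg _ _) ?_
  filter_upwards [self_mem_nhdsWithin] with τ hτ
  exact hsNorm_mono (by linarith) ((((h i).2 κ (hκ.trans hk) τ hτ).1).sub h1.1)

/-! ### Kernel estimates -/

/-- Polynomial growth of a kernel. -/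
structure KerBdd {p : ℕ} (𝒦 : (Fin p → Idx) → ℂ) (μ C : ℝ) : Prop where
  exp_nonneg : 0 ≤ μ
  const_nonneg : 0 ≤ C
  bound : ∀ J, ‖𝒦 J‖ ≤ C * ∏ i, wt2 μ (J i)

/-- On the support of the kernel the two largest frequencies are comparable. -/
def Comparable {p : ℕ} (𝒦 : (Fin p → Idx) → ℂ) (R : ℝ) : Prop :=
  ∀ J, 𝒦 J ≠ 0 → ∀ a, ∃ b, b ≠ a ∧ jb (J a).2 ≤ R * jb (J b).2

lemma prod_wt2_ite {p : ℕ} (J : Fin p → Idx) (a : Fin p) (σ ν : ℝ) :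
    ∏ i, wt2 (if i = a then σ else ν) (J i) =
      wt2 σ (J a) * ∏ i ∈ Finset.univ.erase a, wt2 ν (J i) := by
  rw [← Finset.mul_prod_erase _ _ (Finset.mem_univ a), if_pos rfl]
  congr 1
  exact Finset.prod_congr rfl fun i hi => by rw [if_neg (Finset.ne_of_mem_erase hi)]

lemma jb_frq_le {p : ℕ} (J : Fin p → Idx) {a : Fin p} (ha : ∀ i, jb (J i).2 ≤ jb (J a).2) :
    jb (frq J) ≤ p * jb (J a).2 := by
  rw [frq, Int.cast_sum]
  refine (jb_sum_le _ ⟨a, Finset.mem_univ a⟩ _).trans ?_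
  refine (Finset.sum_le_card_nsmul _ _ _ fun i _ => ha i).trans_eq (by simp)

lemma exists_max_jb {p : ℕ} (hp : 0 < p) (J : Fin p → Idx) :
    ∃ a, ∀ i, jb (J i).2 ≤ jb (J a).2 := by
  obtain ⟨a, -, ha⟩ := Finset.exists_max_image Finset.univ (fun i => jb (J i).2)
    ⟨⟨0, hp⟩, Finset.mem_univ _⟩
  exact ⟨a, fun i => ha i (Finset.mem_univ i)⟩

lemma wt2_pos (σ : ℝ) (J : Idx) : 0 < wt2 σ J := jb_rpow_pos _ _

lemma prod_wt2_pos {p : ℕ} (s : Finset (Fin p)) (σ : ℝ) (J : Fin p → Idx) :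
    0 < ∏ i ∈ s, wt2 σ (J i) := Finset.prod_pos fun _ _ => wt2_pos _ _

/-- The total frequency is at most p times the largest one, so its power θ is charged to the slot
with the largest frequency. -/
lemma KerBdd.est {p : ℕ} (hp : 0 < p) {𝒦 : (Fin p → Idx) → ℂ} {μ C : ℝ} (h : KerBdd 𝒦 μ C)
    {θ : ℝ} (hθ : 0 ≤ θ) : KerEst 𝒦 θ (θ + μ) μ (C * (p : ℝ) ^ θ) where
  nonneg := hθ
  le := by linarith
  const_nonneg := mul_nonneg h.const_nonneg (by positivity)
  bound J := by
    obtain ⟨a, ha⟩ := exists_max_jb hp J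
    have h1 : jb (frq J) ^ θ ≤ (p : ℝ) ^ θ * wt2 θ (J a) := by
      rw [wt2, ← Real.mul_rpow (by positivity) (jb_nonneg _)]
      exact Real.rpow_le_rpow (jb_nonneg _) (jb_frq_le J ha) hθ
    calc ‖𝒦 J‖ * jb (frq J) ^ θ
        ≤ (C * ∏ i, wt2 μ (J i)) * ((p : ℝ) ^ θ * wt2 θ (J a)) := by
          refine mul_le_mul (h.bound J) h1 (jb_rpow_pos _ _).le ?_
          exact mul_nonneg h.const_nonneg (prod_wt2_pos _ _ _).le
      _ = C * (p : ℝ) ^ θ * ∏ i, wt2 (if i = a then θ + μ else μ) (J i) := by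
          rw [prod_wt2_ite, ← Finset.mul_prod_erase _ _ (Finset.mem_univ a)]
          have : wt2 (θ + μ) (J a) = wt2 θ (J a) * wt2 μ (J a) := Real.rpow_add (jb_pos _) _ _
          rw [this]; ring
      _ ≤ _ := by
          refine mul_le_mul_of_nonneg_left ?_ (mul_nonneg h.const_nonneg (by positivity))
          exact Finset.single_le_sum
            (f := fun a => ∏ i, wt2 (if i = a then θ + μ else μ) (J i))
            (fun a _ => (Finset.prod_pos fun i _ => wt2_pos _ _).le) (Finset.mem_univ a)

/-- The slot `a` of largest frequency would carry σ + ρ + μ. Comparability moves the excess ρ + μ to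
another slot `b`, leaving exactly σ on `a` and at most 2μ + ρ elsewhere. The output thus has ρ more
derivatives than the input. -/
lemma KerBdd.est_smoothing {p : ℕ} (hp : 0 < p) {𝒦 : (Fin p → Idx) → ℂ} {μ C R : ℝ}
    (h : KerBdd 𝒦 μ C) (hR : 1 ≤ R) (hc : Comparable 𝒦 R) {σ ρ : ℝ} (hρ : 0 ≤ ρ)
    (hσ : 2 * μ + ρ ≤ σ) :
    KerEst 𝒦 (σ + ρ) σ (2 * μ + ρ) (C * (p : ℝ) ^ (σ + ρ) * R ^ (μ + ρ)) where
  nonneg := by linarith [h.exp_nonneg]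
  le := hσ
  const_nonneg := mul_nonneg (mul_nonneg h.const_nonneg (by positivity)) (by positivity)
  bound J := by
    have hμ := h.exp_nonneg
    have hC' : 0 ≤ C * (p : ℝ) ^ (σ + ρ) * R ^ (μ + ρ) :=
      mul_nonneg (mul_nonneg h.const_nonneg (by positivity)) (by positivity)
    by_cases h0 : 𝒦 J = 0
    · rw [h0, norm_zero, zero_mul]
      exact mul_nonneg hC' (Finset.sum_nonneg fun a _ =>
        (Finset.prod_pos fun i _ => wt2_pos _ _).le)
    obtain ⟨a, ha⟩ := exists_max_jb hp J
    obtain ⟨b, hba, hb⟩ := hc J h0 a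
    have h1 : jb (frq J) ^ (σ + ρ) ≤ (p : ℝ) ^ (σ + ρ) * wt2 (σ + ρ) (J a) := by
      rw [wt2, ← Real.mul_rpow (by positivity) (jb_nonneg _)]
      exact Real.rpow_le_rpow (jb_nonneg _) (jb_frq_le J ha) (by linarith)
    -- The power is transferred to slot `b`; the weights of the other slots are at least 1 and are
    -- inserted for free, so that the result does not depend on `b`.
    have h2 : wt2 (μ + ρ) (J a) ≤ R ^ (μ + ρ) *
        ∏ i ∈ Finset.univ.erase a, wt2 (μ + ρ) (J i) := by
      refine (Real.rpow_le_rpow (jb_nonneg _) hb (by linarith)).trans ?_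
      rw [Real.mul_rpow (by linarith) (jb_nonneg _)]
      refine mul_le_mul_of_nonneg_left ?_ (by positivity)
      have hbm : b ∈ Finset.univ.erase a := Finset.mem_erase.2 ⟨hba, Finset.mem_univ b⟩
      rw [← Finset.mul_prod_erase _ _ hbm]
      refine le_mul_of_one_le_right (wt2_pos _ _).le ?_
      exact Finset.one_le_prod fun i _ => one_le_jb_rpow _ (by linarith)
    calc ‖𝒦 J‖ * jb (frq J) ^ (σ + ρ)
        ≤ (C * ∏ i, wt2 μ (J i)) * ((p : ℝ) ^ (σ + ρ) * wt2 (σ + ρ) (J a)) := by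
          refine mul_le_mul (h.bound J) h1 (jb_rpow_pos _ _).le ?_
          exact mul_nonneg h.const_nonneg (prod_wt2_pos _ _ _).le
      _ = C * (p : ℝ) ^ (σ + ρ) * (wt2 σ (J a) *
            ((∏ i ∈ Finset.univ.erase a, wt2 μ (J i)) * wt2 (μ + ρ) (J a))) := by
          rw [← Finset.mul_prod_erase _ _ (Finset.mem_univ a)]
          have e1 : wt2 (σ + ρ) (J a) = wt2 σ (J a) * wt2 ρ (J a) := Real.rpow_add (jb_pos _) _ _
          have e2 : wt2 (μ + ρ) (J a) = wt2 μ (J a) * wt2 ρ (J a) := Real.rpow_add (jb_pos _) _ _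
          rw [e1, e2]; ring
      _ ≤ C * (p : ℝ) ^ (σ + ρ) * (wt2 σ (J a) *
            ((∏ i ∈ Finset.univ.erase a, wt2 μ (J i)) *
              (R ^ (μ + ρ) * ∏ i ∈ Finset.univ.erase a, wt2 (μ + ρ) (J i)))) := by
          refine mul_le_mul_of_nonneg_left (mul_le_mul_of_nonneg_left
            (mul_le_mul_of_nonneg_left h2 (prod_wt2_pos _ _ _).le) (wt2_pos _ _).le)
            (mul_nonneg h.const_nonneg (by positivity))
      _ = C * (p : ℝ) ^ (σ + ρ) * R ^ (μ + ρ) *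
            ∏ i, wt2 (if i = a then σ else 2 * μ + ρ) (J i) := by
          rw [prod_wt2_ite]
          have e3 : ∏ i ∈ Finset.univ.erase a, wt2 (2 * μ + ρ) (J i) =
              (∏ i ∈ Finset.univ.erase a, wt2 μ (J i)) *
                ∏ i ∈ Finset.univ.erase a, wt2 (μ + ρ) (J i) := by
            rw [← Finset.prod_mul_distrib]
            refine Finset.prod_congr rfl fun i _ => ?_
            rw [wt2, wt2, wt2, ← Real.rpow_add (jb_pos _)]
            congr 1; ring
          rw [e3]; ring
      _ ≤ _ := by
          refine mul_le_mul_of_nonneg_left ?_ hC'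
          exact Finset.single_le_sum
            (f := fun a => ∏ i, wt2 (if i = a then σ else 2 * μ + ρ) (J i))
            (fun a _ => (Finset.prod_pos fun i _ => wt2_pos _ _).le) (Finset.mem_univ a)

/-! ### Sums of time dependent families -/

lemma toW_add {ι : Type*} {w : ι → ℝ} [IsWeight w] {f g : ι → ℂ} (hf : MemW w f)
    (hg : MemW w g) : toW w (f + g) = toW w f + toW w g := by
  apply Subtype.ext
  rw [WL1.add_val, toW_val hf, toW_val hg, toW_val (MemW.add w hf hg)]

lemma dtI_add {ι : Type*} {w : ι → ℝ} [IsWeight w] {I : Set ℝ} (hI : IsTimeInterval I) {k : ℕ}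
    {u v : ℝ → ι → ℂ} (hu : CL1 I k w u) (hv : CL1 I k w v) {κ : ℕ} (hκ : κ ≤ k) {t : ℝ}
    (ht : t ∈ I) : dtI I κ (fun t => u t + v t) t = dtI I κ u t + dtI I κ v t := by
  funext i
  exact iteratedDerivWithin_fun_add ht hI.uniqueDiffOn
    (((hu.smooth i).of_le (by exact_mod_cast hκ)) t ht)
    (((hv.smooth i).of_le (by exact_mod_cast hκ)) t ht)

lemma CL1.add {ι : Type*} {w : ι → ℝ} [IsWeight w] {I : Set ℝ} (hI : IsTimeInterval I) {k : ℕ}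
    {u v : ℝ → ι → ℂ} (hu : CL1 I k w u) (hv : CL1 I k w v) :
    CL1 I k w fun t => u t + v t := by
  refine ⟨fun i => (hu.smooth i).add (hv.smooth i), fun κ hκ t ht => ?_, fun κ hκ => ?_⟩
  · rw [dtI_add hI hu hv hκ ht]
    exact MemW.add w (hu.mem κ hκ t ht) (hv.mem κ hκ t ht)
  · refine ((hu.cont κ hκ).add (hv.cont κ hκ)).congr fun t ht => ?_
    rw [dtI_add hI hu hv hκ ht]
    exact toW_add (hu.mem κ hκ t ht) (hv.mem κ hκ t ht)

lemma CL1.zero {ι : Type*} (w : ι → ℝ) [IsWeight w] (I : Set ℝ) (k : ℕ) :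
    CL1 I k w fun _ => 0 := by
  have hz : ∀ κ t, dtI I κ (fun _ : ℝ => (0 : ι → ℂ)) t = 0 := by
    intro κ t; funext j; simp [dtI]
  refine ⟨fun j => contDiffOn_const, fun κ _ t _ => ?_, fun κ _ => ?_⟩
  · rw [hz]; exact (subW w).zero_mem
  · simp_rw [hz]; exact continuousOn_const

lemma nW_add_le {ι : Type*} {w : ι → ℝ} [IsWeight w] {f g : ι → ℂ} (hf : MemW w f)
    (hg : MemW w g) : nW w (f + g) ≤ nW w f + nW w g := by
  have h := norm_add_le (toW w f) (toW w g)
  rwa [← toW_add hf hg, WL1.norm_def, WL1.norm_def, WL1.norm_def, toW_val hf, toW_val hg,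
    toW_val (MemW.add w hf hg)] at h

/-! ### Non-homogeneous smoothing operators -/

/-- The right hand side of the estimate of non-homogeneous smoothing operators. -/
def smRHS (I : Set ℝ) (N : ℕ) (s₀ s : ℝ) (V : ℝ → Fn2) (u : ℝ → Fn) (t : ℝ) (kk : ℕ × ℕ) : ℝ :=
  normK I kk.2 s u t * normK2 I kk.1 s₀ V t ^ N +
    normK I kk.2 s₀ u t * normK2 I kk.1 s₀ V t ^ (N - 1) * normK2 I kk.1 s V t

lemma smRHS_nonneg (I : Set ℝ) (N : ℕ) (s₀ s : ℝ) (V : ℝ → Fn2) (u : ℝ → Fn) (t : ℝ)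
    (kk : ℕ × ℕ) : 0 ≤ smRHS I N s₀ s V u t kk :=
  add_nonneg (mul_nonneg (normK_nonneg _ _ _ _ _) (pow_nonneg (normK2_nonneg _ _ _ _ _) _))
    (mul_nonneg (mul_nonneg (normK_nonneg _ _ _ _ _) (pow_nonneg (normK2_nonneg _ _ _ _ _) _))
      (normK2_nonneg _ _ _ _ _))

/-- A version of the class of non-homogeneous smoothing operators with weighted `ℓ¹` norms. -/
structure IsStrongSmoothing (I : Set ℝ) (ρ : ℝ) (K N : ℕ) (r s₀ : ℝ) (R : Fn2 → Fn → Fn) :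
    Prop where
  linear : ∀ V, MemHs2 s₀ V → hsNorm2 s₀ V < r → ∀ u v, MemHs s₀ u → MemHs s₀ v →
    ∀ c : ℂ, R V (c • u + v) = c • R V u + R V v
  bound : ∀ s ≥ s₀, ∃ C : ℝ, 0 < C ∧ ∀ V : ℝ → Fn2, MemBall I K s₀ r V → MemCK2 I K s V →
    ∀ u : ℝ → Fn, MemCK I K s u → ∀ k ≤ K,
      CL1 I k (wt1 (s + ρ - 2 * k)) (fun t => R (V t) (u t)) ∧
      ∀ t ∈ I, nW (wt1 (s + ρ - 2 * k)) (dtI I k (fun t => R (V t) (u t)) t) ≤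
        C * ∑ kk ∈ Finset.HasAntidiagonal.antidiagonal k, smRHS I N s₀ s V u t kk

lemma IsStrongSmoothing.isNonhomSmoothing {I : Set ℝ} {ρ : ℝ} {K N : ℕ} {r s₀ : ℝ}
    {R : Fn2 → Fn → Fn} (h : IsStrongSmoothing I ρ K N r s₀ R) :
    IsNonhomSmoothing I ρ K N r s₀ R where
  linear := h.linear
  bound s hs := by
    obtain ⟨C, hC, hb⟩ := h.bound s hs
    refine ⟨C, hC, fun V hV hVs u hu => ⟨?_, fun k hk t ht => ?_⟩⟩
    · exact memCK_of_cl1 fun k hk => (hb V hV hVs u hu k hk).1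
    · have h1 := hb V hV hVs u hu k hk
      rw [← Finset.mul_sum]
      have e : s - 2 * k + ρ = s + ρ - 2 * k := by ring
      rw [e]
      exact ((h1.1.mem k le_rfl t ht).memHs.2).trans (h1.2 t ht)

lemma IsStrongSmoothing.add {I : Set ℝ} (hI : IsTimeInterval I) {ρ : ℝ} {K N : ℕ} {r s₀ : ℝ}
    {R R' : Fn2 → Fn → Fn} (h : IsStrongSmoothing I ρ K N r s₀ R)
    (h' : IsStrongSmoothing I ρ K N r s₀ R') :
    IsStrongSmoothing I ρ K N r s₀ fun V u => R V u + R' V u where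
  linear V hV hVr u v hu hv c := by
    rw [h.linear V hV hVr u v hu hv c, h'.linear V hV hVr u v hu hv c, smul_add]
    abel
  bound s hs := by
    obtain ⟨C, hC, hb⟩ := h.bound s hs
    obtain ⟨C', hC', hb'⟩ := h'.bound s hs
    refine ⟨C + C', add_pos hC hC', fun V hV hVs u hu k hk => ?_⟩
    have h1 := hb V hV hVs u hu k hk
    have h2 := hb' V hV hVs u hu k hk
    refine ⟨h1.1.add hI h2.1, fun t ht => ?_⟩
    rw [dtI_add hI h1.1 h2.1 le_rfl ht, add_mul]
    exact (nW_add_le (h1.1.mem k le_rfl t ht) (h2.1.mem k le_rfl t ht)).trans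
      (add_le_add (h1.2 t ht) (h2.2 t ht))

lemma IsStrongSmoothing.zero {I : Set ℝ} {ρ : ℝ} {K N : ℕ} {r s₀ : ℝ} :
    IsStrongSmoothing I ρ K N r s₀ fun _ _ => 0 where
  linear V hV hVr u v hu hv c := by simp
  bound s hs := by
    refine ⟨1, one_pos, fun V hV hVs u hu k hk => ⟨CL1.zero _ _ _, fun t ht => ?_⟩⟩
    have h0 : dtI I k (fun _ : ℝ => (0 : Fn)) t = 0 := by funext j; simp [dtI]
    rw [h0]
    have : nW (wt1 (s + ρ - 2 * k)) (0 : Fn) = 0 := by simp [nW]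
    rw [this, one_mul]
    exact Finset.sum_nonneg fun kk _ => smRHS_nonneg _ _ _ _ _ _ _ _

lemma IsStrongSmoothing.sum {I : Set ℝ} (hI : IsTimeInterval I) {ρ : ℝ} {K N : ℕ} {r s₀ : ℝ}
    {κ : Type*} (s : Finset κ) {R : κ → Fn2 → Fn → Fn}
    (h : ∀ i ∈ s, IsStrongSmoothing I ρ K N r s₀ (R i)) :
    IsStrongSmoothing I ρ K N r s₀ fun V u => ∑ i ∈ s, R i V u := by
  classical
  induction s using Finset.induction_on with
  | empty => simpa using IsStrongSmoothing.zero
  | insert a s ha ih =>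
    simp_rw [Finset.sum_insert ha]
    exact (h a (by simp)).add hI (ih fun i hi => h i (by simp [hi]))

/-- The arguments of an operator `R(U, …, U)u` acting on the component `e`. -/
def opArgs (q : ℕ) (e : Fin 2) (U : Fn2) (u : Fn) : Fin (q + 1) → Idx → ℂ :=
  Fin.snoc (fun _ => un U) (un (Pi.single e u))

@[simp] lemma opArgs_castSucc {q : ℕ} (e : Fin 2) (U : Fn2) (u : Fn) (i : Fin q) :
    opArgs q e U u i.castSucc = un U := by simp [opArgs]

@[simp] lemma opArgs_last {q : ℕ} (e : Fin 2) (U : Fn2) (u : Fn) :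
    opArgs q e U u (Fin.last q) = un (Pi.single e u) := by simp [opArgs]

lemma MemCK.mono {I : Set ℝ} {k K : ℕ} {s s' : ℝ} {u : ℝ → Fn} (h : MemCK I K s u)
    (hk : k ≤ K) (hs : s' ≤ s) : MemCK I k s' u :=
  MemCK2.mono (U := fun t _ => u t) (fun _ => h) hk hs 0

lemma un_single_smul_add (e : Fin 2) (c : ℂ) (u v : Fn) :
    un (Pi.single e (c • u + v)) = c • un (Pi.single e u) + un (Pi.single e v) := by
  funext J
  by_cases h : J.1 = e
  · simp [un, ← h]
  · simp [un, h]

lemma opArgs_memW {q : ℕ} {e : Fin 2} {U : Fn2} {u : Fn} {σ s : ℝ} (h : σ + 1 ≤ s)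
    (hU : MemHs2 s U) (hu : MemHs s u) (i : Fin (q + 1)) : MemW (wt2 σ) (opArgs q e U u i) := by
  refine Fin.lastCases ?_ (fun i => ?_) i
  · rw [opArgs_last]; exact un_single_memW_iff.2 (hu.memW h).1
  · rw [opArgs_castSucc]; exact (hU.memW h).1

lemma mulT_opArgs_linear {q : ℕ} {e : Fin 2} {𝒦 : (Fin (q + 1) → Idx) → ℂ} {U : Fn2} {u v : Fn}
    (c : ℂ) (hu : Summable fun J => ‖𝒦 J * tens (opArgs q e U u) J‖)
    (hv : Summable fun J => ‖𝒦 J * tens (opArgs q e U v) J‖) :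
    mulT 𝒦 (opArgs q e U (c • u + v)) = c • mulT 𝒦 (opArgs q e U u) + mulT 𝒦 (opArgs q e U v) := by
  have h1 : ∀ x : Fn, opArgs q e U x =
      Function.update (opArgs q e U u) (Fin.last q) (un (Pi.single e x)) := by
    intro x; simp [opArgs, Fin.update_snoc_last]
  rw [h1 u, h1 v, h1 (c • u + v)]
  rw [h1 u] at hu
  rw [h1 v] at hv
  rw [un_single_smul_add, mulT_update_add, mulT_update_smul]
  · refine (hu.mul_left ‖c‖).congr fun J => ?_
    rw [← tensMul_apply, ← tensMul_apply, MultilinearMap.map_update_smul]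
    simp only [norm_mul, smul_eq_mul]; ring
  · exact hv

lemma pow_le_pow_mul_of_le {x r : ℝ} (hx : 0 ≤ x) (hxr : x ≤ r) {N q : ℕ} (h : N ≤ q) :
    x ^ q ≤ r ^ (q - N) * x ^ N := by
  obtain ⟨d, rfl⟩ := Nat.exists_eq_add_of_le h
  rw [pow_add, mul_comm, Nat.add_sub_cancel_left]
  gcongr

lemma prod_snoc_bound_last {q : ℕ} {f : Fin (q + 1) → ℝ} (h0 : ∀ i, 0 ≤ f i) {x y : ℝ}
    (h1 : ∀ i : Fin q, f i.castSucc ≤ x) (h2 : f (Fin.last q) ≤ y) (hx : 0 ≤ x) :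
    ∏ i, f i ≤ x ^ q * y := by
  rw [Fin.prod_univ_castSucc]
  refine mul_le_mul ?_ h2 (h0 _) (pow_nonneg hx _)
  refine (Finset.prod_le_prod (fun i _ => h0 _) fun i _ => h1 i).trans_eq (by simp)

lemma prod_snoc_bound_castSucc {q : ℕ} {f : Fin (q + 1) → ℝ} (h0 : ∀ i, 0 ≤ f i) {x y z : ℝ}
    (a : Fin q) (h1 : ∀ i : Fin q, i ≠ a → f i.castSucc ≤ x) (ha : f a.castSucc ≤ z)
    (h2 : f (Fin.last q) ≤ y) (hx : 0 ≤ x) (hz : 0 ≤ z) :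
    ∏ i, f i ≤ z * x ^ (q - 1) * y := by
  rw [Fin.prod_univ_castSucc]
  refine mul_le_mul ?_ h2 (h0 _) (mul_nonneg hz (pow_nonneg hx _))
  rw [← Finset.mul_prod_erase _ _ (Finset.mem_univ a)]
  refine mul_le_mul ha ?_ (Finset.prod_nonneg fun i _ => h0 _) hz
  refine (Finset.prod_le_prod (fun i _ => h0 _)
    fun i hi => h1 i (Finset.ne_of_mem_erase hi)).trans_eq (by simp)

lemma MemBall.le {I : Set ℝ} {K : ℕ} {s r : ℝ} {U : ℝ → Fn2} (h : MemBall I K s r U) {k : ℕ}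
    (hk : k ≤ K) {t : ℝ} (ht : t ∈ I) : normK2 I k s U t ≤ r := by
  obtain ⟨-, r', hr', hb⟩ := h
  exact (normK2_mono hk s U t).trans ((hb t ht).trans hr'.le)

/-- Multilinear Fourier multipliers whose two largest frequencies are comparable are smoothing. -/
lemma isStrongSmoothing_mulT {I : Set ℝ} (hI : IsTimeInterval I) {ρ : ℝ} (hρ : 0 < ρ) {K N q : ℕ}
    (hN : 1 ≤ N) (hq : N ≤ q) {r s₀ : ℝ} (e : Fin 2)
    {𝒦 : (Fin (q + 1) → Idx) → ℂ} {μ C R : ℝ} (h : KerBdd 𝒦 μ C) (hR : 1 ≤ R)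
    (hc : Comparable 𝒦 R) (hs₀ : 2 * K + 2 * μ + ρ + 2 ≤ s₀) :
    IsStrongSmoothing I ρ K N r s₀ fun V u => mulT 𝒦 (opArgs q e V u) where
  linear V hV _ u v hu hv c := by
    have hμ := h.exp_nonneg
    have hK : (0 : ℝ) ≤ K := Nat.cast_nonneg K
    have hest := h.est_smoothing (Nat.succ_pos q) hR hc (σ := s₀ - 1) hρ.le (by linarith)
    exact mulT_opArgs_linear c
      (hest.summable_norm fun i => opArgs_memW (by linarith) hV hu i)
      (hest.summable_norm fun i => opArgs_memW (by linarith) hV hv i)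
  bound s hs := by
    have hμ := h.exp_nonneg
    have hkK : ∀ k ≤ K, (k : ℝ) ≤ K := fun k hk => by exact_mod_cast hk
    -- A gain of ρ + 1 is taken instead of ρ: the additional derivative pays for the embedding of
    -- H^{s−2k} into ℓ¹ of order s − 2k − 1.
    have hest : ∀ k ≤ K, KerEst 𝒦 (s + ρ - 2 * k) (s - 2 * k - 1) (2 * μ + (ρ + 1))
        (C * ((q + 1 : ℕ) : ℝ) ^ (s - 2 * k - 1 + (ρ + 1)) * R ^ (μ + (ρ + 1))) := by
      intro k hk
      have := hkK k hk
      have h1 := h.est_smoothing (Nat.succ_pos q) hR hc (σ := s - 2 * k - 1) (ρ := ρ + 1)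
        (by linarith) (by linarith)
      convert h1 using 1
      ring
    set Ck : ℕ → ℝ := fun k =>
      C * ((q + 1 : ℕ) : ℝ) ^ (s - 2 * k - 1 + (ρ + 1)) * R ^ (μ + (ρ + 1)) with hCk
    have hCk0 : ∀ k, 0 ≤ Ck k := fun k =>
      mul_nonneg (mul_nonneg h.const_nonneg (by positivity)) (by positivity)
    -- One embedding constant for each of the q + 1 factors, and a power of the radius that absorbs
    -- the q − N surplus factors V.
    set D : ℝ := (2 * sobC) ^ (q + 1) * |r| ^ (q - N) with hD
    have hS : 0 ≤ 2 * sobC := mul_nonneg zero_le_two sobC_nonneg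
    have hD0 : 0 ≤ D := by positivity
    -- The sum over k makes the constant uniform in k ≤ K, and the summand 1 makes it positive.
    refine ⟨1 + ∑ k ∈ Finset.range (K + 1), (q + 1 : ℝ) ^ k * (Ck k * ((q + 1) * D)),
      add_pos_of_pos_of_nonneg one_pos (Finset.sum_nonneg fun k _ => ?_),
      fun V hV hVs u hu k hk => ?_⟩
    · exact mul_nonneg (by positivity) (mul_nonneg (hCk0 k) (by positivity))
    have hV0 : MemCK2 I K s₀ V := hV.1
    have hu0 : MemCK I K s₀ u := hu.mono le_rfl hs
    have hkr := hkK k hk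
    have hcl : ∀ i, CL1 I k (wt2 (s - 2 * k - 1)) (fun t => opArgs q e (V t) (u t) i) := by
      intro i
      refine Fin.lastCases ?_ (fun i => ?_) i
      · simp only [opArgs_last]; exact (hu.cl1 hk (by linarith)).single e
      · simp only [opArgs_castSucc]; exact hVs.cl1 hk (by linarith)
    have hmain := (hest k hk).cl1 hI (k := k) (v := fun i t => opArgs q e (V t) (u t) i) hcl
    refine ⟨hmain.1, fun t ht => ?_⟩
    rw [hmain.2 k le_rfl t ht]
    have hterm : ∀ g : Fin k → Fin (q + 1),
        MemW (wt1 (s + ρ - 2 * k)) (mulT 𝒦 fun i =>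
          dtI I (cnt g i) (fun t => opArgs q e (V t) (u t) i) t) ∧
        nW (wt1 (s + ρ - 2 * k)) (mulT 𝒦 fun i =>
          dtI I (cnt g i) (fun t => opArgs q e (V t) (u t) i) t) ≤
          Ck k * ((q + 1) * (D * ∑ kk ∈ Finset.HasAntidiagonal.antidiagonal k,
            smRHS I N s₀ s V u t kk)) := by
      intro g
      have hm : ∀ i, MemW (wt2 (s - 2 * k - 1))
          (dtI I (cnt g i) (fun t => opArgs q e (V t) (u t) i) t) :=
        fun i => (hcl i).mem _ (cnt_le g i) t ht
      refine ⟨(hest k hk).memW hm, ((hest k hk).nW_le hm).trans ?_⟩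
      refine mul_le_mul_of_nonneg_left ?_ (hCk0 k)
      -- Here k'' derivatives fall on u and k' = k − k'' on all copies of V together, so no single
      -- copy receives more than k'.
      set k'' := cnt g (Fin.last q) with hk''
      set k' := k - k'' with hk'
      have hk''le : k'' ≤ k := cnt_le g _
      have hanti : (k', k'') ∈ Finset.HasAntidiagonal.antidiagonal k := by
        rw [Finset.HasAntidiagonal.mem_antidiagonal]; omega
      have hcl' : ∀ i : Fin q, cnt g i.castSucc ≤ k' := by
        intro i
        have h1 := sum_cnt g
        rw [Fin.sum_univ_castSucc] at h1
        have h2 := Finset.single_le_sum (f := fun i : Fin q => cnt g i.castSucc)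
          (fun _ _ => Nat.zero_le _) (Finset.mem_univ i)
        omega
      have hF : smRHS I N s₀ s V u t (k', k'') ≤
          ∑ kk ∈ Finset.HasAntidiagonal.antidiagonal k, smRHS I N s₀ s V u t kk :=
        Finset.single_le_sum (f := smRHS I N s₀ s V u t)
          (fun kk _ => smRHS_nonneg _ _ _ _ _ _ _ _) hanti
      set x := normK2 I k' s₀ V t with hx
      set z := normK2 I k' s V t with hz
      set y := normK I k'' s u t with hy
      set y₀ := normK I k'' s₀ u t with hy0
      have hx0 : 0 ≤ x := normK2_nonneg _ _ _ _ _
      have hz0 : 0 ≤ z := normK2_nonneg _ _ _ _ _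
      have hyn : 0 ≤ y := normK_nonneg _ _ _ _ _
      have hy0n : 0 ≤ y₀ := normK_nonneg _ _ _ _ _
      have hxr : x ≤ |r| := (hV.le (by omega) ht).trans (le_abs_self r)
      have hci : ∀ i, (cnt g i : ℝ) ≤ k := fun i => by exact_mod_cast cnt_le g i
      have bV : ∀ i : Fin q, nW (wt2 (s - 2 * k - 1)) (dtI I (cnt g i.castSucc)
          (fun t => opArgs q e (V t) (u t) i.castSucc) t) ≤ 2 * sobC * z := by
        intro i
        simp only [opArgs_castSucc]
        have := hci i.castSucc
        exact nW_dtI_un_le (hcl' i) (by omega) (by linarith) hVs ht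
      have bV0 : ∀ i : Fin q, nW (wt2 (2 * μ + (ρ + 1))) (dtI I (cnt g i.castSucc)
          (fun t => opArgs q e (V t) (u t) i.castSucc) t) ≤ 2 * sobC * x := by
        intro i
        simp only [opArgs_castSucc]
        have := hci i.castSucc
        exact nW_dtI_un_le (hcl' i) (by omega) (by linarith) hV0 ht
      have bu : nW (wt2 (s - 2 * k - 1)) (dtI I (cnt g (Fin.last q))
          (fun t => opArgs q e (V t) (u t) (Fin.last q)) t) ≤ 2 * sobC * y := by
        simp only [opArgs_last]
        have := hci (Fin.last q)
        exact nW_dtI_single_le le_rfl (by omega) (by linarith) hu e ht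
      have bu0 : nW (wt2 (2 * μ + (ρ + 1))) (dtI I (cnt g (Fin.last q))
          (fun t => opArgs q e (V t) (u t) (Fin.last q)) t) ≤ 2 * sobC * y₀ := by
        simp only [opArgs_last]
        have := hci (Fin.last q)
        exact nW_dtI_single_le le_rfl (by omega) (by linarith) hu0 e ht
      refine (Finset.sum_le_card_nsmul _ _ (D * ∑ kk ∈ Finset.HasAntidiagonal.antidiagonal k,
        smRHS I N s₀ s V u t kk) fun a _ => ?_).trans_eq (by simp)
      refine le_trans ?_ (mul_le_mul_of_nonneg_left hF hD0)
      -- High norm on u gives the first term of `smRHS`, high norm on a copy of V gives the second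
      -- one.
      refine Fin.lastCases ?_ (fun a => ?_) a
      · refine (prod_snoc_bound_last (fun i => nW_nonneg _ _) (x := 2 * sobC * x)
          (y := 2 * sobC * y) (fun i => ?_) ?_ (by positivity)).trans ?_
        · rw [if_neg (Fin.castSucc_lt_last i).ne]; exact bV0 i
        · rw [if_pos rfl]; exact bu
        · have hp := pow_le_pow_mul_of_le hx0 hxr hq
          calc (2 * sobC * x) ^ q * (2 * sobC * y) = (2 * sobC) ^ (q + 1) * (x ^ q * y) := by ring
            _ ≤ (2 * sobC) ^ (q + 1) * ((|r| ^ (q - N) * x ^ N) * y) := by gcongr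
            _ = D * (y * x ^ N) := by rw [hD]; ring
            _ ≤ _ := by
              refine mul_le_mul_of_nonneg_left ?_ hD0
              exact le_add_of_nonneg_right (by positivity)
      · refine (prod_snoc_bound_castSucc (fun i => nW_nonneg _ _) a (x := 2 * sobC * x)
          (y := 2 * sobC * y₀) (z := 2 * sobC * z) (fun i hi => ?_) ?_ ?_ (by positivity)
          (by positivity)).trans ?_
        · rw [if_neg (by simpa using hi)]; exact bV0 i
        · rw [if_pos rfl]; exact bV a
        · rw [if_neg (Fin.castSucc_lt_last a).ne']; exact bu0
        · have hp := pow_le_pow_mul_of_le hx0 hxr (show N - 1 ≤ q - 1 by omega)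
          have e1 : q - 1 - (N - 1) = q - N := by omega
          rw [e1] at hp
          have e2 : q + 1 = (q - 1) + 2 := by omega
          calc 2 * sobC * z * (2 * sobC * x) ^ (q - 1) * (2 * sobC * y₀)
              = (2 * sobC) ^ (q + 1) * (z * x ^ (q - 1) * y₀) := by rw [e2]; ring
            _ ≤ (2 * sobC) ^ (q + 1) * (z * (|r| ^ (q - N) * x ^ (N - 1)) * y₀) := by gcongr
            _ = D * (y₀ * x ^ (N - 1) * z) := by rw [hD]; ring
            _ ≤ _ := by
              refine mul_le_mul_of_nonneg_left ?_ hD0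
              exact le_add_of_nonneg_left (by positivity)
    refine (nW_sum_le fun g _ => (hterm g).1).trans ?_
    refine (Finset.sum_le_card_nsmul _ _ _ fun g _ => (hterm g).2).trans ?_
    have hsum0 : 0 ≤ ∑ kk ∈ Finset.HasAntidiagonal.antidiagonal k, smRHS I N s₀ s V u t kk :=
      Finset.sum_nonneg fun kk _ => smRHS_nonneg _ _ _ _ _ _ _ _
    have hfin : (q + 1 : ℝ) ^ k * (Ck k * ((q + 1) * D)) ≤
        1 + ∑ k ∈ Finset.range (K + 1), (q + 1 : ℝ) ^ k * (Ck k * ((q + 1) * D)) := by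
      have := Finset.single_le_sum (f := fun k => (q + 1 : ℝ) ^ k * (Ck k * ((q + 1) * D)))
        (fun k _ => mul_nonneg (by positivity) (mul_nonneg (hCk0 k) (by positivity)))
        (Finset.mem_range.2 (Nat.lt_succ_of_le hk))
      linarith
    refine le_trans (le_of_eq ?_) (mul_le_mul_of_nonneg_right hfin hsum0)
    simp only [Finset.card_univ, Fintype.card_fun, Fintype.card_fin, nsmul_eq_mul]
    push_cast
    ring

/-! ### Non-homogeneous symbols -/

/-- The symbol that is a polynomial in `ξ`, whose coefficients are multilinear multipliers. -/
def polySym {q : ℕ} (𝒦 : Fin 3 → (Fin q → Idx) → ℂ) (v : Fin q → Idx → ℂ) (x ξ : ℝ) : ℂ :=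
  ∑ l, evalFn (mulT (𝒦 l) v) x * xiPow l ξ

lemma mulT_zero_ker {q : ℕ} (v : Fin q → Idx → ℂ) :
    mulT (0 : (Fin q → Idx) → ℂ) v = 0 := by
  funext k; simp [mulT]

lemma dx_iterate_zero (α : ℕ) : dx^[α] (0 : Fn) = 0 := by
  induction α with
  | zero => rfl
  | succ α ih =>
    rw [Function.iterate_succ_apply, show dx (0 : Fn) = 0 by funext j; simp [dx], ih]

lemma MemBall.mono {I : Set ℝ} {K : ℕ} {s r r' : ℝ} {U : ℝ → Fn2} (h : MemBall I K s r U)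
    (hr : r ≤ r') : MemBall I K s r' U :=
  ⟨h.1, h.2.choose, h.2.choose_spec.1.trans_le hr, h.2.choose_spec.2⟩

lemma descFactorial_le_two (l : Fin 3) (β : ℕ) : ((l : ℕ).descFactorial β : ℝ) ≤ 2 := by
  have h : (l : ℕ).descFactorial β ≤ 2 := by
    rcases lt_or_ge (l : ℕ) β with h | h
    · rw [Nat.descFactorial_of_lt h]; omega
    · rw [Nat.descFactorial_eq_div h]
      refine (Nat.div_le_self _ _).trans ?_
      exact (Nat.factorial_le (show (l : ℕ) ≤ 2 by omega)).trans (by simp [Nat.factorial])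
  exact_mod_cast h

lemma prod_bound_one {q : ℕ} {f : Fin q → ℝ} (h0 : ∀ i, 0 ≤ f i) {x z : ℝ} (a : Fin q)
    (h1 : ∀ i, i ≠ a → f i ≤ x) (ha : f a ≤ z) (hz : 0 ≤ z) :
    ∏ i, f i ≤ z * x ^ (q - 1) := by
  rw [← Finset.mul_prod_erase _ _ (Finset.mem_univ a)]
  refine mul_le_mul ha ?_ (Finset.prod_nonneg fun i _ => h0 _) hz
  refine (Finset.prod_le_prod (fun i _ => h0 _)
    fun i hi => h1 i (Finset.ne_of_mem_erase hi)).trans_eq (by simp)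

/-- The alternative in `hm` allows any order m, provided that the coefficients of powers above m
vanish; the same lemma then serves the symbols of order 2 and the functions of order 0. -/
lemma isNonhomSymbol_polySym {I : Set ℝ} (hI : IsTimeInterval I) {m : ℝ} {K N q : ℕ}
    (hN : 1 ≤ N) (hq : N ≤ q) {r s₀ : ℝ} (hr : 0 < r) {𝒦 : Fin 3 → (Fin q → Idx) → ℂ} {μ C : ℝ}
    (h : ∀ l, KerBdd (𝒦 l) μ C) (hm : ∀ l : Fin 3, 𝒦 l = 0 ∨ ((l : ℕ) : ℝ) ≤ m)
    (hs₀ : 2 * K + μ + 1 ≤ s₀) :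
    IsNonhomSymbol I m K N r s₀ fun U => polySym 𝒦 fun _ => un U where
  periodic U _ _ x ξ := by
    simp only [polySym, evalFn_periodic]
  bound k hk s hs := by
    have hμ := (h 0).exp_nonneg
    have hC0 := (h 0).const_nonneg
    have hkK : (k : ℝ) ≤ K := by exact_mod_cast hk
    have hqp : 0 < q := by omega
    have hest : ∀ l, ∀ α : ℕ, KerEst (𝒦 l) α (α + μ) μ (C * (q : ℝ) ^ (α : ℝ)) := fun l α =>
      (h l).est hqp (Nat.cast_nonneg α)
    have hS : 0 ≤ 2 * sobC := mul_nonneg zero_le_two sobC_nonneg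
    set E : ℕ → ℝ := fun α =>
      (q : ℝ) ^ k * ((C * (q : ℝ) ^ (α : ℝ)) * (q * ((2 * sobC) ^ q * r ^ (q - N)))) with hE
    have hE0 : ∀ α, 0 ≤ E α := fun α => by positivity
    -- Only finitely many α ≤ s − s₀ occur, so one constant can serve them all.
    set m₀ := ⌈s - s₀⌉₊ + 1 with hm₀
    -- The factor 6 counts three powers of ξ, each with a descending factorial at most 2. The radius
    -- r/2 is an arbitrary one strictly between 0 and r.
    refine ⟨1 + 6 * ∑ α ∈ Finset.range m₀, E α,
      add_pos_of_pos_of_nonneg one_pos (mul_nonneg (by norm_num)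
        (Finset.sum_nonneg fun α _ => hE0 α)),
      r / 2, by linarith, by linarith, fun U hU hUs => ?_⟩
    set G : Fin 3 → ℝ → Fn := fun l t => mulT (𝒦 l) fun _ => un (U t) with hG
    -- The condition 2K + μ + 1 ≤ s₀ enters here: α derivatives in x, the growth μ of the kernel,
    -- one derivative for the embedding and 2k for the time derivatives.
    have hα : ∀ α : ℕ, (α : ℝ) ≤ s - s₀ → (α : ℝ) + μ + 1 ≤ s - 2 * k := fun α hα => by linarith
    have hcl : ∀ l, ∀ α : ℕ, (α : ℝ) ≤ s - s₀ → CL1 I k (wt1 α) (G l) ∧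
        ∀ κ ≤ k, ∀ t ∈ I, dtI I κ (G l) t =
          ∑ g : Fin κ → Fin q, mulT (𝒦 l) fun i => dtI I (cnt g i) (fun t => un (U t)) t :=
      fun l α h1 => (hest l α).cl1 hI (v := fun _ t => un (U t))
        fun _ => hUs.cl1 le_rfl (hα α h1)
    refine ⟨_, isJet_of_cl1 hI (A := s - s₀) (G := G) fun l α h1 => (hcl l α h1).1,
      fun α β h1 t ht x ξ => ?_⟩
    set X := normK2 I k s₀ U t with hX
    set Z := normK2 I k s U t with hZ
    have hX0 : 0 ≤ X := normK2_nonneg _ _ _ _ _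
    have hZ0 : 0 ≤ Z := normK2_nonneg _ _ _ _ _
    have hXr : X ≤ r := (hU.le hk ht).trans (by linarith)
    have hUs0 : MemCK2 I k s₀ U := hU.1.mono hk le_rfl
    have hnW : ∀ l, nW (wt1 α) (dtI I k (G l) t) ≤ E α * (X ^ (N - 1) * Z) := by
      intro l
      rw [(hcl l α h1).2 k le_rfl t ht]
      have hterm : ∀ g : Fin k → Fin q,
          MemW (wt1 α) (mulT (𝒦 l) fun i => dtI I (cnt g i) (fun t => un (U t)) t) ∧
          nW (wt1 α) (mulT (𝒦 l) fun i => dtI I (cnt g i) (fun t => un (U t)) t) ≤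
            (C * (q : ℝ) ^ (α : ℝ)) *
              (q * ((2 * sobC) ^ q * r ^ (q - N) * (X ^ (N - 1) * Z))) := by
        intro g
        have hmem : ∀ i, MemW (wt2 (α + μ)) (dtI I (cnt g i) (fun t => un (U t)) t) := fun i =>
          (hUs.cl1 le_rfl (hα α h1)).mem _ (cnt_le g i) t ht
        refine ⟨(hest l α).memW hmem, ((hest l α).nW_le hmem).trans ?_⟩
        refine mul_le_mul_of_nonneg_left ?_ (by positivity)
        refine (Finset.sum_le_card_nsmul _ _
          ((2 * sobC) ^ q * r ^ (q - N) * (X ^ (N - 1) * Z)) fun a _ => ?_).trans_eq (by simp)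
        have hci : ∀ i, (cnt g i : ℝ) ≤ k := fun i => by exact_mod_cast cnt_le g i
        refine (prod_bound_one (fun i => nW_nonneg _ _) a (x := 2 * sobC * X)
          (z := 2 * sobC * Z) (fun i hi => ?_) ?_ (by positivity)).trans ?_
        · rw [if_neg hi]
          have := hci i
          exact nW_dtI_un_le (cnt_le g i) le_rfl (by linarith) hUs0 ht
        · rw [if_pos rfl]
          have := hci a
          exact nW_dtI_un_le (cnt_le g a) le_rfl (by linarith) hUs ht
        · have hp := pow_le_pow_mul_of_le hX0 hXr (show N - 1 ≤ q - 1 by omega)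
          rw [show q - 1 - (N - 1) = q - N by omega] at hp
          calc 2 * sobC * Z * (2 * sobC * X) ^ (q - 1)
              = (2 * sobC) ^ (q - 1 + 1) * (X ^ (q - 1) * Z) := by ring
            _ ≤ (2 * sobC) ^ (q - 1 + 1) * ((r ^ (q - N) * X ^ (N - 1)) * Z) := by gcongr
            _ = _ := by rw [show q - 1 + 1 = q by omega]; ring
      refine (nW_sum_le fun g _ => (hterm g).1).trans ?_
      refine (Finset.sum_le_card_nsmul _ _ _ fun g _ => (hterm g).2).trans_eq ?_
      simp only [Finset.card_univ, Fintype.card_fun, Fintype.card_fin, nsmul_eq_mul, hE]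
      push_cast
      ring
    have hl : ∀ l : Fin 3, ‖evalFn (dx^[α] (dtI I k (G l) t)) x *
        iteratedDeriv β (xiPow l) ξ‖ ≤ 2 * (E α * (X ^ (N - 1) * Z)) * jb ξ ^ (m - β) := by
      intro l
      have hE0' := hE0 α
      rcases hm l with h0 | hlm
      · have hz : dtI I k (G l) t = 0 := by
          funext j; simp [dtI, hG, h0, mulT_zero_ker]
        rw [hz, dx_iterate_zero, evalFn_zero, zero_mul, norm_zero]
        exact mul_nonneg (by positivity) (jb_rpow_pos _ _).le
      · rw [norm_mul]
        have hmw := (hcl l α h1).1.mem k le_rfl t ht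
        have h2 := (norm_evalFn_le hmw.dx_iterate.1 x).trans (hmw.dx_iterate.2.trans (hnW l))
        have h3 := (norm_iteratedDeriv_xiPow_le (l : ℕ) β hlm ξ).trans
          (mul_le_mul_of_nonneg_right (descFactorial_le_two l β) (jb_rpow_pos _ _).le)
        calc _ ≤ (E α * (X ^ (N - 1) * Z)) * (2 * jb ξ ^ (m - β)) :=
              mul_le_mul h2 h3 (norm_nonneg _) (by positivity)
          _ = _ := by ring
    refine (norm_sum_le _ _).trans ((Finset.sum_le_card_nsmul _ _ _ fun l _ => hl l).trans ?_)
    have hEs : E α ≤ ∑ α ∈ Finset.range m₀, E α := by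
      refine Finset.single_le_sum (f := E) (fun α _ => hE0 α) (Finset.mem_range.2 ?_)
      rw [hm₀, Nat.lt_succ_iff]
      exact_mod_cast h1.trans (Nat.le_ceil _)
    have hY : 0 ≤ jb ξ ^ (m - β) * X ^ (N - 1) * Z :=
      mul_nonneg (mul_nonneg (jb_rpow_pos _ _).le (by positivity)) hZ0
    have h6 : (6 * E α) ≤ 1 + 6 * ∑ α ∈ Finset.range m₀, E α := by linarith
    have h7 := mul_le_mul_of_nonneg_right h6 hY
    simp only [Finset.card_univ, Fintype.card_fin, nsmul_eq_mul]
    push_cast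
    linarith

lemma IsJet.add {I : Set ℝ} {k : ℕ} {A : ℝ} {g g' : ℝ → ℝ → ℝ → ℂ}
    {D D' : ℕ → ℕ → ℕ → ℝ → ℝ → ℝ → ℂ} (h : IsJet I k A g D) (h' : IsJet I k A g' D') :
    IsJet I k A (fun t x ξ => g t x ξ + g' t x ξ)
      fun κ α β t x ξ => D κ α β t x ξ + D' κ α β t x ξ where
  base t ht := by funext x ξ; rw [h.base t ht, h'.base t ht]
  cont κ hκ α hα β := (h.cont κ hκ α hα β).add (h'.cont κ hκ α hα β)
  deriv_t κ hκ α hα β t ht x ξ := (h.deriv_t κ hκ α hα β t ht x ξ).add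
    (h'.deriv_t κ hκ α hα β t ht x ξ)
  deriv_x κ hκ α hα β t ht x ξ := (h.deriv_x κ hκ α hα β t ht x ξ).add
    (h'.deriv_x κ hκ α hα β t ht x ξ)
  deriv_xi κ hκ α hα β t ht x ξ := (h.deriv_xi κ hκ α hα β t ht x ξ).add
    (h'.deriv_xi κ hκ α hα β t ht x ξ)

lemma IsNonhomSymbol.add {I : Set ℝ} {m : ℝ} {K N : ℕ} {r s₀ : ℝ} {a a' : Fn2 → ℝ → ℝ → ℂ}
    (h : IsNonhomSymbol I m K N r s₀ a) (h' : IsNonhomSymbol I m K N r s₀ a') :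
    IsNonhomSymbol I m K N r s₀ fun U x ξ => a U x ξ + a' U x ξ where
  periodic U hU hUr x ξ := by rw [h.periodic U hU hUr, h'.periodic U hU hUr]
  bound k hk s hs := by
    obtain ⟨C, hC, rs, hrs, hrs', hb⟩ := h.bound k hk s hs
    obtain ⟨C', hC', ts, hts, hts', hb'⟩ := h'.bound k hk s hs
    refine ⟨C + C', add_pos hC hC', min rs ts, lt_min hrs hts, (min_le_left _ _).trans_lt hrs',
      fun U hU hUs => ?_⟩
    obtain ⟨D, hD, hDb⟩ := hb U (hU.mono (min_le_left _ _)) hUs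
    obtain ⟨D', hD', hDb'⟩ := hb' U (hU.mono (min_le_right _ _)) hUs
    refine ⟨_, hD.add hD', fun α β hα t ht x ξ => (norm_add_le _ _).trans ?_⟩
    refine (add_le_add (hDb α β hα t ht x ξ) (hDb' α β hα t ht x ξ)).trans_eq ?_
    ring

lemma IsNonhomSymbol.zero {I : Set ℝ} {m : ℝ} {K N : ℕ} {r s₀ : ℝ} (hr : 0 < r) :
    IsNonhomSymbol I m K N r s₀ fun _ _ _ => 0 where
  periodic _ _ _ _ _ := rfl
  bound k hk s hs := by
    refine ⟨1, one_pos, r / 2, by linarith, by linarith, fun U _ _ => ⟨fun _ _ _ _ _ _ => 0,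
      ⟨fun _ _ => rfl, fun _ _ _ _ _ => continuousOn_const,
        fun _ _ _ _ _ _ _ _ _ => hasDerivWithinAt_const _ _ _,
        fun _ _ _ _ _ _ _ _ _ => hasDerivAt_const _ _,
        fun _ _ _ _ _ _ _ _ _ => hasDerivAt_const _ _⟩, fun α β _ t _ x ξ => ?_⟩⟩
    rw [norm_zero, one_mul]
    exact mul_nonneg (mul_nonneg (jb_rpow_pos _ _).le (pow_nonneg (normK2_nonneg _ _ _ _ _) _))
      (normK2_nonneg _ _ _ _ _)

lemma IsNonhomSymbol.sum {I : Set ℝ} {m : ℝ} {K N : ℕ} {r s₀ : ℝ} (hr : 0 < r) {κ : Type*}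
    (s : Finset κ) {a : κ → Fn2 → ℝ → ℝ → ℂ}
    (h : ∀ i ∈ s, IsNonhomSymbol I m K N r s₀ (a i)) :
    IsNonhomSymbol I m K N r s₀ fun U x ξ => ∑ i ∈ s, a i U x ξ := by
  classical
  induction s using Finset.induction_on with
  | empty => simpa using IsNonhomSymbol.zero hr
  | insert b s hb ih =>
    simp_rw [Finset.sum_insert hb]
    exact (h b (by simp)).add (ih fun i hi => h i (by simp [hi]))

/-! ### Smooth functions -/

lemma memHs_cInf (u : CInf) (s : ℝ) : MemHs s (u : Fn) := by
  obtain ⟨k, hk⟩ := exists_nat_ge (s + 1)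
  obtain ⟨C, hC⟩ := u.2 k
  have hC0 : 0 ≤ C := (mul_nonneg (norm_nonneg _) (pow_nonneg (jb_nonneg _) _)).trans (hC 0)
  refine Summable.of_nonneg_of_le (fun _ => mul_nonneg (sq_nonneg _) (jb_rpow_pos _ _).le)
    (fun j => ?_) (summable_jb_neg_two.mul_left (C ^ 2))
  have h1 : jb j ^ (2 * s) ≤ (jb j ^ k) ^ 2 * jb j ^ (-2 : ℝ) := by
    rw [show (jb j ^ k) ^ 2 = (jb j ^ (k : ℝ)) ^ 2 by rw [Real.rpow_natCast], ← rpow_two_mul,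
      ← Real.rpow_add (jb_pos _)]
    exact jb_rpow_le _ (by linarith)
  calc ‖(u : Fn) j‖ ^ 2 * jb j ^ (2 * s)
      ≤ ‖(u : Fn) j‖ ^ 2 * ((jb j ^ k) ^ 2 * jb j ^ (-2 : ℝ)) :=
        mul_le_mul_of_nonneg_left h1 (sq_nonneg _)
    _ = (‖(u : Fn) j‖ * jb j ^ k) ^ 2 * jb j ^ (-2 : ℝ) := by ring
    _ ≤ C ^ 2 * jb j ^ (-2 : ℝ) := by
        refine mul_le_mul_of_nonneg_right ?_ (jb_rpow_pos _ _).le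
        exact pow_le_pow_left₀ (mul_nonneg (norm_nonneg _) (pow_nonneg (jb_nonneg _) _)) (hC j) 2

lemma memW_cInf (u : CInf) (σ : ℝ) : MemW (wt1 σ) (u : Fn) := ((memHs_cInf u (σ + 1)).memW le_rfl).1

lemma memW_cInf2 (U : CInf2) (σ : ℝ) : MemW (wt2 σ) (un U.toFn2) :=
  un_memW_iff.2 fun i => memW_cInf (U i) σ

lemma mem_CInf_of_memW {u : Fn} (h : ∀ k : ℕ, MemW (wt1 k) u) : u ∈ CInf := by
  intro k
  refine ⟨nW (wt1 k) u, fun j => ?_⟩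
  have h1 := Summable.le_tsum (h k) j fun _ _ => mul_nonneg (jb_rpow_pos _ _).le (norm_nonneg _)
  rwa [wt1, Real.rpow_natCast, mul_comm] at h1

/-! ### Spectral pieces -/

/-- The moduli of the frequencies. -/
def absJ {p : ℕ} (J : Fin p → Idx) : Fin p → ℕ := fun i => (J i).2.natAbs

lemma finite_absJ {p : ℕ} (n : Fin p → ℕ) : {J : Fin p → Idx | absJ J = n}.Finite := by
  have h : ∀ i, {l : Idx | l.2.natAbs = n i}.Finite := fun i => by
    refine ((Set.finite_univ (α := Fin 2)).prod
      (Set.finite_Icc (-(n i : ℤ)) (n i))).subset fun l hl => ?_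
    simp only [Set.mem_ofPred_eq] at hl
    simp only [Set.mem_prod, Set.mem_univ, true_and, Set.mem_Icc]
    omega
  refine (Set.Finite.pi' h).subset fun J hJ i => ?_
  exact congrFun hJ i

/-- The projection on the frequencies of modulus `n`. -/
def projU (n : ℕ) (f : Idx → ℂ) : Idx → ℂ := fun l => if l.2.natAbs = n then f l else 0

lemma un_proj2 (n : ℕ) (U : Fn2) : un (proj2 n U).toFn2 = projU n (un U) := rfl

lemma un_single_proj (n : ℕ) (e : Fin 2) (u : Fn) :
    un (Pi.single e (proj n u : Fn)) = projU n (un (Pi.single e u)) := by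
  funext J
  by_cases h : J.1 = e
  · simp [un, projU, proj, ← h]
  · simp [un, projU, h]

/-- A spectral piece of a tensor is its restriction to the multi-indices with prescribed moduli, so
expansions into spectral pieces are regroupings of one absolutely convergent sum. -/
lemma tens_projU {p : ℕ} (n : Fin p → ℕ) (v : Fin p → Idx → ℂ) (J : Fin p → Idx) :
    tens (fun i => projU (n i) (v i)) J = if absJ J = n then tens v J else 0 := by
  split_ifs with h
  · refine Finset.prod_congr rfl fun i _ => ?_
    have hi : (J i).2.natAbs = n i := congrFun h i
    simp [projU, hi]
  · obtain ⟨i, hi⟩ := Function.ne_iff.1 h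
    refine Finset.prod_eq_zero (Finset.mem_univ i) ?_
    have hi' : (J i).2.natAbs ≠ n i := hi
    simp [projU, hi']

lemma hasSum_evalFn_mulT {p : ℕ} {𝒦 : (Fin p → Idx) → ℂ} {v : Fin p → Idx → ℂ}
    (h : Summable fun J => ‖𝒦 J * tens v J‖) (x : ℝ) :
    HasSum (fun J => nrm * (𝒦 J * tens v J * Complex.exp (Complex.I * frq J * x)))
      (evalFn (mulT 𝒦 v) x) := by
  rw [evalFn_eq]
  refine HasSum.mul_left _ ?_
  have hs : Summable fun J => 𝒦 J * tens v J * Complex.exp (Complex.I * frq J * x) :=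
    Summable.of_norm (by simpa [norm_mul, norm_exp_I_int_mul] using h)
  have h1 := hasSum_fiber frq hs
  have h2 : ∀ k : ℤ, (∑' J, if frq J = k then
      𝒦 J * tens v J * Complex.exp (Complex.I * frq J * x) else 0) =
      mulT 𝒦 v k * Complex.exp (Complex.I * k * x) := by
    intro k
    rw [mulT, ← tsum_mul_right]
    refine tsum_congr fun J => ?_
    split_ifs with hk
    · rw [hk]
    · simp
  simp_rw [h2] at h1
  rw [h1.tsum_eq]
  exact hs.hasSum

lemma summable_projU {p : ℕ} {𝒦 : (Fin p → Idx) → ℂ} (v : Fin p → Idx → ℂ) (n : Fin p → ℕ) :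
    Summable fun J => ‖𝒦 J * tens (fun i => projU (n i) (v i)) J‖ := by
  refine summable_of_ne_finset_zero (s := (finite_absJ n).toFinset) fun J hJ => ?_
  rw [tens_projU, if_neg (by simpa using hJ), mul_zero, norm_zero]

/-- A symbol is the sum of its spectral pieces; the pieces may be weighted by a function of the
moduli of the frequencies. -/
lemma hasSum_polySym_projU {q : ℕ} (𝒦 : Fin 3 → (Fin q → Idx) → ℂ) (φ : (Fin q → ℕ) → ℂ)
    {v : Fin q → Idx → ℂ} (h : ∀ l, Summable fun J => ‖φ (absJ J) * 𝒦 l J * tens v J‖) (x ξ : ℝ) :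
    HasSum (fun n => φ n * polySym 𝒦 (fun i => projU (n i) (v i)) x ξ)
      (polySym (fun l J => φ (absJ J) * 𝒦 l J) v x ξ) := by
  have h1 : HasSum (fun J => ∑ l : Fin 3, nrm * (φ (absJ J) * 𝒦 l J * tens v J *
      Complex.exp (Complex.I * frq J * x)) * xiPow l ξ)
      (polySym (fun l J => φ (absJ J) * 𝒦 l J) v x ξ) :=
    hasSum_sum fun l _ => (hasSum_evalFn_mulT (h l) x).mul_right _
  have h2 := hasSum_fiber absJ h1.summable
  rw [h1.tsum_eq] at h2
  convert h2 using 2 with n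
  have h3 : HasSum (fun J => ∑ l : Fin 3, nrm * (𝒦 l J * tens (fun i => projU (n i) (v i)) J *
      Complex.exp (Complex.I * frq J * x)) * xiPow l ξ)
      (polySym 𝒦 (fun i => projU (n i) (v i)) x ξ) :=
    hasSum_sum fun l _ => (hasSum_evalFn_mulT (summable_projU v n) x).mul_right _
  rw [← (h3.mul_left (φ n)).tsum_eq]
  refine tsum_congr fun J => ?_
  rw [tens_projU]
  split_ifs with hn
  · subst hn
    rw [Finset.mul_sum]
    exact Finset.sum_congr rfl fun l _ => by ring
  · simp

lemma mulT_support {p : ℕ} {𝒦 : (Fin p → Idx) → ℂ} {v : Fin p → Idx → ℂ} {k : ℤ}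
    (h : mulT 𝒦 v k ≠ 0) : ∃ J, frq J = k ∧ tens v J ≠ 0 := by
  by_contra! hc
  apply h
  refine (tsum_congr fun J => ?_).trans tsum_zero
  split_ifs with hk
  · rw [hc J hk, mul_zero]
  · rfl

lemma exists_unit_mul_natAbs (j : ℤ) : ∃ ε : ℤˣ, (ε : ℤ) * (j.natAbs : ℤ) = j := by
  rcases Int.natAbs_eq j with h | h
  · exact ⟨1, by simp only [Units.val_one, one_mul]; exact h.symm⟩
  · exact ⟨-1, by simp only [Units.val_neg, Units.val_one, neg_one_mul]; exact h.symm⟩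

/-- The required relation is −(total frequency) + Σ j_i = 0, written with moduli and signs. -/
lemma signRelation_of_frq {p : ℕ} (J : Fin p → Idx) {n₀ : ℕ} (h : (frq J).natAbs = n₀) :
    SignRelation (Fin.cons (α := fun _ => ℕ) n₀ (absJ J)) := by
  choose ε hε using fun i => exists_unit_mul_natAbs (J i).2
  obtain ⟨ε₀, hε₀⟩ := exists_unit_mul_natAbs (frq J)
  refine ⟨Fin.cons (-ε₀) ε, ?_⟩
  rw [Fin.sum_univ_succ]
  simp only [Fin.cons_zero, Fin.cons_succ, Units.val_neg, absJ, hε]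
  rw [← h, neg_mul, hε₀, frq]
  simp

lemma mulT_projU_spectral {p : ℕ} {𝒦 : (Fin p → Idx) → ℂ} {v : Fin p → Idx → ℂ} {n : Fin p → ℕ}
    {n₀ : ℕ} (h : proj n₀ (mulT 𝒦 fun i => projU (n i) (v i)) ≠ 0) :
    SignRelation (Fin.cons (α := fun _ => ℕ) n₀ n) := by
  have h1 : ∃ k : ℤ, k.natAbs = n₀ ∧ mulT 𝒦 (fun i => projU (n i) (v i)) k ≠ 0 := by
    by_contra! hc
    apply h
    apply Subtype.ext
    funext k
    by_cases hk : k.natAbs = n₀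
    · simp [proj, hk, hc k hk]
    · simp [proj, hk]
  obtain ⟨k, hk, hne⟩ := h1
  obtain ⟨J, hJ, hJ2⟩ := mulT_support hne
  rw [tens_projU] at hJ2
  have hn : absJ J = n := by
    by_contra hc; exact hJ2 (if_neg hc)
  rw [← hn]
  exact signRelation_of_frq J (by rw [hJ, hk])

lemma norm_le_hsNorm_zero {u : Fn} (h : MemHs 0 u) (j : ℤ) : ‖u j‖ ≤ hsNorm 0 u := by
  apply Real.le_sqrt_of_sq_le
  have h1 := Summable.le_tsum h j fun _ _ => mul_nonneg (sq_nonneg _) (jb_rpow_pos _ _).le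
  simpa using h1

/-- At most two frequencies, n and −n, are present. -/
lemma nW_proj_le (n : ℕ) (u : Fn) : nW (wt1 0) (proj n u : Fn) ≤ 2 * l2 (proj n u) := by
  rw [nW_zero, tsum_eq_sum (s := {(n : ℤ), -(n : ℤ)})]
  · refine (Finset.sum_le_card_nsmul _ _ (l2 (proj n u))
      fun j _ => norm_le_hsNorm_zero (memHs_cInf (proj n u) 0) j).trans ?_
    rw [nsmul_eq_mul]
    refine mul_le_mul_of_nonneg_right ?_ (hsNorm_nonneg _ _)
    exact_mod_cast Finset.card_le_two
  · intro j hj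
    have : j.natAbs ≠ n := by
      simp only [Finset.mem_insert, Finset.mem_singleton, not_or] at hj
      omega
    simp [proj, this]

lemma nW_projU_un_le (n : ℕ) (U : Fn2) :
    nW (wt2 0) (projU n (un U)) ≤ 4 * l2v (proj2 n U) := by
  rw [← un_proj2, nW_un (memW_cInf2 _ 0), Fin.sum_univ_two]
  have h : ∀ i, nW (wt1 0) ((proj2 n U).toFn2 i) ≤ 2 * l2v (proj2 n U) := fun i =>
    (nW_proj_le n (U i)).trans (mul_le_mul_of_nonneg_left
      (hsNorm_le_hsNorm2 0 (proj2 n U).toFn2 i) zero_le_two)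
  linarith [h 0, h 1]

/-- A crude bound of a multilinear multiplier by the size of the kernel on the support of the
arguments. -/
lemma nW_mulT_le_of_support {p : ℕ} {𝒦 : (Fin p → Idx) → ℂ} {v : Fin p → Idx → ℂ} {θ B : ℝ}
    (hθ : 0 ≤ θ) (hv : ∀ i, MemW (wt2 0) (v i))
    (hB : ∀ J, tens v J ≠ 0 → jb (frq J) ^ θ * ‖𝒦 J‖ ≤ B) :
    MemW (wt1 θ) (mulT 𝒦 v) ∧ nW (wt1 θ) (mulT 𝒦 v) ≤ B * ∏ i, nW (wt2 0) (v i) := by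
  have h1 : HasSum (fun J => B * ‖tens v J‖) (B * ∏ i, nW (wt2 0) (v i)) := by
    refine HasSum.mul_left _ ?_
    simp_rw [norm_tens]
    refine hasSum_tens_of_nonneg _ _ (fun _ _ => norm_nonneg _) fun i => ?_
    have := (hv i).hasSum
    simpa [nW, wt2] using this
  have hle : ∀ J, jb (frq J) ^ θ * ‖𝒦 J * tens v J‖ ≤ B * ‖tens v J‖ := by
    intro J
    by_cases h0 : tens v J = 0
    · simp [h0]
    · rw [norm_mul, ← mul_assoc]
      exact mul_le_mul_of_nonneg_right (hB J h0) (norm_nonneg _)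
  have hs : Summable fun J => jb (frq J) ^ θ * ‖𝒦 J * tens v J‖ :=
    h1.summable.of_nonneg_of_le (fun J => mul_nonneg (jb_rpow_pos _ _).le (norm_nonneg _)) hle
  have h2 := mulT_memW_of_summable hθ hs
  exact ⟨h2.1, h2.2.trans ((Summable.tsum_le_tsum hle hs h1.summable).trans_eq h1.tsum_eq)⟩

/-- Permuting the arguments amounts to permuting the kernel, because the total frequency is
symmetric. -/
lemma mulT_comp_perm {p : ℕ} (𝒦 : (Fin p → Idx) → ℂ) (v : Fin p → Idx → ℂ)
    (e : Equiv.Perm (Fin p)) : mulT 𝒦 (v ∘ e) = mulT (fun J => 𝒦 (J ∘ e)) v := by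
  funext k
  unfold mulT
  rw [← (Equiv.arrowCongr e.symm (Equiv.refl Idx)).tsum_eq]
  refine tsum_congr fun J => ?_
  have h : (Equiv.arrowCongr e.symm (Equiv.refl Idx)) J = J ∘ e := by
    funext i; simp [Equiv.arrowCongr]
  rw [h, frq_comp_perm, tens_comp_perm]

/-! ### Homogeneous symbols -/

lemma KerBdd.summable_norm {p : ℕ} (hp : 0 < p) {𝒦 : (Fin p → Idx) → ℂ} {μ C : ℝ}
    (h : KerBdd 𝒦 μ C) {v : Fin p → Idx → ℂ} (hv : ∀ i, MemW (wt2 μ) (v i)) :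
    Summable fun J => ‖𝒦 J * tens v J‖ :=
  (h.est hp (θ := 0) le_rfl).summable_norm (by simpa using hv)

lemma KerBdd.memW {p : ℕ} (hp : 0 < p) {𝒦 : (Fin p → Idx) → ℂ} {μ C θ : ℝ} (hθ : 0 ≤ θ)
    (h : KerBdd 𝒦 μ C) {v : Fin p → Idx → ℂ} (hv : ∀ i, MemW (wt2 (θ + μ)) (v i)) :
    MemW (wt1 θ) (mulT 𝒦 v) :=
  (h.est hp hθ).memW hv

/-- The multilinear map defined by a family of kernels of polynomial growth. -/
def polyHom (q : ℕ) (𝒦 : Fin 3 → (Fin q → Idx) → ℂ) : HomSym q := by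
  classical
  -- The default value 0 concerns q = 0 and kernels without polynomial growth. The terms of the
  -- expansions have q ≥ 1 and kernels of polynomial growth.
  exact if h : 0 < q ∧ ∃ μ C, ∀ l, KerBdd (𝒦 l) μ C then
    { toFun := fun U => polySym 𝒦 fun i => un (U i).toFn2
      map_update_add' := by
        intro _ U i x y
        obtain ⟨hq, μ, C, hb⟩ := h
        have hu : ∀ z : CInf2, (fun j => un (CInf2.toFn2 (Function.update U i z j))) =
            Function.update (fun j => un (U j).toFn2) i (un z.toFn2) := by
          intro z; funext j; rw [Function.apply_update (fun _ (z : CInf2) => un z.toFn2)]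
        have hm : ∀ (z : CInf2) (σ : ℝ) (j : Fin q), MemW (wt2 σ)
            (Function.update (fun j => un (U j).toFn2) i (un z.toFn2) j) := by
          intro z σ j; rw [← hu]; exact memW_cInf2 _ _
        funext X ξ
        change polySym 𝒦 _ X ξ = polySym 𝒦 _ X ξ + polySym 𝒦 _ X ξ
        rw [hu, hu, hu]
        simp only [polySym]
        rw [← Finset.sum_add_distrib]
        refine Finset.sum_congr rfl fun l _ => ?_
        have e1 : un (x + y).toFn2 = un x.toFn2 + un y.toFn2 := rfl
        rw [e1, mulT_update_add _ _ _ _ ((hb l).summable_norm hq (hm x μ))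
          ((hb l).summable_norm hq (hm y μ)), evalFn_add ((hb l).memW hq le_rfl (hm x _))
          ((hb l).memW hq le_rfl (hm y _)), add_mul]
      map_update_smul' := by
        intro _ U i c x
        have hu : ∀ z : CInf2, (fun j => un (CInf2.toFn2 (Function.update U i z j))) =
            Function.update (fun j => un (U j).toFn2) i (un z.toFn2) := by
          intro z; funext j; rw [Function.apply_update (fun _ (z : CInf2) => un z.toFn2)]
        funext X ξ
        change polySym 𝒦 _ X ξ = c * polySym 𝒦 _ X ξ
        rw [hu, hu]
        simp only [polySym]
        rw [Finset.mul_sum]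
        refine Finset.sum_congr rfl fun l _ => ?_
        have e1 : un (c • x).toFn2 = c • un x.toFn2 := rfl
        rw [e1, mulT_update_smul, evalFn_smul, mul_assoc] }
  else 0

lemma polyHom_apply {q : ℕ} (hq : 0 < q) {𝒦 : Fin 3 → (Fin q → Idx) → ℂ} {μ C : ℝ}
    (h : ∀ l, KerBdd (𝒦 l) μ C) (U : Fin q → CInf2) :
    polyHom q 𝒦 U = polySym 𝒦 fun i => un (U i).toFn2 := by
  rw [polyHom, dif_pos ⟨hq, μ, C, h⟩]
  rfl

lemma polyHom_projTuple {q : ℕ} (hq : 0 < q) {𝒦 : Fin 3 → (Fin q → Idx) → ℂ} {μ C : ℝ}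
    (h : ∀ l, KerBdd (𝒦 l) μ C) (n : Fin q → ℕ) (U : Fin q → Fn2) :
    polyHom q 𝒦 (projTuple n U) = polySym 𝒦 fun i => projU (n i) (un (U i)) := by
  rw [polyHom_apply hq h]
  rfl

lemma iteratedDeriv_polySym {q : ℕ} (hq : 0 < q) {𝒦 : Fin 3 → (Fin q → Idx) → ℂ} {μ C : ℝ}
    (h : ∀ l, KerBdd (𝒦 l) μ C) {v : Fin q → Idx → ℂ} (hv : ∀ σ i, MemW (wt2 σ) (v i))
    (α β : ℕ) (x ξ : ℝ) :
    iteratedDeriv α (fun x' => iteratedDeriv β (fun ξ' => polySym 𝒦 v x' ξ') ξ) x =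
      ∑ l, evalFn (dx^[α] (mulT (𝒦 l) v)) x * iteratedDeriv β (xiPow l) ξ := by
  have hm : ∀ l, ∀ α : ℕ, MemW (wt1 α) (mulT (𝒦 l) v) := fun l α =>
    (h l).memW hq (Nat.cast_nonneg α) fun i => hv _ i
  have h1 : ∀ x', iteratedDeriv β (fun ξ' => polySym 𝒦 v x' ξ') ξ =
      ∑ l, evalFn (mulT (𝒦 l) v) x' * iteratedDeriv β (xiPow l) ξ := by
    intro x'
    unfold polySym
    rw [iteratedDeriv_fun_sum (f := fun (l : Fin 3) ξ' => evalFn (mulT (𝒦 l) v) x' * xiPow l ξ')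
      fun l _ => ((contDiff_const.mul (contDiff_xiPow l)).of_le (by exact_mod_cast le_top)).contDiffAt]
    exact Finset.sum_congr rfl fun l _ => iteratedDeriv_const_mul_field _ _
  simp_rw [h1]
  rw [iteratedDeriv_fun_sum (f := fun (l : Fin 3) x' =>
    evalFn (mulT (𝒦 l) v) x' * iteratedDeriv β (xiPow l) ξ) fun l _ => (((contDiff_evalFn (hm l)).mul contDiff_const).of_le
    (by exact_mod_cast le_top)).contDiffAt]
  refine Finset.sum_congr rfl fun l _ => ?_
  rw [iteratedDeriv_mul_const_field, iteratedDeriv_evalFn (hm l α)]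

lemma le_sqrt_one_add_sum_sq {q : ℕ} (n : Fin q → ℕ) (i : Fin q) :
    jb (n i) ≤ Real.sqrt (1 + ∑ i, (n i : ℝ) ^ 2) := by
  unfold jb
  gcongr
  exact Finset.single_le_sum (f := fun i => (n i : ℝ) ^ 2) (fun _ _ => sq_nonneg _)
    (Finset.mem_univ i)

/-- On a spectral piece every frequency is at most ⟨n⟩, so the kernel and the x-derivatives cost
only powers of ⟨n⟩. The dependence on ξ is that of a polynomial. -/
lemma isHomSymbol_polyHom {q : ℕ} (hq : 0 < q) {m : ℝ} {𝒦 : Fin 3 → (Fin q → Idx) → ℂ} {μ C : ℝ}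
    (h : ∀ l, KerBdd (𝒦 l) μ C) (hm : ∀ l : Fin 3, 𝒦 l = 0 ∨ ((l : ℕ) : ℝ) ≤ m)
    (hsymm : ∀ l J (e : Equiv.Perm (Fin q)), 𝒦 l (J ∘ e) = 𝒦 l J) :
    IsHomSymbol m q (polyHom q 𝒦) where
  symm e U := by
    rw [polyHom_apply hq h, polyHom_apply hq h]
    funext x ξ
    simp only [polySym]
    refine Finset.sum_congr rfl fun l _ => ?_
    have h1 := mulT_comp_perm (𝒦 l) (fun i => un (U i).toFn2) e
    rw [show (fun J => 𝒦 l (J ∘ e)) = 𝒦 l from funext fun J => hsymm l J e] at h1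
    rw [← h1]
    rfl
  periodic U x ξ := by
    rw [polyHom_apply hq h]
    simp only [polySym, evalFn_periodic]
  smooth U := by
    rw [polyHom_apply hq h]
    simp only [polySym]
    refine ContDiff.sum fun l _ => ContDiff.mul ?_ ?_
    · exact (contDiff_evalFn fun α => (h l).memW hq (Nat.cast_nonneg α)
        fun i => memW_cInf2 _ _).comp contDiff_fst
    · exact (contDiff_xiPow l).comp contDiff_snd
  bound := by
    have hμ := (h 0).exp_nonneg
    have hC0 := (h 0).const_nonneg
    -- Each of the q slots contributes at most ⟨n⟩^μ; the summand 1 makes the exponent strictly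
    -- positive.
    refine ⟨q * μ + 1, by positivity, fun α β => ?_⟩
    -- Three powers of ξ, a descending factorial at most 2, and a factor 4 per argument (two
    -- components, two frequencies each) for comparing ℓ¹ with L².
    refine ⟨6 * (C * (q : ℝ) ^ (α : ℝ) * 4 ^ q) + 1, by positivity, fun U n x ξ => ?_⟩
    rw [polyHom_projTuple hq h]
    set v : Fin q → Idx → ℂ := fun i => projU (n i) (un (U i).toFn2) with hv
    have hvm : ∀ σ i, MemW (wt2 σ) (v i) := fun σ i => memW_cInf2 (proj2 (n i) (U i).toFn2) σ
    rw [iteratedDeriv_polySym hq h hvm]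
    set Y := Real.sqrt (1 + ∑ i, (n i : ℝ) ^ 2) with hY
    set Q := ∏ i, l2v (proj2 (n i) (U i).toFn2) with hQ
    have hQ0 : 0 ≤ Q := Finset.prod_nonneg fun i _ => hsNorm2_nonneg _ _
    have hYi : ∀ i, jb (n i) ≤ Y := le_sqrt_one_add_sum_sq n
    have hY1 : 1 ≤ Y := (one_le_jb _).trans (hYi ⟨0, hq⟩)
    have hY0 : 0 < Y := by linarith
    have hB : ∀ l, nW (wt1 α) (mulT (𝒦 l) v) ≤
        (C * (q : ℝ) ^ (α : ℝ) * Y ^ (q * μ + 1 + α)) * (4 ^ q * Q) := by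
      intro l
      have h1 := nW_mulT_le_of_support (𝒦 := 𝒦 l) (θ := α)
        (B := C * (q : ℝ) ^ (α : ℝ) * Y ^ (q * μ + 1 + α)) (Nat.cast_nonneg α) (hvm 0) ?_
      · refine h1.2.trans (mul_le_mul_of_nonneg_left ?_ (by positivity))
        refine (Finset.prod_le_prod (fun i _ => nW_nonneg _ _)
          fun i _ => nW_projU_un_le (n i) (U i).toFn2).trans_eq ?_
        rw [Finset.prod_mul_distrib]; simp [hQ]
      · intro J hJ
        rw [hv, tens_projU] at hJ
        have hn : absJ J = n := by by_contra hc; exact hJ (if_neg hc)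
        have hJi : ∀ i, jb (J i).2 ≤ Y := by
          intro i; rw [← jb_natAbs]
          have := hYi i
          rwa [← hn] at this
        have e1 : jb (frq J) ≤ q * Y := by
          obtain ⟨a, ha⟩ := exists_max_jb hq J
          exact (jb_frq_le J ha).trans (by gcongr; exact hJi a)
        have e2 : jb (frq J) ^ (α : ℝ) ≤ (q : ℝ) ^ (α : ℝ) * Y ^ (α : ℝ) := by
          rw [← Real.mul_rpow (by positivity) hY0.le]
          exact Real.rpow_le_rpow (jb_nonneg _) e1 (Nat.cast_nonneg α)
        have e3 : ∏ i, wt2 μ (J i) ≤ Y ^ (q * μ) := by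
          refine (Finset.prod_le_prod (fun _ _ => (wt2_pos _ _).le)
            fun i _ => Real.rpow_le_rpow (jb_nonneg _) (hJi i) hμ).trans_eq ?_
          rw [Finset.prod_const, Finset.card_univ, Fintype.card_fin, ← Real.rpow_natCast,
            ← Real.rpow_mul hY0.le, mul_comm]
        have e4 : Y ^ (q * μ) ≤ Y ^ (q * μ + 1) :=
          Real.rpow_le_rpow_of_exponent_le hY1 (by linarith)
        calc jb (frq J) ^ (α : ℝ) * ‖𝒦 l J‖
            ≤ ((q : ℝ) ^ (α : ℝ) * Y ^ (α : ℝ)) * (C * Y ^ (q * μ + 1)) := by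
              refine mul_le_mul e2 (((h l).bound J).trans ?_) (norm_nonneg _) (by positivity)
              exact mul_le_mul_of_nonneg_left (e3.trans e4) hC0
          _ = _ := by rw [Real.rpow_add hY0 (q * μ + 1) α]; ring
    have hl : ∀ l : Fin 3, ‖evalFn (dx^[α] (mulT (𝒦 l) v)) x * iteratedDeriv β (xiPow l) ξ‖ ≤
        2 * ((C * (q : ℝ) ^ (α : ℝ) * Y ^ (q * μ + 1 + α)) * (4 ^ q * Q)) * jb ξ ^ (m - β) := by
      intro l
      rcases hm l with h0 | hlm
      · rw [h0, mulT_zero_ker, dx_iterate_zero, evalFn_zero, zero_mul, norm_zero]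
        exact mul_nonneg (by positivity) (jb_rpow_pos _ _).le
      · rw [norm_mul]
        have hmw : MemW (wt1 α) (mulT (𝒦 l) v) := (h l).memW hq (Nat.cast_nonneg α) fun i => hvm _ i
        have h2 := (norm_evalFn_le hmw.dx_iterate.1 x).trans (hmw.dx_iterate.2.trans (hB l))
        have h3 := (norm_iteratedDeriv_xiPow_le (l : ℕ) β hlm ξ).trans
          (mul_le_mul_of_nonneg_right (descFactorial_le_two l β) (jb_rpow_pos _ _).le)
        calc _ ≤ ((C * (q : ℝ) ^ (α : ℝ) * Y ^ (q * μ + 1 + α)) * (4 ^ q * Q)) *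
              (2 * jb ξ ^ (m - β)) := mul_le_mul h2 h3 (norm_nonneg _) (by positivity)
          _ = _ := by ring
    refine (norm_sum_le _ _).trans ((Finset.sum_le_card_nsmul _ _ _ fun l _ => hl l).trans ?_)
    simp only [Finset.card_univ, Fintype.card_fin, nsmul_eq_mul]
    have hZ : 0 ≤ Y ^ (q * μ + 1 + α) * jb ξ ^ (m - β) * Q :=
      mul_nonneg (mul_nonneg (by positivity) (jb_rpow_pos _ _).le) hQ0
    push_cast
    linarith
  spectral U n n₀ ξ hne := by
    rw [polyHom_projTuple hq h] at hne
    set v : Fin q → Idx → ℂ := fun i => un (U i).toFn2 with hv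
    have hmw : ∀ l, MemW (wt1 0) (mulT (𝒦 l) fun i => projU (n i) (v i)) := fun l =>
      (h l).memW hq le_rfl fun i => memW_cInf2 (proj2 (n i) (U i).toFn2) _
    have h1 : (fun x => polySym 𝒦 (fun i => projU (n i) (v i)) x ξ) =
        evalFn (∑ l : Fin 3, xiPow l ξ • mulT (𝒦 l) fun i => projU (n i) (v i)) := by
      funext x
      rw [evalFn_sum fun l _ => MemW.smul _ _ (hmw l)]
      simp only [polySym, evalFn_smul]
      exact Finset.sum_congr rfl fun l _ => mul_comm _ _
    rw [h1, fourierFn_evalFn (memW_sum fun l _ => MemW.smul _ _ (hmw l))] at hne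
    have h2 : ∃ l, proj n₀ (mulT (𝒦 l) fun i => projU (n i) (v i)) ≠ 0 := by
      by_contra! hc
      apply hne
      apply Subtype.ext
      funext k
      by_cases hk : k.natAbs = n₀
      · have h3 : ∀ l, mulT (𝒦 l) (fun i => projU (n i) (v i)) k = 0 := by
          intro l
          have := congrFun (congrArg Subtype.val (hc l)) k
          simpa [proj, hk] using this
        simp [proj, hk, h3]
      · simp [proj, hk]
    obtain ⟨l, hl⟩ := h2
    exact mulT_projU_spectral hl
  expand U x ξ := by
    simp_rw [polyHom_projTuple hq h]
    rw [polyHom_apply hq h]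
    have h1 := hasSum_polySym_projU 𝒦 (fun _ => 1) (v := fun i => un (U i).toFn2) (fun l => ?_) x ξ
    · simpa using h1
    · simpa using (h l).summable_norm hq fun i => memW_cInf2 (U i) μ

lemma polyHom_eval {q : ℕ} (hq : 0 < q) {𝒦 : Fin 3 → (Fin q → Idx) → ℂ} {μ C : ℝ}
    (h : ∀ l, KerBdd (𝒦 l) μ C) {U : Fn2} (hU : MemW (wt2 μ) (un U)) (x ξ : ℝ) :
    (polyHom q 𝒦).eval U x ξ = polySym 𝒦 (fun _ => un U) x ξ := by
  unfold HomSym.eval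
  simp_rw [polyHom_projTuple hq h]
  have h1 := hasSum_polySym_projU 𝒦 (fun _ => 1) (v := fun _ => un U) (fun l => ?_) x ξ
  · simpa using h1.tsum_eq
  · simpa using (h l).summable_norm hq fun _ => hU

/-! ### Homogeneous smoothing operators -/

lemma hasSum_mulT_projU {p : ℕ} {𝒦 : (Fin p → Idx) → ℂ} {v : Fin p → Idx → ℂ}
    (h : Summable fun J => ‖𝒦 J * tens v J‖) (k : ℤ) :
    HasSum (fun n : Fin p → ℕ => mulT 𝒦 (fun i => projU (n i) (v i)) k) (mulT 𝒦 v k) := by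
  have h1 : HasSum _ (mulT 𝒦 v k) :=
    hasSum_fiber absJ (Summable.ite_of_norm h fun J => frq J = k).of_norm
  convert h1 using 1
  funext n
  refine tsum_congr fun J => ?_
  rw [tens_projU]
  split_ifs <;> simp

/-- The multilinear Fourier multiplier on smooth functions. -/
def mulHom {p : ℕ} (hp : 0 < p) (𝒦 : (Fin p → Idx) → ℂ) (h : ∃ μ C, KerBdd 𝒦 μ C) :
    MultilinearMap ℂ (fun _ : Fin p => CInf2) CInf where
  toFun U := ⟨mulT 𝒦 fun i => un (U i).toFn2, by
    obtain ⟨μ, C, hb⟩ := h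
    exact mem_CInf_of_memW fun k => hb.memW hp (Nat.cast_nonneg k) fun i => memW_cInf2 _ _⟩
  map_update_add' := by
    intro _ U i x y
    obtain ⟨μ, C, hb⟩ := h
    have hu : ∀ z : CInf2, (fun j => un (CInf2.toFn2 (Function.update U i z j))) =
        Function.update (fun j => un (U j).toFn2) i (un z.toFn2) := by
      intro z; funext j; rw [Function.apply_update (fun _ (z : CInf2) => un z.toFn2)]
    have hm : ∀ (z : CInf2) (σ : ℝ) (j : Fin p), MemW (wt2 σ)
        (Function.update (fun j => un (U j).toFn2) i (un z.toFn2) j) := by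
      intro z σ j; rw [← hu]; exact memW_cInf2 _ _
    apply Subtype.ext
    change mulT 𝒦 _ = mulT 𝒦 _ + mulT 𝒦 _
    rw [hu, hu, hu]
    have e1 : un (x + y).toFn2 = un x.toFn2 + un y.toFn2 := rfl
    rw [e1, mulT_update_add _ _ _ _ (hb.summable_norm hp (hm x μ)) (hb.summable_norm hp (hm y μ))]
  map_update_smul' := by
    intro _ U i c x
    have hu : ∀ z : CInf2, (fun j => un (CInf2.toFn2 (Function.update U i z j))) =
        Function.update (fun j => un (U j).toFn2) i (un z.toFn2) := by
      intro z; funext j; rw [Function.apply_update (fun _ (z : CInf2) => un z.toFn2)]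
    apply Subtype.ext
    change mulT 𝒦 _ = c • mulT 𝒦 _
    rw [hu, hu]
    have e1 : un (c • x).toFn2 = c • un x.toFn2 := rfl
    rw [e1, mulT_update_smul]

/-- The operator `(U₁, …, U_q) ↦ R(U₁, …, U_q)` acting on the component `e`. -/
def opHom (q : ℕ) (e : Fin 2) (𝒦 : (Fin (q + 1) → Idx) → ℂ) : HomOp q := by
  classical
  -- The default value 0 concerns only kernels without polynomial growth.
  exact if h : ∃ μ C, KerBdd 𝒦 μ C then
    (LinearMap.lcomp ℂ CInf (LinearMap.single ℂ (fun _ : Fin 2 => CInf) e)).compMultilinearMap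
      (mulHom (Nat.succ_pos q) 𝒦 h).curryRight
  else 0

lemma opHom_apply {q : ℕ} (e : Fin 2) {𝒦 : (Fin (q + 1) → Idx) → ℂ} {μ C : ℝ}
    (h : KerBdd 𝒦 μ C) (U : Fin q → CInf2) (u : CInf) :
    (opHom q e 𝒦 U u : Fn) = mulT 𝒦
      (Fin.snoc (α := fun _ => Idx → ℂ) (fun i => un (U i).toFn2) (un (Pi.single e (u : Fn)))) := by
  rw [opHom, dif_pos ⟨μ, C, h⟩]
  change mulT 𝒦 _ = _
  congr 1
  funext i
  refine Fin.lastCases ?_ (fun i => ?_) i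
  · simp only [Fin.snoc_last]
    funext J
    by_cases hJ : J.1 = e
    · simp [un, CInf2.toFn2, ← hJ]
    · simp [un, CInf2.toFn2, hJ]
  · simp

lemma opHom_projTuple {q : ℕ} (e : Fin 2) {𝒦 : (Fin (q + 1) → Idx) → ℂ} {μ C : ℝ}
    (h : KerBdd 𝒦 μ C) (n : Fin q → ℕ) (m : ℕ) (U : Fin q → Fn2) (u : Fn) :
    (opHom q e 𝒦 (projTuple n U) (proj m u) : Fn) = mulT 𝒦 fun i =>
      projU (Fin.snoc (α := fun _ => ℕ) n m i)
        (Fin.snoc (α := fun _ => Idx → ℂ) (fun i => un (U i)) (un (Pi.single e u)) i) := by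
  rw [opHom_apply e h]
  congr 1
  funext i
  refine Fin.lastCases ?_ (fun i => ?_) i
  · simp only [Fin.snoc_last]; exact un_single_proj m e u
  · simp only [Fin.snoc_castSucc]; rfl

/-- The extension of a permutation of `Fin q` to `Fin (q+1)` fixing the last element. -/
def extPerm {q : ℕ} (e : Equiv.Perm (Fin q)) : Equiv.Perm (Fin (q + 1)) :=
  finSuccEquivLast.trans ((Equiv.optionCongr e).trans finSuccEquivLast.symm)

@[simp] lemma extPerm_castSucc {q : ℕ} (e : Equiv.Perm (Fin q)) (i : Fin q) :
    extPerm e i.castSucc = (e i).castSucc := by simp [extPerm]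

@[simp] lemma extPerm_last {q : ℕ} (e : Equiv.Perm (Fin q)) :
    extPerm e (Fin.last q) = Fin.last q := by simp [extPerm]

lemma snoc_comp_perm {q : ℕ} {α : Type*} (v : Fin q → α) (w : α) (e : Equiv.Perm (Fin q)) :
    (Fin.snoc (v ∘ e) w : Fin (q + 1) → α) = (Fin.snoc v w : Fin (q + 1) → α) ∘ extPerm e := by
  funext i
  refine Fin.lastCases ?_ (fun i => ?_) i <;> simp

lemma le_maxOne {p : ℕ} (v : Fin p → ℝ) (i : Fin p) : v i ≤ maxOne v :=
  le_ciSup (f := v) (Set.finite_range v).bddAbove i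

lemma le_maxTwo {p : ℕ} (v : Fin p → ℝ) {i j : Fin p} (h : i ≠ j) :
    min (v i) (v j) ≤ maxTwo v :=
  le_ciSup (f := fun ij : {ij : Fin p × Fin p // ij.1 ≠ ij.2} => min (v ij.1.1) (v ij.1.2))
    (Set.finite_range _).bddAbove ⟨(i, j), h⟩

lemma l2_proj_le {G : Fn} (h : MemW (wt1 0) G) (n : ℕ) : l2 (proj n G) ≤ nW (wt1 0) G := by
  refine (memW_cInf (proj n G) 0).memHs.2.trans ?_
  refine Summable.tsum_le_tsum (fun j => ?_) (memW_cInf (proj n G) 0) h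
  refine mul_le_mul_of_nonneg_left ?_ (jb_rpow_pos _ _).le
  simp only [proj]
  split_ifs <;> simp

/-- The kernel is at most a constant times max^{(q+1)μ}, that is max^{ρ+(q+1)μ}/max^ρ. Comparability
replaces max by R·max₂ in the numerator, which is the required bound with growth exponent (q+1)μ. -/
lemma isHomSmoothing_opHom {q : ℕ} {ρ : ℝ} (hρ : 0 < ρ) (e : Fin 2)
    {𝒦 : (Fin (q + 1) → Idx) → ℂ} {μ C R : ℝ} (h : KerBdd 𝒦 μ C) (hR : 1 ≤ R)
    (hc : Comparable 𝒦 R) (hsymm : ∀ J (e : Equiv.Perm (Fin (q + 1))), 𝒦 (J ∘ e) = 𝒦 J) :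
    IsHomSmoothing ρ q (opHom q e 𝒦) where
  symm f U := by
    apply LinearMap.ext
    intro u
    apply Subtype.ext
    rw [opHom_apply e h, opHom_apply e h]
    have h1 := snoc_comp_perm (fun i => un (U i).toFn2) (un (Pi.single e (u : Fn))) f
    change mulT 𝒦 (Fin.snoc ((fun i => un (U i).toFn2) ∘ f) _) = _
    rw [h1, mulT_comp_perm]
    congr 1
    funext J
    exact hsymm J _
  bound := by
    have hμ := h.exp_nonneg
    have hC0 := h.const_nonneg
    refine ⟨(q + 1) * μ, by positivity,
      C * R ^ (ρ + (q + 1) * μ) * 4 ^ (q + 1) + 1, by positivity, fun U u n n₀ m => ?_⟩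
    rw [opHom_projTuple e h]
    set v : Fin (q + 1) → Idx → ℂ := Fin.snoc (α := fun _ => Idx → ℂ)
      (fun i => un (U i).toFn2) (un (Pi.single e (u : Fn))) with hv
    set nm : Fin (q + 1) → ℕ := Fin.snoc (α := fun _ => ℕ) n m with hnm
    set A := maxTwo fun i => jb (nm i : ℝ) with hA
    set B := maxOne fun i => jb (nm i : ℝ) with hB
    set Q := (∏ i, l2v (proj2 (n i) (U i).toFn2)) * l2 (proj m u) with hQ
    have hQ0 : 0 ≤ Q := mul_nonneg (Finset.prod_nonneg fun i _ => hsNorm2_nonneg _ _)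
      (hsNorm_nonneg _ _)
    have hB0 : 0 < B := (jb_pos _).trans_le (le_maxOne (fun i => jb (nm i : ℝ)) 0)
    have hA0 : 0 ≤ A := Real.iSup_nonneg fun _ => le_min (jb_nonneg _) (jb_nonneg _)
    have hvm : ∀ i, MemW (wt2 0) (projU (nm i) (v i)) := by
      intro i
      refine Fin.lastCases ?_ (fun i => ?_) i
      · simp only [hnm, hv, Fin.snoc_last]
        rw [← un_single_proj]
        exact un_single_memW_iff.2 (memW_cInf _ 0)
      · simp only [hnm, hv, Fin.snoc_castSucc]
        rw [← un_proj2]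
        exact memW_cInf2 _ 0
    have hbd : ∀ J, tens (fun i => projU (nm i) (v i)) J ≠ 0 →
        jb (frq J) ^ (0 : ℝ) * ‖𝒦 J‖ ≤ C * R ^ (ρ + (q + 1) * μ) * (A ^ (ρ + (q + 1) * μ) / B ^ ρ) := by
      intro J hJ
      rw [Real.rpow_zero, one_mul]
      by_cases h0 : 𝒦 J = 0
      · rw [h0, norm_zero]; positivity
      rw [tens_projU] at hJ
      have hn : absJ J = nm := by by_contra hcc; exact hJ (if_neg hcc)
      have hval : ∀ i, jb (nm i : ℝ) = jb (J i).2 := fun i => by rw [← hn]; exact jb_natAbs _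
      obtain ⟨a, ha⟩ := exists_max_jb (Nat.succ_pos q) J
      obtain ⟨b, hba, hb⟩ := hc J h0 a
      have hBa : B ≤ jb (J a).2 := ciSup_le fun i => (hval i).trans_le (ha i)
      have hAb : jb (J b).2 ≤ A := by
        calc jb (J b).2 = min (jb (nm a : ℝ)) (jb (nm b : ℝ)) := by
              rw [hval, hval, min_eq_right (ha b)]
          _ ≤ A := le_maxTwo (fun i => jb (nm i : ℝ)) hba.symm
      have e1 : ∏ i, wt2 μ (J i) ≤ jb (J a).2 ^ ((q + 1) * μ) := by
        refine (Finset.prod_le_prod (fun _ _ => (wt2_pos _ _).le)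
          fun i _ => Real.rpow_le_rpow (jb_nonneg _) (ha i) hμ).trans_eq ?_
        rw [Finset.prod_const, Finset.card_univ, Fintype.card_fin, ← Real.rpow_natCast,
          ← Real.rpow_mul (jb_nonneg _), mul_comm]
        push_cast; rfl
      have e2 : jb (J a).2 ^ (ρ + (q + 1) * μ) ≤
          R ^ (ρ + (q + 1) * μ) * A ^ (ρ + (q + 1) * μ) := by
        rw [← Real.mul_rpow (by linarith) hA0]
        refine Real.rpow_le_rpow (jb_nonneg _) (hb.trans ?_) (by positivity)
        exact mul_le_mul_of_nonneg_left hAb (by linarith)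
      have e3 : jb (J a).2 ^ ((q + 1) * μ) * B ^ ρ ≤ jb (J a).2 ^ (ρ + (q + 1) * μ) := by
        rw [Real.rpow_add (jb_pos _), mul_comm]
        exact mul_le_mul_of_nonneg_right (Real.rpow_le_rpow hB0.le hBa hρ.le) (jb_rpow_pos _ _).le
      refine (h.bound J).trans ?_
      rw [mul_assoc]
      refine mul_le_mul_of_nonneg_left (e1.trans ?_) hC0
      rw [← mul_div_assoc, le_div_iff₀ (Real.rpow_pos_of_pos hB0 ρ)]
      exact e3.trans e2
    have h1 := nW_mulT_le_of_support le_rfl hvm hbd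
    refine (l2_proj_le h1.1 n₀).trans (h1.2.trans ?_)
    have hprod : ∏ i, nW (wt2 0) (projU (nm i) (v i)) ≤ 4 ^ (q + 1) * Q := by
      rw [Fin.prod_univ_castSucc]
      simp only [hnm, hv, Fin.snoc_castSucc, Fin.snoc_last]
      have p1 : ∏ i : Fin q, nW (wt2 0) (projU (n i) (un (U i).toFn2)) ≤
          4 ^ q * ∏ i, l2v (proj2 (n i) (U i).toFn2) := by
        refine (Finset.prod_le_prod (fun i _ => nW_nonneg _ _)
          fun i _ => nW_projU_un_le (n i) (U i).toFn2).trans_eq ?_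
        rw [Finset.prod_mul_distrib]; simp
      have p2 : nW (wt2 0) (projU m (un (Pi.single e (u : Fn)))) ≤ 4 * l2 (proj m u) := by
        rw [← un_single_proj, nW_un_single (memW_cInf _ 0)]
        have := nW_proj_le m (u : Fn)
        have h0 : 0 ≤ l2 (proj m u) := hsNorm_nonneg _ _
        linarith
      refine (mul_le_mul p1 p2 (nW_nonneg _ _) (mul_nonneg (by positivity)
        (Finset.prod_nonneg fun i _ => hsNorm2_nonneg _ _))).trans_eq ?_
      rw [hQ]; ring
    have hAB : 0 ≤ A ^ (ρ + (q + 1) * μ) / B ^ ρ := by positivity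
    calc _ ≤ C * R ^ (ρ + (q + 1) * μ) * (A ^ (ρ + (q + 1) * μ) / B ^ ρ) * (4 ^ (q + 1) * Q) :=
          mul_le_mul_of_nonneg_left hprod (by positivity)
      _ ≤ _ := by nlinarith [mul_nonneg hAB hQ0]
  spectral U u n n₀ m hne := by
    rw [opHom_projTuple e h] at hne
    exact mulT_projU_spectral hne
  expand U u k := by
    simp_rw [opHom_projTuple e h]
    rw [opHom_apply e h]
    have hs : Summable fun J => ‖𝒦 J * tens (Fin.snoc (α := fun _ => Idx → ℂ)
        (fun i => un (U i).toFn2) (un (Pi.single e (u : Fn)))) J‖ := by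
      refine h.summable_norm (Nat.succ_pos q) fun i => ?_
      refine Fin.lastCases ?_ (fun i => ?_) i
      · rw [Fin.snoc_last]; exact un_single_memW_iff.2 (memW_cInf _ _)
      · rw [Fin.snoc_castSucc]; exact memW_cInf2 _ _
    exact (snocEquiv q ℕ).hasSum_iff.2 (hasSum_mulT_projU hs k)

lemma opHom_eval {q : ℕ} (e : Fin 2) {𝒦 : (Fin (q + 1) → Idx) → ℂ} {μ C : ℝ}
    (h : KerBdd 𝒦 μ C) {U : Fn2} {u : Fn} (hU : MemW (wt2 μ) (un U)) (hu : MemW (wt1 μ) u) :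
    (opHom q e 𝒦).eval U u = mulT 𝒦 (opArgs q e U u) := by
  funext k
  unfold HomOp.eval
  simp_rw [opHom_projTuple e h]
  have hs : Summable fun J => ‖𝒦 J * tens (opArgs q e U u) J‖ := by
    refine h.summable_norm (Nat.succ_pos q) fun i => ?_
    refine Fin.lastCases ?_ (fun i => ?_) i
    · rw [opArgs_last]; exact un_single_memW_iff.2 hu
    · rw [opArgs_castSucc]; exact hU
  exact ((snocEquiv q ℕ).hasSum_iff.2 (hasSum_mulT_projU hs k)).tsum_eq

/-! ### Cut-off functions -/

/-- What is used of the cut-off functions of the quantization. -/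
structure IsCut (q : ℕ) (δ : ℝ) (φ : (Fin q → ℤ) → ℝ → ℝ) : Prop where
  bound : ∃ C : ℝ, 0 ≤ C ∧ ∀ j ξ, |φ j ξ| ≤ C
  even : ∀ j ξ, φ (-j) (-ξ) = φ j ξ
  eq_one : ∀ j ξ, ∑ i, |(j i : ℝ)| ≤ δ / 2 * jb ξ → φ j ξ = 1
  eq_zero : ∀ j ξ a, δ * jb ξ < |(j a : ℝ)| - ∑ i ∈ Finset.univ.erase a, |(j i : ℝ)| → φ j ξ = 0

/-- The cut-off function applied to the frequencies in the homogeneous case. -/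
def cutHom (χ : Cutoffs) (q : ℕ) (j : Fin q → ℤ) (ξ : ℝ) : ℝ :=
  χ.hom q (WithLp.toLp 2 fun i => ((j i).natAbs : ℝ)) ξ

/-- The cut-off function applied to the frequencies in the non-homogeneous case. -/
def cutNon (χ : Cutoffs) (q : ℕ) (j : Fin q → ℤ) (ξ : ℝ) : ℝ :=
  χ.non (WithLp.toLp 2 fun _ => ((∑ i, j i : ℤ) : ℝ)) ξ

lemma IsAdmissibleCutoff.bounded {p : ℕ} {δ : ℝ} {f : EuclideanSpace ℝ (Fin p) → ℝ → ℝ}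
    (h : IsAdmissibleCutoff p δ f) : ∃ C : ℝ, 0 ≤ C ∧ ∀ y ξ, |f y ξ| ≤ C := by
  obtain ⟨C, hC⟩ := h.bound 0
  have h1 : ∀ y ξ, |f y ξ| ≤ C := fun y ξ => by
    have := hC y ξ
    rw [norm_iteratedFDeriv_zero] at this
    simpa using this
  exact ⟨C, (abs_nonneg _).trans (h1 0 0), h1⟩

/-- The Euclidean norm of the frequencies, like the modulus of their sum in `isCut_cutNon`, lies
between |j_a| − Σ_{i≠a}|j_i| and Σ|j_i|. These two bounds are all that the proof needs about the
region where the cut-off is 1 or 0, so both quantizations are treated together. -/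
lemma isCut_cutHom {χ : Cutoffs} {δ : ℝ} (h : χ.Admissible δ) {q : ℕ} (hq : 1 ≤ q) :
    IsCut q δ (cutHom χ q) where
  bound := by
    obtain ⟨C, h0, hC⟩ := (h.1 q hq).bounded
    exact ⟨C, h0, fun j ξ => hC _ _⟩
  even j ξ := by
    unfold cutHom
    rw [(h.1 q hq).even_right]
    simp
  eq_one j ξ hj := by
    refine (h.1 q hq).eq_one _ _ (le_trans ?_ hj)
    rw [EuclideanSpace.norm_eq]
    refine Real.sqrt_le_iff.2 ⟨Finset.sum_nonneg fun _ _ => abs_nonneg _, ?_⟩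
    simp only [Nat.cast_natAbs, Int.cast_abs, Real.norm_eq_abs, abs_abs]
    exact Finset.sum_sq_le_sq_sum_of_nonneg fun _ _ => abs_nonneg _
  eq_zero j ξ a hj := by
    refine (h.1 q hq).support _ _ (lt_of_lt_of_le hj ?_)
    have h1 := PiLp.norm_apply_le
      (WithLp.toLp 2 fun i => ((j i).natAbs : ℝ) : EuclideanSpace ℝ (Fin q)) a
    simp only [Nat.cast_natAbs, Int.cast_abs, Real.norm_eq_abs, abs_abs] at h1 ⊢
    have h2 : 0 ≤ ∑ i ∈ Finset.univ.erase a, |(j i : ℝ)| :=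
      Finset.sum_nonneg fun _ _ => abs_nonneg _
    linarith

lemma norm_toLp_one (x : ℝ) :
    ‖(WithLp.toLp 2 fun _ => x : EuclideanSpace ℝ (Fin 1))‖ = |x| := by
  rw [EuclideanSpace.norm_eq]
  simp [Real.sqrt_sq_eq_abs]

lemma isCut_cutNon {χ : Cutoffs} {δ : ℝ} (h : χ.Admissible δ) (q : ℕ) :
    IsCut q δ (cutNon χ q) where
  bound := by
    obtain ⟨C, h0, hC⟩ := h.2.bounded
    exact ⟨C, h0, fun j ξ => hC _ _⟩
  even j ξ := by
    unfold cutNon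
    rw [h.2.even_right]
    refine h.2.even_left _ _ 0 (by simp) (fun i hi => absurd (Subsingleton.elim i 0) hi) ξ
  eq_one j ξ hj := by
    refine h.2.eq_one _ _ (le_trans ?_ hj)
    rw [norm_toLp_one]
    push_cast
    exact Finset.abs_sum_le_sum_abs _ _
  eq_zero j ξ a hj := by
    refine h.2.support _ _ (lt_of_lt_of_le hj ?_)
    rw [norm_toLp_one]
    push_cast
    rw [← Finset.add_sum_erase _ _ (Finset.mem_univ a)]
    have h1 := Finset.abs_sum_le_sum_abs (fun i => (j i : ℝ)) (Finset.univ.erase a)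
    have h2 := abs_sub_abs_le_abs_sub (j a : ℝ) (-∑ i ∈ Finset.univ.erase a, (j i : ℝ))
    rw [abs_neg, sub_neg_eq_add] at h2
    linarith

/-! ### The symmetrized weight of the paradifferential part -/

/-- The frequency variable `ξ = j_{q+1} + (j₁ + ⋯ + j_q)/2` of the Weyl quantization. -/
def weylXi {q : ℕ} (J : Fin (q + 1) → Idx) : ℝ :=
  (J (Fin.last q)).2 + (frq (Fin.init J : Fin q → Idx) : ℝ) / 2

/-- The first q slots hold the frequencies of the symbol, and the last slot holds that of the
function acted upon. -/
def cutWt {q : ℕ} (φ : (Fin q → ℤ) → ℝ → ℝ) (J : Fin (q + 1) → Idx) : ℝ :=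
  φ (fun i => (J i.castSucc).2) (weylXi J)

/-- The normalisation is 1/q! and not 1/(q+1)!: when one slot dominates, exactly q! permutations
contribute 1. -/
def symWt {q : ℕ} (φ : (Fin q → ℤ) → ℝ → ℝ) (J : Fin (q + 1) → Idx) : ℝ :=
  ((q.factorial : ℝ))⁻¹ * ∑ e : Equiv.Perm (Fin (q + 1)), cutWt φ (J ∘ e)

lemma symWt_comp_perm {q : ℕ} (φ : (Fin q → ℤ) → ℝ → ℝ) (J : Fin (q + 1) → Idx)
    (f : Equiv.Perm (Fin (q + 1))) : symWt φ (J ∘ f) = symWt φ J := by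
  unfold symWt
  congr 1
  exact Fintype.sum_equiv (Equiv.mulLeft f) _ _ fun e => rfl

/-- Reversal of all frequencies. -/
def negJ {p : ℕ} (J : Fin p → Idx) : Fin p → Idx := fun i => ((J i).1, -(J i).2)

/-- Exchange of the two components. -/
def flipJ {p : ℕ} (J : Fin p → Idx) : Fin p → Idx := fun i => ((J i).1 + 1, (J i).2)

lemma frq_negJ {p : ℕ} (J : Fin p → Idx) : frq (negJ J) = -frq J := by simp [frq, negJ]

lemma frq_flipJ {p : ℕ} (J : Fin p → Idx) : frq (flipJ J) = frq J := rfl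

lemma weylXi_negJ {q : ℕ} (J : Fin (q + 1) → Idx) : weylXi (negJ J) = -weylXi J := by
  have h : (Fin.init (negJ J) : Fin q → Idx) = negJ (Fin.init J : Fin q → Idx) := rfl
  unfold weylXi
  rw [h, frq_negJ]
  simp only [negJ]
  push_cast; ring

lemma symWt_negJ {q : ℕ} {δ : ℝ} {φ : (Fin q → ℤ) → ℝ → ℝ} (h : IsCut q δ φ)
    (J : Fin (q + 1) → Idx) : symWt φ (negJ J) = symWt φ J := by
  unfold symWt
  congr 1
  refine Finset.sum_congr rfl fun e _ => ?_
  have h1 : negJ J ∘ e = negJ (J ∘ e) := rfl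
  unfold cutWt
  rw [h1, weylXi_negJ]
  exact h.even (fun i => ((J ∘ e) i.castSucc).2) (weylXi (J ∘ e))

lemma symWt_flipJ {q : ℕ} (φ : (Fin q → ℤ) → ℝ → ℝ) (J : Fin (q + 1) → Idx) :
    symWt φ (flipJ J) = symWt φ J := rfl

/-- The q + 1 possible images of the last slot have equally many permutations, by composition with a
transposition, and there are (q+1)! in total. -/
lemma card_perm_apply_eq (q : ℕ) (a : Fin (q + 1)) :
    (Finset.univ.filter fun e : Equiv.Perm (Fin (q + 1)) => e (Fin.last q) = a).card =
      q.factorial := by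
  have h1 : ∀ b, (Finset.univ.filter fun e : Equiv.Perm (Fin (q + 1)) => e (Fin.last q) = b).card =
      (Finset.univ.filter fun e : Equiv.Perm (Fin (q + 1)) => e (Fin.last q) = a).card := by
    intro b
    refine Finset.card_equiv (Equiv.mulLeft (Equiv.swap a b)) fun e => ?_
    simp only [Finset.mem_filter, Finset.mem_univ, true_and, Equiv.coe_mulLeft,
      Equiv.Perm.mul_apply]
    constructor
    · rintro rfl; simp
    · intro h
      have := congrArg (Equiv.swap a b) h
      simpa using this
  have h2 := Finset.card_eq_sum_card_fiberwise
    (f := fun e : Equiv.Perm (Fin (q + 1)) => e (Fin.last q)) (s := Finset.univ)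
    (t := Finset.univ) (by intro x _; simp)
  rw [Finset.sum_congr rfl fun b _ => h1 b] at h2
  simp only [Finset.card_univ, Fintype.card_perm, Fintype.card_fin, Finset.sum_const,
    smul_eq_mul, Nat.factorial_succ] at h2
  exact (Nat.eq_of_mul_eq_mul_left (Nat.succ_pos q) h2).symm

lemma abs_weylXi_sub_le {q : ℕ} (J : Fin (q + 1) → Idx) :
    |weylXi J - (J (Fin.last q)).2| ≤ (∑ i : Fin q, |((J i.castSucc).2 : ℝ)|) / 2 := by
  have h : weylXi J - (J (Fin.last q)).2 = (∑ i : Fin q, ((J i.castSucc).2 : ℝ)) / 2 := by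
    unfold weylXi frq Fin.init
    push_cast; ring
  rw [h, abs_div, abs_two]
  exact div_le_div_of_nonneg_right (Finset.abs_sum_le_sum_abs _ _) (by norm_num)

/-- If the last frequency dominates, ξ is close to it, so ⟨ξ⟩ is at least half of its bracket and
the symbol frequencies lie where the cut-off is 1. -/
lemma cutWt_eq_one {q : ℕ} {δ : ℝ} (hδ : 0 < δ) (hδ1 : δ < 1) {φ : (Fin q → ℤ) → ℝ → ℝ}
    (h : IsCut q δ φ) (J : Fin (q + 1) → Idx)
    (hJ : ∑ i : Fin q, |((J i.castSucc).2 : ℝ)| ≤ δ / 16 * jb (J (Fin.last q)).2) :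
    cutWt φ J = 1 := by
  refine h.eq_one _ _ (hJ.trans ?_)
  have h1 := abs_weylXi_sub_le J
  have h2 := jb_add_le (weylXi J) ((J (Fin.last q)).2 - weylXi J)
  rw [add_sub_cancel, abs_sub_comm] at h2
  have h3 := jb_pos (J (Fin.last q)).2
  have h4 : δ * jb (J (Fin.last q)).2 ≤ jb (J (Fin.last q)).2 :=
    mul_le_of_le_one_left h3.le hδ1.le
  have h5 : jb (J (Fin.last q)).2 ≤ 2 * jb (weylXi J) := by linarith
  have h6 := mul_le_mul_of_nonneg_left h5 hδ.le
  have h7 := mul_pos hδ h3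
  linarith

/-- If a symbol frequency j_a dominates, ξ has size about |j_a|/2, hence δ⟨ξ⟩ < |j_a| − Σ_{i≠a}|j_i|
because δ < 1. The bracket of the last slot is at least 1, which forces ⟨j_a⟩ ≥ 16 and leaves room
for the additive constants. -/
lemma cutWt_eq_zero {q : ℕ} {δ : ℝ} (hδ : 0 < δ) (hδ1 : δ < 1) {φ : (Fin q → ℤ) → ℝ → ℝ}
    (h : IsCut q δ φ) (J : Fin (q + 1) → Idx) (a : Fin q)
    (hJ : ∑ i ∈ Finset.univ.erase a, |((J i.castSucc).2 : ℝ)| + jb (J (Fin.last q)).2 ≤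
      1 / 16 * jb (J a.castSucc).2) :
    cutWt φ J = 0 := by
  refine h.eq_zero _ _ a ?_
  have h1 := abs_weylXi_sub_le J
  rw [← Finset.add_sum_erase _ _ (Finset.mem_univ a)] at h1
  have h2 := jb_add_le (J (Fin.last q)).2 (weylXi J - (J (Fin.last q)).2)
  rw [add_sub_cancel] at h2
  have h3 := jb_le_one_add_abs (J a.castSucc).2
  have h4 := one_le_jb (J (Fin.last q)).2
  have h5 : 0 ≤ ∑ i ∈ Finset.univ.erase a, |((J i.castSucc).2 : ℝ)| :=
    Finset.sum_nonneg fun _ _ => abs_nonneg _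
  have h6 := abs_nonneg ((J a.castSucc).2 : ℝ)
  have h7 := jb_pos (weylXi J)
  have h8 : δ * jb (weylXi J) ≤ jb (weylXi J) := by nlinarith
  linarith

/-- A permutation bringing the dominant slot to the last place contributes 1, any other one leaves
it among the symbol frequencies and contributes 0. The factor q + 1 in the threshold absorbs the sum
of the other frequencies. -/
lemma symWt_eq_one {q : ℕ} (hq : 1 ≤ q) {δ : ℝ} (hδ : 0 < δ) (hδ1 : δ < 1)
    {φ : (Fin q → ℤ) → ℝ → ℝ} (h : IsCut q δ φ) (J : Fin (q + 1) → Idx) (a : Fin (q + 1))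
    (ha : ∀ b, b ≠ a → 16 * (q + 1) / δ * jb (J b).2 < jb (J a).2) : symWt φ J = 1 := by
  have hb : ∀ b, b ≠ a → (q + 1) * jb (J b).2 ≤ δ / 16 * jb (J a).2 := fun b hb => by
    have := (ha b hb).le
    rw [div_mul_eq_mul_div, div_le_iff₀ hδ] at this
    linarith
  have h1 : ∀ e : Equiv.Perm (Fin (q + 1)),
      cutWt φ (J ∘ e) = if e (Fin.last q) = a then 1 else 0 := by
    intro e
    split_ifs with he
    · refine cutWt_eq_one hδ hδ1 h _ ?_
      simp only [Function.comp, he]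
      have h2 : ∀ i : Fin q, |((J (e i.castSucc)).2 : ℝ)| ≤ δ / 16 * jb (J a).2 / (q + 1) := by
        intro i
        rw [le_div_iff₀ (by positivity), mul_comm]
        refine le_trans (mul_le_mul_of_nonneg_left (abs_le_jb _) (by positivity)) (hb _ ?_)
        rw [← he]
        exact fun hc => (Fin.castSucc_lt_last i).ne (e.injective hc)
      refine (Finset.sum_le_sum fun i _ => h2 i).trans ?_
      rw [Finset.sum_const, Finset.card_univ, Fintype.card_fin, nsmul_eq_mul, ← mul_div_assoc,
        div_le_iff₀ (by positivity), mul_comm]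
      have := jb_pos (J a).2
      exact mul_le_mul_of_nonneg_left (by linarith) (by positivity)
    · obtain ⟨c, hc⟩ := e.surjective a
      obtain ⟨i, rfl⟩ : ∃ i : Fin q, i.castSucc = c := by
        refine Fin.exists_castSucc_eq.2 ?_
        rintro rfl; exact he hc
      refine cutWt_eq_zero hδ hδ1 h _ i ?_
      simp only [Function.comp, hc]
      have h2 : ∀ b, b ≠ a → jb (J b).2 ≤ 1 / 16 * jb (J a).2 / (q + 1) := by
        intro b hba
        rw [le_div_iff₀ (by positivity), mul_comm]
        refine (hb b hba).trans ?_
        have := jb_pos (J a).2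
        nlinarith
      have h3 : ∀ k ∈ Finset.univ.erase i,
          |((J (e (Fin.castSucc k))).2 : ℝ)| ≤ 1 / 16 * jb (J a).2 / (q + 1) := by
        intro k hk
        refine (abs_le_jb _).trans (h2 _ ?_)
        rw [← hc]
        exact fun h' => (Finset.ne_of_mem_erase hk) (Fin.castSucc_injective _ (e.injective h'))
      refine (add_le_add (Finset.sum_le_sum h3) (h2 _ he)).trans ?_
      rw [Finset.sum_const, Finset.card_erase_of_mem (Finset.mem_univ _), Finset.card_univ,
        Fintype.card_fin, nsmul_eq_mul, ← mul_div_assoc, ← add_div, div_le_iff₀ (by positivity)]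
      have h4 : ((q - 1 : ℕ) : ℝ) ≤ q := by exact_mod_cast Nat.sub_le q 1
      have := jb_pos (J a).2
      nlinarith
  unfold symWt
  rw [Finset.sum_congr rfl fun e _ => h1 e, Finset.sum_boole, card_perm_apply_eq]
  exact inv_mul_cancel₀ (by exact_mod_cast q.factorial_ne_zero)

lemma abs_symWt_le {q : ℕ} {δ : ℝ} {φ : (Fin q → ℤ) → ℝ → ℝ} (h : IsCut q δ φ) :
    ∃ C : ℝ, 0 ≤ C ∧ ∀ J : Fin (q + 1) → Idx, |symWt φ J| ≤ C := by
  obtain ⟨C, h0, hC⟩ := h.bound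
  refine ⟨((q.factorial : ℝ))⁻¹ * ∑ e : Equiv.Perm (Fin (q + 1)), C, by positivity, fun J => ?_⟩
  unfold symWt
  rw [abs_mul, abs_of_nonneg (by positivity : (0 : ℝ) ≤ ((q.factorial : ℝ))⁻¹)]
  refine mul_le_mul_of_nonneg_left ?_ (by positivity)
  exact (Finset.abs_sum_le_sum_abs _ _).trans (Finset.sum_le_sum fun e _ => hC _ _)

/-! ### The remainder kernel, and symmetrization on the diagonal -/

/-- The kernel of the smoothing remainder. -/
def smoothKer {q : ℕ} (φ : (Fin q → ℤ) → ℝ → ℝ) (κ : (Fin (q + 1) → Idx) → ℂ) :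
    (Fin (q + 1) → Idx) → ℂ := fun J => ((1 - symWt φ J : ℝ) : ℂ) * κ J

/-- Contrapositive of `symWt_eq_one`: where one frequency dominates all others the remainder
vanishes. This is the source of all the smoothing. -/
lemma comparable_smoothKer {q : ℕ} (hq : 1 ≤ q) {δ : ℝ} (hδ : 0 < δ) (hδ1 : δ < 1)
    {φ : (Fin q → ℤ) → ℝ → ℝ} (h : IsCut q δ φ) (κ : (Fin (q + 1) → Idx) → ℂ) :
    Comparable (smoothKer φ κ) (16 * (q + 1) / δ) := by
  intro J hJ a
  by_contra! hc
  refine hJ ?_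
  have := symWt_eq_one hq hδ hδ1 h J a fun b hb => hc b hb
  simp [smoothKer, this]

lemma KerBdd.mul_left {p : ℕ} {κ : (Fin p → Idx) → ℂ} {μ C D : ℝ} (h : KerBdd κ μ C)
    (hD : 0 ≤ D) {g : (Fin p → Idx) → ℂ} (hg : ∀ J, ‖g J‖ ≤ D) :
    KerBdd (fun J => g J * κ J) μ (D * C) where
  exp_nonneg := h.exp_nonneg
  const_nonneg := mul_nonneg hD h.const_nonneg
  bound J := by
    rw [norm_mul, mul_assoc]
    exact mul_le_mul (hg J) (h.bound J) (norm_nonneg _) hD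

lemma KerBdd.smoothKer {q : ℕ} {δ : ℝ} {φ : (Fin q → ℤ) → ℝ → ℝ} (h : IsCut q δ φ)
    {κ : (Fin (q + 1) → Idx) → ℂ} {μ C : ℝ} (hκ : KerBdd κ μ C) :
    ∃ C', KerBdd (ParaNLS.smoothKer φ κ) μ C' := by
  obtain ⟨D, h0, hD⟩ := abs_symWt_le h
  refine ⟨_, hκ.mul_left (D := 1 + D) (by positivity) fun J => ?_⟩
  rw [Complex.norm_real, Real.norm_eq_abs]
  refine (abs_sub _ _).trans ?_
  rw [abs_one]
  linarith [hD J]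

lemma smoothKer_comp_perm {q : ℕ} (φ : (Fin q → ℤ) → ℝ → ℝ) {κ : (Fin (q + 1) → Idx) → ℂ}
    (h : ∀ J (e : Equiv.Perm (Fin (q + 1))), κ (J ∘ e) = κ J) (J : Fin (q + 1) → Idx)
    (e : Equiv.Perm (Fin (q + 1))) : smoothKer φ κ (J ∘ e) = smoothKer φ κ J := by
  simp only [smoothKer, symWt_comp_perm, h]

lemma mulT_add_ker {p : ℕ} {𝒦 𝒦' : (Fin p → Idx) → ℂ} {v : Fin p → Idx → ℂ}
    (h : Summable fun J => ‖𝒦 J * tens v J‖) (h' : Summable fun J => ‖𝒦' J * tens v J‖) :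
    mulT (fun J => 𝒦 J + 𝒦' J) v = mulT 𝒦 v + mulT 𝒦' v := by
  funext k
  rw [Pi.add_apply]
  unfold mulT
  rw [← (Summable.ite_of_norm h _).of_norm.tsum_add (Summable.ite_of_norm h' _).of_norm]
  refine tsum_congr fun J => ?_
  split_ifs <;> ring

lemma mulT_sum_ker {p : ℕ} {κ : Type*} (s : Finset κ) {𝒦 : κ → (Fin p → Idx) → ℂ}
    {v : Fin p → Idx → ℂ} (h : ∀ i ∈ s, Summable fun J => ‖𝒦 i J * tens v J‖) :
    mulT (fun J => ∑ i ∈ s, 𝒦 i J) v = ∑ i ∈ s, mulT (𝒦 i) v := by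
  funext k
  rw [Finset.sum_apply]
  unfold mulT
  rw [← Summable.tsum_finsetSum fun i hi => (Summable.ite_of_norm (h i hi) _).of_norm]
  refine tsum_congr fun J => ?_
  split_ifs
  · rw [Finset.sum_mul]
  · simp

lemma mulT_smul_ker {p : ℕ} (c : ℂ) (𝒦 : (Fin p → Idx) → ℂ) (v : Fin p → Idx → ℂ) :
    mulT (fun J => c * 𝒦 J) v = c • mulT 𝒦 v := by
  funext k
  rw [Pi.smul_apply, smul_eq_mul]
  unfold mulT
  rw [← tsum_mul_left]
  refine tsum_congr fun J => ?_
  split_ifs <;> ring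

/-- On the diagonal the paradifferential kernel may be symmetrized. -/
lemma mulT_cutWt_diag {q : ℕ} {δ : ℝ} {φ : (Fin q → ℤ) → ℝ → ℝ} (hφ : IsCut q δ φ)
    {κ : (Fin (q + 1) → Idx) → ℂ}
    (hsymm : ∀ J (e : Equiv.Perm (Fin (q + 1))), κ (J ∘ e) = κ J) {v : Idx → ℂ}
    (h : Summable fun J => ‖κ J * tens (fun _ : Fin (q + 1) => v) J‖) :
    mulT (fun J => ((q : ℂ) + 1) * (cutWt φ J : ℂ) * κ J) (fun _ => v) =
      mulT (fun J => (symWt φ J : ℂ) * κ J) (fun _ => v) := by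
  obtain ⟨C, h0, hC⟩ := hφ.bound
  have hs : ∀ e : Equiv.Perm (Fin (q + 1)),
      Summable fun J => ‖(cutWt φ (J ∘ e) : ℂ) * κ J * tens (fun _ : Fin (q + 1) => v) J‖ := by
    intro e
    refine (h.mul_left C).of_nonneg_of_le (fun _ => norm_nonneg _) fun J => ?_
    rw [mul_assoc, norm_mul, Complex.norm_real, Real.norm_eq_abs]
    exact mul_le_mul_of_nonneg_right (hC _ _) (norm_nonneg _)
  -- All arguments are equal and κ is symmetric, so permuting the slots of the cut-off does not
  -- change the value.
  have h1 : ∀ e : Equiv.Perm (Fin (q + 1)),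
      mulT (fun J => (cutWt φ (J ∘ e) : ℂ) * κ J) (fun _ => v) =
        mulT (fun J => (cutWt φ J : ℂ) * κ J) (fun _ => v) := by
    intro e
    have := mulT_comp_perm (fun J => (cutWt φ J : ℂ) * κ J) (fun _ => v) e
    simp only [hsymm] at this
    exact this.symm
  have h2 : (fun J => (symWt φ J : ℂ) * κ J) = fun J => ((q.factorial : ℂ))⁻¹ *
      ∑ e : Equiv.Perm (Fin (q + 1)), (cutWt φ (J ∘ e) : ℂ) * κ J := by
    funext J
    unfold symWt
    push_cast
    rw [← Finset.sum_mul, mul_assoc]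
  rw [h2, mulT_smul_ker, mulT_sum_ker _ fun e _ => hs e, Finset.sum_congr rfl fun e _ => h1 e,
    Finset.sum_const, Finset.card_univ, Fintype.card_perm, Fintype.card_fin, ← Nat.cast_smul_eq_nsmul ℂ,
    smul_smul]
  -- The sum has (q+1)! equal terms and the normalisation is 1/q!, which produces the factor q + 1.
  have h3 : ((q.factorial : ℂ))⁻¹ * ((q + 1).factorial : ℂ) = (q : ℂ) + 1 := by
    rw [Nat.factorial_succ]
    push_cast
    rw [mul_comm, mul_assoc, mul_inv_cancel₀ (by exact_mod_cast q.factorial_ne_zero), mul_one]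
  rw [h3, ← mulT_smul_ker]
  congr 1
  funext J
  ring

/-! ### Weyl quantization of polynomial symbols -/

/-- The arguments `(U, …, U, V)`. -/
def rowArgs (q : ℕ) (U V : Fn2) : Fin (q + 1) → Idx → ℂ :=
  Fin.snoc (α := fun _ => Idx → ℂ) (fun _ => un U) (un V)

lemma rowArgs_self (q : ℕ) (U : Fn2) : rowArgs q U U = fun _ => un U := by
  funext i
  refine Fin.lastCases ?_ (fun i => ?_) i <;> simp [rowArgs]

lemma tens_rowArgs (q : ℕ) (U V : Fn2) (J : Fin (q + 1) → Idx) :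
    tens (rowArgs q U V) J =
      tens (fun _ : Fin q => un U) (fun i => J i.castSucc) * un V (J (Fin.last q)) := by
  simp [tens, rowArgs, Fin.prod_univ_castSucc]

lemma tens_opArgs (q : ℕ) (e : Fin 2) (U V : Fn2) (J : Fin (q + 1) → Idx) :
    tens (opArgs q e U (V e)) J =
      if (J (Fin.last q)).1 = e then tens (rowArgs q U V) J else 0 := by
  rw [tens_rowArgs]
  simp only [tens, Fin.prod_univ_castSucc, opArgs_castSucc, opArgs_last]
  split_ifs with h
  · subst h; simp [un]
  · simp [un, Pi.single_eq_of_ne h]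

lemma rowArgs_memW {q : ℕ} {U V : Fn2} {σ s : ℝ} (h : σ + 1 ≤ s) (hU : MemHs2 s U)
    (hV : MemHs2 s V) (i : Fin (q + 1)) : MemW (wt2 σ) (rowArgs q U V i) := by
  refine Fin.lastCases ?_ (fun i => ?_) i
  · simpa [rowArgs] using (hV.memW h).1
  · simpa [rowArgs] using (hU.memW h).1

lemma summable_opArgs_of_rowArgs {q : ℕ} {𝒦 : (Fin (q + 1) → Idx) → ℂ} {U V : Fn2}
    (h : Summable fun J => ‖𝒦 J * tens (rowArgs q U V) J‖) (e : Fin 2) :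
    Summable fun J => ‖𝒦 J * tens (opArgs q e U (V e)) J‖ := by
  refine h.of_nonneg_of_le (fun _ => norm_nonneg _) fun J => ?_
  rw [tens_opArgs]
  split_ifs
  · rfl
  · simp only [mul_zero, norm_zero]; exact norm_nonneg _

/-- The entry in column `e` sees only the multi-indices whose last component is `e`; a row of the
matrix therefore reassembles the full multiplier on (U,…,U,V). -/
lemma sum_mulT_opArgs {q : ℕ} {𝒦 : (Fin (q + 1) → Idx) → ℂ} {U V : Fn2}
    (h : Summable fun J => ‖𝒦 J * tens (rowArgs q U V) J‖) :
    ∑ e, mulT 𝒦 (opArgs q e U (V e)) = mulT 𝒦 (rowArgs q U V) := by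
  funext k
  rw [Finset.sum_apply]
  unfold mulT
  rw [← Summable.tsum_finsetSum fun e _ =>
    (Summable.ite_of_norm (summable_opArgs_of_rowArgs h e) _).of_norm]
  refine tsum_congr fun J => ?_
  simp only [tens_opArgs]
  split_ifs
  · simp
  · simp

/-- The truncated symbol at frequency `ξ`. -/
def symKer {q : ℕ} (φ : (Fin q → ℤ) → ℝ → ℝ) (𝒦 : Fin 3 → (Fin q → Idx) → ℂ) (ξ : ℝ)
    (J : Fin q → Idx) : ℂ :=
  (φ (fun i => (J i).2) ξ : ℂ) * ∑ l, 𝒦 l J * xiPow l ξ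

/-- The kernel of the paradifferential operator. -/
def cutKer {q : ℕ} (φ : (Fin q → ℤ) → ℝ → ℝ) (κ : (Fin (q + 1) → Idx) → ℂ)
    (J : Fin (q + 1) → Idx) : ℂ := ((q : ℂ) + 1) * (cutWt φ J : ℂ) * κ J

/-- `𝒦` are the coefficients of the Weyl symbol on the component `e` associated with `κ`. -/
def IsWeylCoeff {q : ℕ} (e : Fin 2) (𝒦 : Fin 3 → (Fin q → Idx) → ℂ)
    (κ : (Fin (q + 1) → Idx) → ℂ) : Prop :=
  ∀ J : Fin (q + 1) → Idx, (J (Fin.last q)).1 = e →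
    nrm * ∑ l, 𝒦 l (fun i => J i.castSucc) * xiPow l (weylXi J) = ((q : ℂ) + 1) * κ J

/-- The multi-indices are summed first over the symbol slots, then over the last slot (e, j). Output
frequency k forces the symbol slots to have total frequency k − j, and `IsWeylCoeff` identifies the
two kernels. -/
lemma hasSum_weyl {q : ℕ} {e : Fin 2} {φ : (Fin q → ℤ) → ℝ → ℝ}
    {𝒦 : Fin 3 → (Fin q → Idx) → ℂ} {κ : (Fin (q + 1) → Idx) → ℂ} (hw : IsWeylCoeff e 𝒦 κ)
    {U V : Fn2} (hs : Summable fun J => ‖cutKer φ κ J * tens (opArgs q e U (V e)) J‖) (k : ℤ) :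
    HasSum (fun j : ℤ => nrm *
      (mulT (symKer φ 𝒦 (((k : ℝ) + j) / 2)) (fun _ => un U) (k - j) * V e j))
      (mulT (cutKer φ κ) (opArgs q e U (V e)) k) := by
  have h1 := (Summable.ite_of_norm hs fun J => frq J = k).of_norm
  have h2 := (((Equiv.prodComm _ _).trans (snocEquiv q Idx)).hasSum_iff.2 h1.hasSum)
  have h3 := h2.prod_fiberwise fun l => (h2.summable.prod_factor l).hasSum
  have hinj : Function.Injective fun j : ℤ => ((e, j) : Idx) := fun a b h => (Prod.ext_iff.1 h).2
  rw [← hinj.hasSum_iff] at h3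
  · refine Eq.subst (motive := fun f : ℤ → ℂ => HasSum f
      (mulT (cutKer φ κ) (opArgs q e U (V e)) k)) (funext fun j => Eq.symm ?_) h3
    unfold mulT
    simp only [Function.comp]
    rw [← tsum_mul_right, ← tsum_mul_left]
    refine tsum_congr fun J => ?_
    have hJ : ((Equiv.prodComm Idx (Fin q → Idx)).trans (snocEquiv q Idx)) ((e, j), J) =
      (Fin.snoc J (e, j) : Fin (q + 1) → Idx) := rfl
    rw [hJ, frq_snoc]
    by_cases hk : frq J = k - j
    · have hk' : frq J + ((e, j) : Idx).2 = k := by rw [hk]; simp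
      rw [if_pos hk, if_pos hk', tens_opArgs, tens_rowArgs]
      -- Since j + (k − j)/2 = (k + j)/2, this is exactly the point where the Weyl quantization
      -- evaluates the symbol.
      have hx : weylXi (Fin.snoc J (e, j) : Fin (q + 1) → Idx) = ((k : ℝ) + j) / 2 := by
        unfold weylXi
        rw [Fin.init_snoc, Fin.snoc_last, hk]
        push_cast; ring
      have hw' := hw (Fin.snoc J (e, j)) (by simp)
      rw [hx] at hw'
      simp only [Fin.snoc_last, Fin.snoc_castSucc] at hw' ⊢
      unfold symKer cutKer cutWt
      rw [hx]
      have hu : un V (e, j) = V e j := rfl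
      simp only [Fin.snoc_castSucc, if_true, hu]
      linear_combination (φ (fun i => (J i).2) (((k : ℝ) + j) / 2) : ℂ) *
        tens (fun _ : Fin q => un U) J * V e j * hw'
    · have hk' : ¬ frq J + ((e, j) : Idx).2 = k := fun h => hk (by rw [← h]; simp)
      rw [if_neg hk, if_neg hk']
      simp
  · rintro ⟨e', j⟩ hl
    have he : e' ≠ e := fun h => hl ⟨j, by rw [h]⟩
    refine (tsum_congr fun J => ?_).trans tsum_zero
    have hJ : ((Equiv.prodComm Idx (Fin q → Idx)).trans (snocEquiv q Idx)) ((e', j), J) =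
      (Fin.snoc J (e', j) : Fin (q + 1) → Idx) := rfl
    simp only [Function.comp, hJ, tens_opArgs, Fin.snoc_last, if_neg he]
    simp

/-- A sum over q is allowed because the non-homogeneous term is a single symbol that gathers several
degrees. -/
lemma opW_eq_sum {κ : Type*} {s : Finset κ} {c : ℝ → ℝ → ℂ} {G : κ → ℝ → Fn} {u : Fn}
    {T : κ → Fn} (hc : ∀ x ξ, c x ξ = ∑ q ∈ s, evalFn (G q ξ) x)
    (hG : ∀ q ∈ s, ∀ ξ, MemW (wt1 0) (G q ξ))
    (hT : ∀ q ∈ s, ∀ k : ℤ,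
      HasSum (fun j : ℤ => nrm * (G q (((k : ℝ) + j) / 2) (k - j) * u j)) (T q k)) :
    opW c u = ∑ q ∈ s, T q := by
  funext k
  rw [Finset.sum_apply]
  have h1 : ∀ ξ, fourierFn (fun x => c x ξ) = ∑ q ∈ s, G q ξ := by
    intro ξ
    have : (fun x => c x ξ) = evalFn (∑ q ∈ s, G q ξ) := by
      funext x
      rw [hc, evalFn_sum fun q hq => hG q hq ξ]
    rw [this, fourierFn_evalFn (memW_sum fun q hq => hG q hq ξ)]
  refine Eq.trans ?_ (hasSum_sum fun q hq => hT q hq k).tsum_eq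
  unfold opW
  rw [← tsum_mul_left]
  refine tsum_congr fun j => ?_
  rw [h1, Finset.sum_apply, Finset.sum_mul, Finset.mul_sum]
  rfl

lemma KerBdd.sum {p : ℕ} {κ : Type*} {s : Finset κ} {𝒦 : κ → (Fin p → Idx) → ℂ} {μ : ℝ}
    (hμ : 0 ≤ μ) {C : κ → ℝ} (h : ∀ i ∈ s, KerBdd (𝒦 i) μ (C i)) :
    KerBdd (fun J => ∑ i ∈ s, 𝒦 i J) μ (∑ i ∈ s, C i) where
  exp_nonneg := hμ
  const_nonneg := Finset.sum_nonneg fun i hi => (h i hi).const_nonneg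
  bound J := by
    refine (norm_sum_le _ _).trans ?_
    rw [Finset.sum_mul]
    exact Finset.sum_le_sum fun i hi => (h i hi).bound J

lemma evalFn_mulT_poly {q : ℕ} {g : (Fin q → Idx) → ℂ} {𝒦 : Fin 3 → (Fin q → Idx) → ℂ}
    {v : Fin q → Idx → ℂ} (h : ∀ l, Summable fun J => ‖g J * 𝒦 l J * tens v J‖)
    (hm : ∀ l, MemW (wt1 0) (mulT (fun J => g J * 𝒦 l J) v)) (x ξ : ℝ) :
    polySym (fun l J => g J * 𝒦 l J) v x ξ =
      evalFn (mulT (fun J => g J * ∑ l, 𝒦 l J * xiPow l ξ) v) x := by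
  have h1 : (fun J => g J * ∑ l, 𝒦 l J * xiPow l ξ) =
      fun J => ∑ l : Fin 3, xiPow l ξ * (g J * 𝒦 l J) := by
    funext J; rw [Finset.mul_sum]; exact Finset.sum_congr rfl fun l _ => by ring
  rw [h1, mulT_sum_ker]
  · simp only [mulT_smul_ker]
    rw [evalFn_sum]
    · simp only [evalFn_smul]
      exact Finset.sum_congr rfl fun l _ => mul_comm _ _
    · intro l _
      exact MemW.smul _ _ (hm l)
  · intro l _
    refine ((h l).mul_left ‖xiPow l ξ‖).congr fun J => ?_
    rw [← norm_mul]; congr 1; ring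

lemma norm_cut_le {q : ℕ} {δ : ℝ} {φ : (Fin q → ℤ) → ℝ → ℝ} (h : IsCut q δ φ) (ξ : ℝ) :
    ∃ D : ℝ, 0 ≤ D ∧ ∀ J : Fin q → Idx, ‖(φ (fun i => (J i).2) ξ : ℂ)‖ ≤ D := by
  obtain ⟨D, h0, hD⟩ := h.bound
  exact ⟨D, h0, fun J => by rw [Complex.norm_real]; exact hD _ _⟩

lemma polySym_cut {q : ℕ} (hq : 0 < q) {δ : ℝ} {φ : (Fin q → ℤ) → ℝ → ℝ} (hφ : IsCut q δ φ)
    {𝒦 : Fin 3 → (Fin q → Idx) → ℂ} {μ C : ℝ} (h : ∀ l, KerBdd (𝒦 l) μ C)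
    {v : Fin q → Idx → ℂ} (hv : ∀ i, MemW (wt2 μ) (v i)) (x ξ η : ℝ) :
    polySym (fun l J => (φ (fun i => (J i).2) η : ℂ) * 𝒦 l J) v x ξ =
      evalFn (mulT (fun J => (φ (fun i => (J i).2) η : ℂ) * ∑ l, 𝒦 l J * xiPow l ξ) v) x := by
  obtain ⟨D, h0, hD⟩ := norm_cut_le hφ η
  have hk := fun l => (h l).mul_left h0 hD
  refine evalFn_mulT_poly (fun l => (hk l).summable_norm hq hv) (fun l => ?_) x ξ
  exact (hk l).memW hq le_rfl fun i => by rw [zero_add]; exact hv i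

lemma memW_mulT_symKer {q : ℕ} (hq : 0 < q) {δ : ℝ} {φ : (Fin q → ℤ) → ℝ → ℝ}
    (hφ : IsCut q δ φ) {𝒦 : Fin 3 → (Fin q → Idx) → ℂ} {μ C : ℝ} (h : ∀ l, KerBdd (𝒦 l) μ C)
    {v : Fin q → Idx → ℂ} (hv : ∀ i, MemW (wt2 μ) (v i)) (ξ : ℝ) :
    MemW (wt1 0) (mulT (symKer φ 𝒦 ξ) v) := by
  obtain ⟨D, h0, hD⟩ := norm_cut_le hφ ξ
  have h1 : ∀ l ∈ (Finset.univ : Finset (Fin 3)),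
      KerBdd (fun J => 𝒦 l J * xiPow l ξ) μ (‖xiPow l ξ‖ * C) := fun l _ => by
    have := (h l).mul_left (norm_nonneg (xiPow l ξ)) (g := fun _ => xiPow l ξ) fun _ => le_rfl
    simpa only [mul_comm] using this
  have h2 := (KerBdd.sum (h 0).exp_nonneg h1).mul_left h0 hD
  exact h2.memW hq le_rfl fun i => by rw [zero_add]; exact hv i

/-- The homogeneous cut-off depends on the moduli of the frequencies only, so inserting it in the
spectral pieces amounts to inserting it in the kernel. -/
lemma truncate_polyHom {χ : Cutoffs} {δ : ℝ} (hχ : χ.Admissible δ) {q : ℕ} (hq : 0 < q)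
    {𝒦 : Fin 3 → (Fin q → Idx) → ℂ} {μ C : ℝ} (h : ∀ l, KerBdd (𝒦 l) μ C) {U : Fn2}
    (hU : MemW (wt2 μ) (un U)) (x ξ : ℝ) :
    (polyHom q 𝒦).truncate χ U x ξ =
      evalFn (mulT (symKer (cutHom χ q) 𝒦 ξ) fun _ => un U) x := by
  have hφ := isCut_cutHom hχ hq
  obtain ⟨D, h0, hD⟩ := norm_cut_le hφ ξ
  have h1 := hasSum_polySym_projU 𝒦
    (fun n => (χ.hom q (WithLp.toLp 2 fun i => (n i : ℝ)) ξ : ℂ)) (v := fun _ => un U)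
    (fun l => ((h l).mul_left h0 hD).summable_norm hq fun _ => hU) x ξ
  unfold HomSym.truncate
  simp_rw [polyHom_projTuple hq h]
  rw [h1.tsum_eq]
  exact polySym_cut hq hφ h (fun _ => hU) x ξ ξ

/-- The Fourier variable η of the symbol is the total frequency of the multi-index, so this
truncation too is a factor in the kernel. -/
lemma truncateNon_polySym {χ : Cutoffs} {δ : ℝ} (hχ : χ.Admissible δ) {s : Finset ℕ}
    (hq : ∀ q ∈ s, 0 < q) {𝒦 : (q : ℕ) → Fin 3 → (Fin q → Idx) → ℂ} {μ : ℝ} {C : ℕ → ℝ}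
    (h : ∀ q l, KerBdd (𝒦 q l) μ (C q)) {U : Fn2} (hU : MemW (wt2 μ) (un U)) (x ξ : ℝ) :
    truncateNon χ (fun x ξ => ∑ q ∈ s, polySym (𝒦 q) (fun _ => un U) x ξ) x ξ =
      ∑ q ∈ s, evalFn (mulT (symKer (cutNon χ q) (𝒦 q) ξ) fun _ => un U) x := by
  have hG : ∀ q ∈ s, MemW (wt1 0) (mulT (fun J => ∑ l, 𝒦 q l J * xiPow l ξ) fun _ => un U) := by
    intro q hqs
    have h1 : ∀ l ∈ (Finset.univ : Finset (Fin 3)),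
        KerBdd (fun J => 𝒦 q l J * xiPow l ξ) μ (‖xiPow l ξ‖ * C q) := fun l _ => by
      have := (h q l).mul_left (norm_nonneg (xiPow l ξ)) (g := fun _ => xiPow l ξ) fun _ => le_rfl
      simpa only [mul_comm] using this
    exact (KerBdd.sum (h q 0).exp_nonneg h1).memW (hq q hqs) le_rfl
      fun _ => by rw [zero_add]; exact hU
  have hp : (fun x' => ∑ q ∈ s, polySym (𝒦 q) (fun _ => un U) x' ξ) =
      evalFn (∑ q ∈ s, mulT (fun J => ∑ l, 𝒦 q l J * xiPow l ξ) fun _ => un U) := by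
    funext x'
    rw [evalFn_sum hG]
    refine Finset.sum_congr rfl fun q hqs => ?_
    have := evalFn_mulT_poly (g := fun _ => 1) (𝒦 := 𝒦 q) (v := fun _ => un U)
      (fun l => by simpa using (h q l).summable_norm (hq q hqs) fun _ => hU)
      (fun l => by simpa using (h q l).memW (hq q hqs) le_rfl fun _ => by rw [zero_add]; exact hU)
      x' ξ
    simpa using this
  unfold truncateNon
  rw [hp, fourierFn_evalFn (memW_sum hG), ← evalFn_sum fun q hqs =>
    memW_mulT_symKer (hq q hqs) (isCut_cutNon hχ q) (h q) (fun _ => hU) ξ]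
  congr 1
  funext η
  rw [Finset.sum_apply, Finset.sum_apply, Finset.mul_sum]
  refine Finset.sum_congr rfl fun q _ => ?_
  unfold mulT
  rw [← tsum_mul_left]
  refine tsum_congr fun J => ?_
  split_ifs with hJ
  · subst hJ
    unfold symKer cutNon frq
    ring
  · simp

/-- A symbol with polynomial multilinear expansion up to degree `Q - 1`. -/
def polyExp (N Q : ℕ) (𝒦 : (q : ℕ) → Fin 3 → (Fin q → Idx) → ℂ) : SymExp where
  hom q := polyHom q (𝒦 q)
  rem U x ξ := ∑ q ∈ Finset.Ico N Q, polySym (𝒦 q) (fun _ => un U) x ξ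

/-- The cut-off function acting on the terms of degree `q`. -/
def cutAt (χ : Cutoffs) (N q : ℕ) : (Fin q → ℤ) → ℝ → ℝ :=
  if q < N then cutHom χ q else cutNon χ q

lemma isCut_cutAt {χ : Cutoffs} {δ : ℝ} (h : χ.Admissible δ) (N : ℕ) {q : ℕ} (hq : 1 ≤ q) :
    IsCut q δ (cutAt χ N q) := by
  unfold cutAt
  split_ifs
  · exact isCut_cutHom h hq
  · exact isCut_cutNon h q

lemma KerBdd.cutKer {q : ℕ} {δ : ℝ} {φ : (Fin q → ℤ) → ℝ → ℝ} (h : IsCut q δ φ)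
    {κ : (Fin (q + 1) → Idx) → ℂ} {μ C : ℝ} (hκ : KerBdd κ μ C) :
    ∃ C', KerBdd (ParaNLS.cutKer φ κ) μ C' := by
  obtain ⟨D, h0, hD⟩ := h.bound
  refine ⟨_, hκ.mul_left (D := ‖(q : ℂ) + 1‖ * D) (by positivity) fun J => ?_⟩
  rw [norm_mul, Complex.norm_real]
  exact mul_le_mul_of_nonneg_left (hD _ _) (norm_nonneg _)

/-- Degrees below N are cut term by term with the cut-off on ℝ^q, the others together with the one
on ℝ; `cutAt` records which one applies. -/
lemma polyExp_opBW {χ : Cutoffs} {δ : ℝ} (hχ : χ.Admissible δ) {N Q : ℕ} (hN : 1 ≤ N)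
    (hQ : N ≤ Q) {e : Fin 2} {𝒦 : (q : ℕ) → Fin 3 → (Fin q → Idx) → ℂ}
    {κ : (q : ℕ) → (Fin (q + 1) → Idx) → ℂ} (hw : ∀ q, 1 ≤ q → IsWeylCoeff e (𝒦 q) (κ q))
    {μ μ' : ℝ} {C C' : ℕ → ℝ} (h : ∀ q l, KerBdd (𝒦 q l) μ (C q))
    (h' : ∀ q, KerBdd (κ q) μ' (C' q)) {U V : Fn2} {s : ℝ} (hs : μ + 1 ≤ s) (hs' : μ' + 1 ≤ s)
    (hU : MemHs2 s U) (hV : MemHs2 s V) :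
    (polyExp N Q 𝒦).opBW χ 1 N U (V e) =
      ∑ q ∈ Finset.Ico 1 Q, mulT (cutKer (cutAt χ N q) (κ q)) (opArgs q e U (V e)) := by
  have hUμ := (hU.memW hs).1
  have hsum : ∀ q, 1 ≤ q → ∀ φ, IsCut q δ φ →
      Summable fun J => ‖cutKer φ (κ q) J * tens (opArgs q e U (V e)) J‖ := by
    intro q hq φ hφ
    obtain ⟨D, hD⟩ := (h' q).cutKer hφ
    exact summable_opArgs_of_rowArgs
      (hD.summable_norm (Nat.succ_pos q) (rowArgs_memW hs' hU hV)) e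
  rw [← Finset.sum_Ico_consecutive _ hN hQ]
  unfold SymExp.opBW
  congr 1
  · refine Finset.sum_congr rfl fun q hq => ?_
    obtain ⟨hq1, hqN⟩ := Finset.mem_Ico.1 hq
    have hcut : cutAt χ N q = cutHom χ q := if_pos hqN
    rw [hcut]
    have := opW_eq_sum (s := {()}) (c := (polyHom q (𝒦 q)).truncate χ U) (u := V e)
      (G := fun _ ξ => mulT (symKer (cutHom χ q) (𝒦 q) ξ) fun _ => un U)
      (T := fun _ => mulT (cutKer (cutHom χ q) (κ q)) (opArgs q e U (V e)))
      (fun x ξ => by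
        rw [Finset.sum_singleton]; exact truncate_polyHom hχ hq1 (h q) hUμ x ξ)
      (fun _ _ ξ => memW_mulT_symKer hq1 (isCut_cutHom hχ hq1) (h q) (fun _ => hUμ) ξ)
      (fun _ _ k => hasSum_weyl (hw q hq1) (hsum q hq1 _ (isCut_cutHom hχ hq1)) k)
    rwa [Finset.sum_singleton] at this
  · have hpos : ∀ q ∈ Finset.Ico N Q, 1 ≤ q := fun q hq => hN.trans (Finset.mem_Ico.1 hq).1
    have := opW_eq_sum (s := Finset.Ico N Q) (c := truncateNon χ ((polyExp N Q 𝒦).rem U))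
      (u := V e)
      (G := fun q ξ => mulT (symKer (cutNon χ q) (𝒦 q) ξ) fun _ => un U)
      (T := fun q => mulT (cutKer (cutNon χ q) (κ q)) (opArgs q e U (V e)))
      (fun x ξ => truncateNon_polySym hχ hpos h hUμ x ξ)
      (fun q hq ξ => memW_mulT_symKer (hpos q hq) (isCut_cutNon hχ q) (h q) (fun _ => hUμ) ξ)
      (fun q hq k => hasSum_weyl (hw q (hpos q hq)) (hsum q (hpos q hq) _ (isCut_cutNon hχ q)) k)
    rw [this]
    refine Finset.sum_congr rfl fun q hq => ?_
    have hcut : cutAt χ N q = cutNon χ q := if_neg (not_lt.2 (Finset.mem_Ico.1 hq).1)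
    rw [hcut]

/-! ### Polynomials as symmetric tensors -/

/-- The indices of the variables of the nonlinearity. -/
abbrev Vars : Type := Fin 3 ⊕ Fin 3

/-- The exponent of the monomial `∏ X (c i)`. -/
def content {p : ℕ} (c : Fin p → Vars) : Vars →₀ ℕ := ∑ i, Finsupp.single (c i) 1

lemma degree_content {p : ℕ} (c : Fin p → Vars) : (content c).degree = p := by
  simp [content, map_sum, Finsupp.degree_single]

lemma content_comp_perm {p : ℕ} (c : Fin p → Vars) (e : Equiv.Perm (Fin p)) :
    content (c ∘ e) = content c := Equiv.sum_comp e fun i => Finsupp.single (c i) 1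

lemma monomial_content {p : ℕ} (c : Fin p → Vars) :
    MvPolynomial.monomial (content c) (1 : ℂ) = ∏ i, MvPolynomial.X (c i) := by
  unfold content
  rw [MvPolynomial.monomial_sum_one]
  rfl

lemma exists_content (p : ℕ) (d : Vars →₀ ℕ) (h : d.degree = p) :
    ∃ c : Fin p → Vars, content c = d := by
  induction p generalizing d with
  | zero => exact ⟨Fin.elim0, by simp [content, ((Finsupp.degree_eq_zero_iff d).1 h)]⟩
  | succ p ih =>
    have hd : d ≠ 0 := by rintro rfl; simp at h
    obtain ⟨v, hv⟩ := Finsupp.ne_iff.1 hd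
    have hle : Finsupp.single v 1 ≤ d := by
      rw [Finsupp.single_le_iff]; exact Nat.one_le_iff_ne_zero.2 hv
    have hsum := tsub_add_cancel_of_le hle
    have hdeg : (d - Finsupp.single v 1).degree = p := by
      have := congrArg Finsupp.degree hsum
      rw [map_add, Finsupp.degree_single, h] at this
      omega
    obtain ⟨c, hc⟩ := ih _ hdeg
    refine ⟨Fin.snoc c v, ?_⟩
    rw [← hsum, ← hc]
    simp [content, Fin.sum_univ_castSucc]

/-- The symmetric tensor of the homogeneous part of degree `p` of `P`. -/
def wordCoeff (P : MvPolynomial Vars ℂ) {p : ℕ} (c : Fin p → Vars) : ℂ :=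
  MvPolynomial.coeff (content c) P /
    ((Finset.univ.filter fun c' : Fin p → Vars => content c' = content c).card : ℂ)

lemma wordCoeff_comp_perm (P : MvPolynomial Vars ℂ) {p : ℕ} (c : Fin p → Vars)
    (e : Equiv.Perm (Fin p)) : wordCoeff P (c ∘ e) = wordCoeff P c := by
  unfold wordCoeff
  rw [content_comp_perm]

/-- Every monomial is spread evenly over the words with its content, so summing over these words
gives back its coefficient. -/
lemma coeff_words (P : MvPolynomial Vars ℂ) (p : ℕ) (d : Vars →₀ ℕ) :
    MvPolynomial.coeff d
      (∑ c : Fin p → Vars, MvPolynomial.C (wordCoeff P c) * ∏ i, MvPolynomial.X (c i)) =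
      if d.degree = p then MvPolynomial.coeff d P else 0 := by
  rw [MvPolynomial.coeff_sum]
  have h1 : ∀ c : Fin p → Vars, MvPolynomial.coeff d
      (MvPolynomial.C (wordCoeff P c) * ∏ i, MvPolynomial.X (c i)) =
      if content c = d then MvPolynomial.coeff d P /
        ((Finset.univ.filter fun c' : Fin p → Vars => content c' = d).card : ℂ) else 0 := by
    intro c
    rw [← monomial_content, MvPolynomial.coeff_C_mul, MvPolynomial.coeff_monomial]
    split_ifs with h
    · subst h; rw [mul_one]; rfl
    · rw [mul_zero]
  rw [Finset.sum_congr rfl fun c _ => h1 c, ← Finset.sum_filter, Finset.sum_const, nsmul_eq_mul]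
  split_ifs with h
  · obtain ⟨c, hc⟩ := exists_content p d h
    refine mul_div_cancel₀ _ ?_
    exact_mod_cast (Finset.card_pos.2 ⟨c, by simp [hc]⟩).ne'
  · have : (Finset.univ.filter fun c : Fin p → Vars => content c = d) = ∅ := by
      refine Finset.filter_eq_empty_iff.2 fun c _ hc => h ?_
      rw [← hc, degree_content]
    rw [this]; simp

lemma eq_sum_words (P : MvPolynomial Vars ℂ) {Q : ℕ} (hQ : P.totalDegree < Q) :
    P = ∑ p ∈ Finset.range Q, ∑ c : Fin p → Vars,
      MvPolynomial.C (wordCoeff P c) * ∏ i, MvPolynomial.X (c i) := by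
  ext d
  rw [MvPolynomial.coeff_sum, Finset.sum_congr rfl fun p _ => coeff_words P p d,
    Finset.sum_ite_eq]
  split_ifs with h
  · rfl
  · refine MvPolynomial.coeff_eq_zero_of_totalDegree_lt (hQ.trans_le ?_)
    rw [Finset.mem_range, not_lt] at h
    exact h

lemma eval_eq_sum_words (P : MvPolynomial Vars ℂ) {Q : ℕ} (hQ : P.totalDegree < Q)
    (z : Vars → ℂ) : MvPolynomial.eval z P =
      ∑ p ∈ Finset.range Q, ∑ c : Fin p → Vars, wordCoeff P c * ∏ i, z (c i) := by
  conv_lhs => rw [eq_sum_words P hQ]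
  simp [map_sum, map_prod]

lemma pderiv_prod {ι : Type*} [DecidableEq ι] (v : Vars) (s : Finset ι)
    (f : ι → MvPolynomial Vars ℂ) : MvPolynomial.pderiv v (∏ i ∈ s, f i) =
      ∑ i ∈ s, (∏ j ∈ s.erase i, f j) * MvPolynomial.pderiv v (f i) := by
  induction s using Finset.induction_on with
  | empty => simp
  | insert a s ha ih =>
    rw [Finset.prod_insert ha, Derivation.leibniz, ih, Finset.sum_insert ha,
      Finset.erase_insert ha, smul_eq_mul, smul_eq_mul, Finset.mul_sum, add_comm]
    congr 1
    refine Finset.sum_congr rfl fun i hi => ?_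
    have hne : a ≠ i := by rintro rfl; exact ha hi
    rw [Finset.erase_insert_of_ne hne, Finset.prod_insert fun h => ha (Finset.mem_of_mem_erase h)]
    ring

lemma pderiv_prod_X {p : ℕ} (v : Vars) (c : Fin p → Vars) :
    MvPolynomial.pderiv v (∏ i, MvPolynomial.X (c i) : MvPolynomial Vars ℂ) =
      ∑ i, if c i = v then ∏ j ∈ Finset.univ.erase i, MvPolynomial.X (c j) else 0 := by
  rw [pderiv_prod]
  refine Finset.sum_congr rfl fun i _ => ?_
  rw [MvPolynomial.pderiv_X, Pi.single_apply]
  split_ifs <;> simp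

/-- By symmetry of the tensor, each of the q + 1 slots where the derivative may fall can be moved to
the last place and contributes equally. -/
lemma eval_pderiv_eq (P : MvPolynomial Vars ℂ) {Q : ℕ} (hQ : P.totalDegree < Q + 1)
    (v : Vars) (z : Vars → ℂ) : MvPolynomial.eval z (MvPolynomial.pderiv v P) =
      ∑ q ∈ Finset.range Q, ((q : ℂ) + 1) * ∑ c : Fin q → Vars,
        wordCoeff P (Fin.snoc c v : Fin (q + 1) → Vars) * ∏ i, z (c i) := by
  conv_lhs => rw [eq_sum_words P hQ]
  rw [map_sum, map_sum, Finset.sum_range_succ']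
  have h0 : MvPolynomial.eval z (MvPolynomial.pderiv v (∑ c : Fin 0 → Vars,
      MvPolynomial.C (wordCoeff P c) * ∏ i, MvPolynomial.X (c i))) = 0 := by simp
  rw [h0, add_zero]
  refine Finset.sum_congr rfl fun q _ => ?_
  have h1 : ∀ c : Fin (q + 1) → Vars, MvPolynomial.eval z (MvPolynomial.pderiv v
      (MvPolynomial.C (wordCoeff P c) * ∏ i, MvPolynomial.X (c i))) =
      ∑ a, if c a = v then wordCoeff P c * ∏ j ∈ Finset.univ.erase a, z (c j) else 0 := by
    intro c
    rw [MvPolynomial.pderiv_C_mul, pderiv_prod_X, map_mul, MvPolynomial.eval_C, map_sum, Finset.mul_sum]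
    refine Finset.sum_congr rfl fun a _ => ?_
    split_ifs
    · rw [map_prod]; simp
    · simp
  rw [map_sum, map_sum, Finset.sum_congr rfl fun c _ => h1 c, Finset.sum_comm]
  have h2 : ∀ a : Fin (q + 1), (∑ c : Fin (q + 1) → Vars,
      if c a = v then wordCoeff P c * ∏ j ∈ Finset.univ.erase a, z (c j) else 0) =
      ∑ c : Fin q → Vars, wordCoeff P (Fin.snoc c v : Fin (q + 1) → Vars) * ∏ i, z (c i) := by
    intro a
    have h3 : (∑ c : Fin (q + 1) → Vars,
        if c a = v then wordCoeff P c * ∏ j ∈ Finset.univ.erase a, z (c j) else 0) =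
        ∑ c : Fin (q + 1) → Vars, if c (Fin.last q) = v then
          wordCoeff P c * ∏ j : Fin q, z (c j.castSucc) else 0 := by
      refine Fintype.sum_equiv ((Equiv.swap a (Fin.last q)).arrowCongr (Equiv.refl _)) _ _
        fun c => ?_
      have hc : ((Equiv.swap a (Fin.last q)).arrowCongr (Equiv.refl _)) c =
          c ∘ Equiv.swap a (Fin.last q) := by
        funext i; simp [Equiv.arrowCongr]
      rw [hc, wordCoeff_comp_perm]
      simp only [Function.comp, Equiv.swap_apply_right]
      by_cases hv : c a = v
      · rw [if_pos hv, if_pos hv]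
        congr 1
        have hu : (Finset.univ.erase (Fin.last q)) = Finset.univ.map Fin.castSuccEmb := by
          ext i
          simp only [Finset.mem_erase, Finset.mem_univ, and_true, Finset.mem_map, true_and]
          exact Fin.exists_castSucc_eq.symm
        have hp : ∏ j : Fin q, z (c (Equiv.swap a (Fin.last q) j.castSucc)) =
            ∏ j ∈ Finset.univ.erase (Fin.last q), z (c (Equiv.swap a (Fin.last q) j)) := by
          rw [hu, Finset.prod_map]; rfl
        rw [hp]
        refine Finset.prod_equiv (Equiv.swap a (Fin.last q)) (fun j => ?_) fun j _ => by simp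
        simp [Equiv.swap_apply_eq_iff]
      · rw [if_neg hv, if_neg hv]
    rw [h3, ← (snocEquiv q Vars).sum_comp, Fintype.sum_prod_type]
    refine Finset.sum_congr rfl fun c _ => ?_
    simp
  rw [Finset.sum_congr rfl fun a _ => h2 a, Finset.sum_const, Finset.card_univ, Fintype.card_fin,
    nsmul_eq_mul]
  push_cast
  rfl

/-! ### Consequences of the structural assumptions on the nonlinearity -/

/-- The point `(z, conj z)`. -/
def cpt (z₀ z₁ z₂ : ℂ) : Vars → ℂ := Sum.elim ![z₀, z₁, z₂] ![conj z₀, conj z₁, conj z₂]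

lemma polyFun_eq (P : MvPolynomial Vars ℂ) (z₀ z₁ z₂ : ℂ) :
    polyFun P z₀ z₁ z₂ = MvPolynomial.eval (cpt z₀ z₁ z₂) P := rfl

/-- With z = x + iy and conj z = x − iy the polynomial vanishes at all real points, hence
identically. The substitution is linear and invertible over ℂ, so the original polynomial is zero.
-/
lemma eq_zero_of_polyFun {P : MvPolynomial Vars ℂ} (h : ∀ z₀ z₁ z₂, polyFun P z₀ z₁ z₂ = 0) :
    P = 0 := by
  set P' := MvPolynomial.bind₁ (Sum.elim
    (fun l => MvPolynomial.X (Sum.inl l) + MvPolynomial.C Complex.I * MvPolynomial.X (Sum.inr l))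
    (fun l => MvPolynomial.X (Sum.inl l) - MvPolynomial.C Complex.I * MvPolynomial.X (Sum.inr l)) :
      Vars → MvPolynomial Vars ℂ) P with hP'
  have hev : ∀ w : Vars → ℂ, MvPolynomial.eval w P' = MvPolynomial.eval
      (Sum.elim (fun l => w (Sum.inl l) + Complex.I * w (Sum.inr l))
        (fun l => w (Sum.inl l) - Complex.I * w (Sum.inr l))) P := by
    intro w
    rw [hP', ← MvPolynomial.coe_aeval_eq_eval, ← MvPolynomial.coe_aeval_eq_eval]
    simp only [RingHom.coe_coe, MvPolynomial.aeval_bind₁]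
    congr 2
    funext v
    rcases v with l | l <;> simp
  have h0 : P' = 0 := by
    refine MvPolynomial.funext_set (fun _ => Set.range ((↑) : ℝ → ℂ))
      (fun _ => Set.infinite_range_of_injective Complex.ofReal_injective) fun w hw => ?_
    rw [hev, map_zero]
    have hr : ∀ v, conj (w v) = w v := fun v => by
      obtain ⟨x, hx⟩ := hw v (Set.mem_univ v)
      rw [← hx]; exact Complex.conj_ofReal x
    rw [← h (w (Sum.inl 0) + Complex.I * w (Sum.inr 0)) (w (Sum.inl 1) + Complex.I * w (Sum.inr 1))
      (w (Sum.inl 2) + Complex.I * w (Sum.inr 2)), polyFun_eq]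
    congr 2
    funext v
    rcases v with l | l <;> fin_cases l <;> simp [cpt, hr, sub_eq_add_neg]
  refine MvPolynomial.funext fun w => ?_
  have h1 := hev (Sum.elim (fun l => (w (Sum.inl l) + w (Sum.inr l)) / 2)
    (fun l => (w (Sum.inl l) - w (Sum.inr l)) / (2 * Complex.I)))
  rw [h0, map_zero] at h1
  rw [map_zero, h1]
  congr 2
  funext v
  have hI := Complex.I_ne_zero
  rcases v with l | l <;> simp only [Sum.elim_inl, Sum.elim_inr] <;> field_simp <;> ring

lemma eq_of_polyFun {P Q : MvPolynomial Vars ℂ}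
    (h : ∀ z₀ z₁ z₂, polyFun P z₀ z₁ z₂ = polyFun Q z₀ z₁ z₂) : P = Q := by
  refine sub_eq_zero.1 (eq_zero_of_polyFun fun z₀ z₁ z₂ => ?_)
  have := h z₀ z₁ z₂
  rw [polyFun_eq] at this ⊢
  rw [map_sub, this, polyFun_eq, sub_self]

lemma conj_eval (P : MvPolynomial Vars ℂ) (z : Vars → ℂ) :
    conj (MvPolynomial.eval z P) =
      MvPolynomial.eval (fun v => conj (z v)) (MvPolynomial.map (starRingEnd ℂ) P) := by
  rw [MvPolynomial.eval_map]
  exact MvPolynomial.eval₂_comp_left (starRingEnd ℂ) (RingHom.id ℂ) z P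

/-- Conjugating the variables and the value conjugates the coefficients, so the assumption makes
them real, by uniqueness of coefficients. -/
lemma IsAdmissibleNonlinearity.conj_coeff {P : MvPolynomial Vars ℂ}
    (hP : IsAdmissibleNonlinearity P) (d : Vars →₀ ℕ) :
    conj (MvPolynomial.coeff d P) = MvPolynomial.coeff d P := by
  have h : MvPolynomial.map (starRingEnd ℂ) P = P := by
    refine eq_of_polyFun fun z₀ z₁ z₂ => ?_
    rw [hP.reversibility, polyFun_eq, polyFun_eq, conj_eval]
    congr 2
    funext v
    rcases v with l | l <;> fin_cases l <;> simp [cpt]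
  conv_rhs => rw [← h]
  rw [MvPolynomial.coeff_map]

lemma IsAdmissibleNonlinearity.conj_wordCoeff {P : MvPolynomial Vars ℂ}
    (hP : IsAdmissibleNonlinearity P) {p : ℕ} (c : Fin p → Vars) :
    conj (wordCoeff P c) = wordCoeff P c := by
  unfold wordCoeff
  rw [map_div₀, hP.conj_coeff, Complex.conj_natCast]

/-- The parity of the variables. -/
def sgV : Vars → ℂ := Sum.elim (fun l => (-1) ^ (l : ℕ)) (fun l => (-1) ^ (l : ℕ))

lemma coeff_bind_smul (s : Vars → ℂ) (P : MvPolynomial Vars ℂ) (d : Vars →₀ ℕ) :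
    MvPolynomial.coeff d (MvPolynomial.bind₁ (fun v => MvPolynomial.C (s v) * MvPolynomial.X v) P) =
      MvPolynomial.coeff d P * d.prod fun v n => s v ^ n := by
  induction P using MvPolynomial.induction_on' with
  | monomial e a =>
    have h1 : (MvPolynomial.bind₁ (fun v => MvPolynomial.C (s v) * MvPolynomial.X v))
        (MvPolynomial.monomial e a) = MvPolynomial.monomial e (a * e.prod fun v n => s v ^ n) := by
      rw [MvPolynomial.bind₁_monomial, MvPolynomial.monomial_eq (a := a * _), MvPolynomial.C_mul,
        mul_assoc]
      congr 1
      simp only [Finsupp.prod, map_prod, map_pow, mul_pow, Finset.prod_mul_distrib]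
    rw [h1, MvPolynomial.coeff_monomial, MvPolynomial.coeff_monomial]
    split_ifs with h
    · rw [h]
    · rw [zero_mul]
  | add p q hp hq => rw [map_add, MvPolynomial.coeff_add, MvPolynomial.coeff_add, hp, hq, add_mul]

/-- The sign is −1 only on the variables z₁ and conj z₁. Invariance under z₁ ↦ −z₁ forces every
monomial present to contain an even number of them. -/
lemma IsAdmissibleNonlinearity.prod_sgV {P : MvPolynomial Vars ℂ}
    (hP : IsAdmissibleNonlinearity P) {p : ℕ} {c : Fin p → Vars} (hc : wordCoeff P c ≠ 0) :
    ∏ i, sgV (c i) = 1 := by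
  have h : MvPolynomial.bind₁ (fun v => MvPolynomial.C (sgV v) * MvPolynomial.X v) P = P := by
    refine eq_of_polyFun fun z₀ z₁ z₂ => ?_
    rw [hP.parity z₀ z₁ z₂, polyFun_eq, polyFun_eq, ← MvPolynomial.coe_aeval_eq_eval,
      ← MvPolynomial.coe_aeval_eq_eval]
    simp only [RingHom.coe_coe, MvPolynomial.aeval_bind₁]
    congr 2
    funext v
    rcases v with l | l <;> fin_cases l <;> simp [cpt, sgV]
  have h1 := coeff_bind_smul sgV P (content c)
  rw [h] at h1
  have h2 : MvPolynomial.coeff (content c) P ≠ 0 := by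
    intro h0; exact hc (by rw [wordCoeff, h0, zero_div])
  have h3 : (content c).prod (fun v n => sgV v ^ n) = 1 :=
    (mul_right_eq_self₀.1 h1.symm).resolve_right h2
  rw [← h3]
  have h4 := congrArg (MvPolynomial.eval sgV) (monomial_content c)
  rw [MvPolynomial.eval_monomial, one_mul, map_prod] at h4
  simpa using h4.symm

lemma IsAdmissibleNonlinearity.wordCoeff_eq_zero {P : MvPolynomial Vars ℂ}
    (hP : IsAdmissibleNonlinearity P) {p : ℕ} (hp : p < 2) (c : Fin p → Vars) :
    wordCoeff P c = 0 := by
  have : MvPolynomial.coeff (content c) P = 0 := by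
    by_contra h
    have := hP.order_two _ (MvPolynomial.mem_support_iff.2 h)
    rw [degree_content] at this
    omega
  rw [wordCoeff, this, zero_div]

/-- The real linear map `v ↦ a v + b (conj v)`. -/
def realLin (a b : ℂ) : ℂ →L[ℝ] ℂ :=
  ContinuousLinearMap.mul ℝ ℂ a +
    (ContinuousLinearMap.mul ℝ ℂ b).comp (Complex.conjCLE : ℂ →L[ℝ] ℂ)

lemma realLin_apply (a b v : ℂ) : realLin a b v = a * v + b * conj v := rfl

lemma hasFDerivAt_cpt (z₀ z₁ z : ℂ) (v : Vars) :
    HasFDerivAt (fun w => cpt z₀ z₁ w v)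
      (realLin (if v = Sum.inl 2 then 1 else 0) (if v = Sum.inr 2 then 1 else 0)) z := by
  have hc : ∀ a : ℂ, HasFDerivAt (fun _ : ℂ => a) (realLin 0 0) z := fun a =>
    (hasFDerivAt_const (𝕜 := ℝ) a z).congr_fderiv
      (ContinuousLinearMap.ext fun w => by simp [realLin_apply])
  have h1 : HasFDerivAt (fun w : ℂ => w) (realLin 1 0) z :=
    (hasFDerivAt_id (𝕜 := ℝ) z).congr_fderiv
      (ContinuousLinearMap.ext fun w => by simp [realLin_apply])
  have h2 : HasFDerivAt (fun w : ℂ => conj w) (realLin 0 1) z :=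
    (Complex.conjCLE.hasFDerivAt (x := z)).congr_fderiv
      (ContinuousLinearMap.ext fun w => by simp [realLin_apply])
  rcases v with l | l <;> fin_cases l
  · exact hc z₀
  · exact hc z₁
  · exact h1
  · exact hc (conj z₀)
  · exact hc (conj z₁)
  · exact h2

lemma hasFDerivAt_polyFun (P : MvPolynomial Vars ℂ) (z₀ z₁ z : ℂ) :
    HasFDerivAt (fun w => polyFun P z₀ z₁ w)
      (realLin (MvPolynomial.eval (cpt z₀ z₁ z) (MvPolynomial.pderiv (Sum.inl 2) P))
        (MvPolynomial.eval (cpt z₀ z₁ z) (MvPolynomial.pderiv (Sum.inr 2) P))) z := by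
  simp only [polyFun_eq]
  induction P using MvPolynomial.induction_on with
  | C a =>
    simp only [MvPolynomial.eval_C, MvPolynomial.pderiv_C, map_zero]
    exact (hasFDerivAt_const (𝕜 := ℝ) a z).congr_fderiv
      (ContinuousLinearMap.ext fun w => by simp [realLin_apply])
  | add p q hp hq =>
    simp only [map_add]
    refine (hp.add hq).congr_fderiv (ContinuousLinearMap.ext fun w => ?_)
    rw [add_apply]
    simp only [realLin_apply]
    ring
  | mul_X p v hp =>
    simp only [map_mul, MvPolynomial.eval_X]
    refine (hp.mul (hasFDerivAt_cpt z₀ z₁ z v)).congr_fderiv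
      (ContinuousLinearMap.ext fun w => ?_)
    rw [Derivation.leibniz, Derivation.leibniz, MvPolynomial.pderiv_X, MvPolynomial.pderiv_X]
    rw [add_apply, smul_apply,
      smul_apply]
    simp only [realLin_apply, smul_eq_mul, map_add, map_mul, MvPolynomial.eval_X, Pi.single_apply,
      apply_ite (MvPolynomial.eval (cpt z₀ z₁ z)), map_one, map_zero, eq_comm (a := v)]
    ring

/-- The real differential is v ↦ a·v + b·conj v with a, b the formal derivatives in z₂ and conj z₂;
the Wirtinger derivative extracts a. This turns the Schrödinger assumption into a statement on a
polynomial. -/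
lemma wirtinger_polyFun (P : MvPolynomial Vars ℂ) (z₀ z₁ z : ℂ) :
    wirtinger (fun w => polyFun P z₀ z₁ w) z =
      MvPolynomial.eval (cpt z₀ z₁ z) (MvPolynomial.pderiv (Sum.inl 2) P) := by
  unfold wirtinger
  rw [(hasFDerivAt_polyFun P z₀ z₁ z).fderiv, realLin_apply, realLin_apply, map_one, Complex.conj_I]
  linear_combination
    -(MvPolynomial.eval (cpt z₀ z₁ z) (MvPolynomial.pderiv (Sum.inl 2) P) -
      MvPolynomial.eval (cpt z₀ z₁ z) (MvPolynomial.pderiv (Sum.inr 2) P)) / 2 * Complex.I_sq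

/-! ### Kernels of polynomial nonlinearities -/

/-- `∂ₓ^l u` for `ε = 0` and `∂ₓ^l (conj u)` for `ε = 1`. -/
def var (l : Fin 3) (ε : Fin 2) : Vars := if ε = 0 then Sum.inl l else Sum.inr l

def varEquiv : Fin 3 × Fin 2 ≃ Vars where
  toFun x := var x.1 x.2
  invFun := Sum.elim (fun l => (l, 0)) (fun l => (l, 1))
  left_inv x := by obtain ⟨l, ε⟩ := x; fin_cases ε <;> rfl
  right_inv v := by rcases v with l | l <;> rfl

lemma sgV_var (l : Fin 3) (ε : Fin 2) : sgV (var l ε) = (-1) ^ (l : ℕ) := by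
  fin_cases ε <;> rfl

/-- The kernel of the multilinear map with coefficients `b` acting on `Sⁱ U`. -/
def wordKer (i : Fin 2) {p : ℕ} (b : (Fin p → Vars) → ℂ) (J : Fin p → Idx) : ℂ :=
  -- A product of p Fourier series has p normalising factors, and the evaluation of the result
  -- supplies one of them. Addition in `Fin 2` of i = 1 exchanges the roles of u and conj u.
  nrm ^ (p - 1) * ∑ c : Fin p → Fin 3, b (fun t => var (c t) ((J t).1 + i)) *
    ∏ t, (Complex.I * (J t).2) ^ (c t : ℕ)

lemma norm_I_mul_pow_le (j : ℤ) (l : Fin 3) : ‖(Complex.I * j) ^ (l : ℕ)‖ ≤ jb j ^ (2 : ℝ) := by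
  rw [norm_pow, norm_mul, Complex.norm_I, one_mul, Complex.norm_intCast]
  refine (pow_le_pow_left₀ (abs_nonneg _) (abs_le_jb _) _).trans ?_
  rw [Real.rpow_two]
  exact pow_le_pow_right₀ (one_le_jb _) (by omega)

lemma kerBdd_wordKer (i : Fin 2) {p : ℕ} (b : (Fin p → Vars) → ℂ) :
    ∃ C, KerBdd (wordKer i b) 2 C := by
  refine ⟨∑ _c : Fin p → Fin 3, ∑ c' : Fin p → Vars, ‖b c'‖, by norm_num, by positivity,
    fun J => ?_⟩
  unfold wordKer
  rw [norm_mul, norm_pow, Finset.sum_mul]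
  refine (mul_le_of_le_one_left (norm_nonneg _)
    (pow_le_one₀ (norm_nonneg _) norm_nrm_le)).trans ?_
  refine (norm_sum_le _ _).trans (Finset.sum_le_sum fun c _ => ?_)
  rw [norm_mul, norm_prod]
  refine mul_le_mul ?_ ?_ (Finset.prod_nonneg fun _ _ => norm_nonneg _) (by positivity)
  · exact Finset.single_le_sum (f := fun c' : Fin p → Vars => ‖b c'‖) (fun _ _ => norm_nonneg _)
      (Finset.mem_univ _)
  · exact Finset.prod_le_prod (fun _ _ => norm_nonneg _) fun t _ => norm_I_mul_pow_le _ _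

lemma wordKer_comp_perm (i : Fin 2) {p : ℕ} {b : (Fin p → Vars) → ℂ}
    (hb : ∀ c (e : Equiv.Perm (Fin p)), b (c ∘ e) = b c) (J : Fin p → Idx)
    (e : Equiv.Perm (Fin p)) : wordKer i b (J ∘ e) = wordKer i b J := by
  unfold wordKer
  congr 1
  refine Fintype.sum_equiv (e.arrowCongr (Equiv.refl _)) _ _ fun c => ?_
  obtain ⟨c', rfl⟩ : ∃ c' : Fin p → Fin 3, c = c' ∘ e := ⟨c ∘ e.symm, by ext t; simp⟩
  have h1 : (e.arrowCongr (Equiv.refl _)) (c' ∘ e) = c' := by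
    funext t; simp [Equiv.arrowCongr]
  rw [h1]
  congr 1
  · exact hb (fun t => var (c' t) ((J t).1 + i)) e
  · exact Equiv.prod_comp e fun t => (Complex.I * ((J t).2 : ℂ)) ^ (c' t : ℕ)

lemma wordKer_flipJ (i : Fin 2) {p : ℕ} (b : (Fin p → Vars) → ℂ) (J : Fin p → Idx) :
    wordKer i b (flipJ J) = wordKer (i + 1) b J := by
  unfold wordKer flipJ
  simp only [add_assoc, add_comm (1 : Fin 2) i]

/-- The coefficients are real, and conjugation combined with the reversal of j leaves ij unchanged.
-/
lemma conj_wordKer_negJ (i : Fin 2) {p : ℕ} {b : (Fin p → Vars) → ℂ}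
    (hb : ∀ c, conj (b c) = b c) (J : Fin p → Idx) :
    conj (wordKer i b (negJ J)) = wordKer i b J := by
  unfold wordKer negJ
  simp [map_sum, map_prod, conj_nrm, hb]

/-- Reversing the frequencies gives a factor (−1)^{c t} per slot, which is the parity of the
corresponding variable. -/
lemma wordKer_negJ (i : Fin 2) {p : ℕ} {b : (Fin p → Vars) → ℂ} {s : ℂ}
    (hb : ∀ c : Fin p → Vars, b c ≠ 0 → ∏ t, sgV (c t) = s) (J : Fin p → Idx) :
    wordKer i b (negJ J) = s * wordKer i b J := by
  unfold wordKer negJ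
  rw [mul_left_comm, Finset.mul_sum _ _ s]
  congr 1
  refine Finset.sum_congr rfl fun c _ => ?_
  by_cases h0 : b (fun t => var (c t) ((J t).1 + i)) = 0
  · simp [h0]
  · have h1 := hb _ h0
    simp only [sgV_var] at h1
    rw [← h1, mul_left_comm, ← Finset.prod_mul_distrib]
    congr 1
    refine Finset.prod_congr rfl fun t _ => ?_
    rw [← mul_pow]
    congr 1
    push_cast; ring

/-- The values of the variables `var l ε` at the point `x`. -/
def varVal (i : Fin 2) (U : Fn2) (x : ℝ) : Vars → ℂ :=
  Sum.elim (fun l => evalFn (dx^[(l : ℕ)] (U (0 + i))) x)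
    (fun l => evalFn (dx^[(l : ℕ)] (U (1 + i))) x)

lemma varVal_var (i : Fin 2) (U : Fn2) (x : ℝ) (l : Fin 3) (ε : Fin 2) :
    varVal i U x (var l ε) = evalFn (dx^[(l : ℕ)] (U (ε + i))) x := by
  fin_cases ε <;> rfl

lemma dx_iterate_apply (l : ℕ) (u : Fn) (j : ℤ) : (dx^[l] u) j = (Complex.I * j) ^ l * u j := by
  induction l with
  | zero => simp
  | succ l ih => rw [Function.iterate_succ_apply', dx, ih]; ring

lemma hasSum_varVal {U : Fn2} (hU : MemW (wt2 2) (un U)) (x : ℝ) (l : Fin 3) (ε : Fin 2) :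
    HasSum (fun J : Idx => if J.1 = ε then
      nrm * ((Complex.I * J.2) ^ (l : ℕ) * un U J * Complex.exp (Complex.I * J.2 * x)) else 0)
      (evalFn (dx^[(l : ℕ)] (U ε)) x) := by
  have hinj : Function.Injective fun j : ℤ => ((ε, j) : Idx) := fun a b h => (Prod.ext_iff.1 h).2
  rw [← hinj.hasSum_iff]
  · have hm : MemW (wt1 0) (dx^[(l : ℕ)] (U ε)) :=
      (MemW.dx_iterate ((un_memW_iff.1 hU ε).wt1_mono (by
        have : (l : ℕ) ≤ 2 := by omega
        exact_mod_cast this))).1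
    have h := (summable_evalFn hm x).hasSum.mul_left nrm
    refine Eq.subst (motive := fun f : ℤ → ℂ => HasSum f _) (funext fun j => ?_) h
    simp [dx_iterate_apply, un]
  · rintro ⟨ε', j⟩ hl
    exact if_neg fun h => hl ⟨j, by simp only at h; rw [h]⟩

/-- A product of absolutely convergent Fourier series is summed over multi-indices; the exponentials
multiply to the one of the total frequency. -/
lemma evalFn_wordKer {p : ℕ} (hp : 0 < p) (i : Fin 2) (b : (Fin p → Vars) → ℂ) {U : Fn2}
    (hU : MemW (wt2 2) (un U)) (x : ℝ) :
    evalFn (mulT (wordKer i b) fun _ => un U) x =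
      ∑ c : Fin p → Vars, b c * ∏ t, varVal i U x (c t) := by
  obtain ⟨C, hC⟩ := kerBdd_wordKer i b
  have h1 := hasSum_evalFn_mulT (hC.summable_norm hp fun _ => hU) x
  have h2 : ∀ c : Fin p → Fin 3 × Fin 2, HasSum (fun J : Fin p → Idx =>
      b (fun t => var (c t).1 (c t).2) * tens (fun t (J : Idx) => if J.1 = (c t).2 + i then
        nrm * ((Complex.I * J.2) ^ ((c t).1 : ℕ) * un U J * Complex.exp (Complex.I * J.2 * x))
        else 0) J)
      (b (fun t => var (c t).1 (c t).2) * ∏ t, varVal i U x (var (c t).1 (c t).2)) := by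
    intro c
    have h3 : ∀ t, HasSum _ _ := fun t => hasSum_varVal hU x (c t).1 ((c t).2 + i)
    have h4 := hasSum_tens (fun t (J : Idx) => if J.1 = (c t).2 + i then
        nrm * ((Complex.I * J.2) ^ ((c t).1 : ℕ) * un U J * Complex.exp (Complex.I * J.2 * x))
        else 0) fun t => (h3 t).summable.norm
    rw [Finset.prod_congr rfl fun t _ => (h3 t).tsum_eq] at h4
    simp only [varVal_var]
    exact h4.mul_left _
  have h5 := hasSum_sum fun c (_ : c ∈ (Finset.univ : Finset (Fin p → Fin 3 × Fin 2))) => h2 c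
  have h6 : ∑ c : Fin p → Vars, b c * ∏ t, varVal i U x (c t) =
      ∑ c : Fin p → Fin 3 × Fin 2,
        b (fun t => var (c t).1 (c t).2) * ∏ t, varVal i U x (var (c t).1 (c t).2) :=
    (Fintype.sum_equiv ((Equiv.refl _).arrowCongr varEquiv) _ _ fun c => rfl).symm
  rw [h6]
  refine h1.unique (Eq.subst (motive := fun f : (Fin p → Idx) → ℂ => HasSum f _)
    (funext fun J => ?_) h5)
  rw [← (Equiv.arrowProdEquivProdArrow (Fin p) (fun _ => Fin 3) (fun _ => Fin 2)).symm.sum_comp,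
    Fintype.sum_prod_type]
  have hn : nrm ^ p = nrm * nrm ^ (p - 1) := by
    rw [← pow_succ', Nat.sub_add_cancel hp]
  have hexp : Complex.exp (Complex.I * frq J * x) =
      ∏ t, Complex.exp (Complex.I * (J t).2 * x) := by
    rw [← Complex.exp_sum]
    unfold frq
    push_cast
    rw [Finset.mul_sum, Finset.sum_mul]
  unfold wordKer
  have h7 : ∀ c : Fin p → Fin 3, (∑ ε : Fin p → Fin 2,
      b (fun t => var (c t) (ε t)) * tens (fun t (J : Idx) => if J.1 = ε t + i then
        nrm * ((Complex.I * J.2) ^ (c t : ℕ) * un U J * Complex.exp (Complex.I * J.2 * x))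
        else 0) J) =
      nrm * nrm ^ (p - 1) * (b (fun t => var (c t) ((J t).1 + i)) *
        ∏ t, (Complex.I * (J t).2) ^ (c t : ℕ)) * tens (fun _ => un U) J *
        Complex.exp (Complex.I * frq J * x) := by
    intro c
    have hii : ∀ a : Fin 2, a + i + i = a := by intro a; fin_cases a <;> fin_cases i <;> rfl
    -- Once the components of J are fixed, a single choice between u and conj u in each slot gives a
    -- nonzero term.
    rw [Finset.sum_eq_single fun t => (J t).1 + i]
    · have h8 : tens (fun t (K : Idx) => if K.1 = (J t).1 + i + i then
          nrm * ((Complex.I * K.2) ^ (c t : ℕ) * un U K * Complex.exp (Complex.I * K.2 * x))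
          else 0) J = ∏ t, nrm * ((Complex.I * (J t).2) ^ (c t : ℕ) * un U (J t) *
            Complex.exp (Complex.I * (J t).2 * x)) :=
        Finset.prod_congr rfl fun t _ => if_pos (hii _).symm
      rw [h8, Finset.prod_mul_distrib, Finset.prod_mul_distrib, Finset.prod_mul_distrib, hexp,
        Finset.prod_const, Finset.card_univ, Fintype.card_fin, hn]
      unfold tens
      ring
    · intro ε _ hε
      obtain ⟨t, ht⟩ := Function.ne_iff.1 hε
      have h8 : tens (fun t (J : Idx) => if J.1 = ε t + i then
          nrm * ((Complex.I * J.2) ^ (c t : ℕ) * un U J * Complex.exp (Complex.I * J.2 * x))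
          else 0) J = 0 := by
        refine Finset.prod_eq_zero (Finset.mem_univ t) (if_neg fun h => ht ?_)
        rw [h, hii]
      rw [h8, mul_zero]
    · intro h; exact absurd (Finset.mem_univ _) h
  refine (Finset.sum_congr rfl fun c _ => h7 c).trans ?_
  rw [← Finset.sum_mul, ← Finset.sum_mul, ← Finset.mul_sum]
  ring

/-! ### The kernels of the paralinearization -/

/-- The kernel of the homogeneous part of degree `q + 1` of the nonlinearity. -/
def mainKer (P : MvPolynomial Vars ℂ) (i : Fin 2) (q : ℕ) : (Fin (q + 1) → Idx) → ℂ :=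
  wordKer i (wordCoeff P)

/-- The kernel of the coefficient of `(iξ)^l` in the paradifferential symbol. -/
def symB (P : MvPolynomial Vars ℂ) (i e : Fin 2) (q : ℕ) (l : Fin 3) (J : Fin q → Idx) : ℂ :=
  -- L is the number of derivatives on the last slot. The binomial formula for (iξ − i·frq/2)^L
  -- gives the coefficient of (iξ)^l; for l > L the binomial coefficient vanishes, so the truncated
  -- exponent is harmless.
  ((q : ℂ) + 1) * ∑ L : Fin 3, ((L : ℕ).choose l : ℂ) *
    (-(Complex.I * frq J / 2)) ^ ((L : ℕ) - l) *
      wordKer i (fun c : Fin q → Vars => wordCoeff P (Fin.snoc c (var L (e + i)) : Fin (q + 1) → Vars)) J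

lemma add_pow_fin_three (x y : ℂ) (L : Fin 3) :
    (x + y) ^ (L : ℕ) = ∑ l : Fin 3, ((L : ℕ).choose l : ℂ) * y ^ ((L : ℕ) - l) * x ^ (l : ℕ) := by
  fin_cases L <;> simp [Fin.sum_univ_three] <;> ring

/-- In the last slot i·j = iξ − i·frq/2 with ξ the Weyl frequency, so the powers of ij are
polynomials in iξ with coefficients depending on the other slots only. The identity is exact. -/
lemma isWeylCoeff_symB (P : MvPolynomial Vars ℂ) (i e : Fin 2) {q : ℕ} (hq : 1 ≤ q) :
    IsWeylCoeff e (symB P i e q) (mainKer P i q) := by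
  intro J hJ
  set J' : Fin q → Idx := fun t => J t.castSucc with hJ'
  have hx : ∀ L : Fin 3, (Complex.I * (J (Fin.last q)).2) ^ (L : ℕ) =
      ∑ l : Fin 3, ((L : ℕ).choose l : ℂ) * (-(Complex.I * frq J' / 2)) ^ ((L : ℕ) - l) *
        xiPow l (weylXi J) := by
    intro L
    have h1 : Complex.I * ((J (Fin.last q)).2 : ℂ) =
        Complex.I * (weylXi J : ℂ) + -(Complex.I * frq J' / 2) := by
      have h2 : (weylXi J : ℂ) = (J (Fin.last q)).2 + (frq J' : ℂ) / 2 := by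
        unfold weylXi; push_cast; rfl
      rw [h2]; ring
    rw [h1, add_pow_fin_three]
    rfl
  unfold mainKer wordKer
  rw [← (snocEquiv q (Fin 3)).sum_comp, Fintype.sum_prod_type_right]
  have h3 : ∀ (L : Fin 3) (c : Fin q → Fin 3),
      wordCoeff P (fun t => var ((Fin.snoc c L : Fin (q + 1) → Fin 3) t) ((J t).1 + i)) =
      wordCoeff P (Fin.snoc (fun t => var (c t) ((J' t).1 + i)) (var L (e + i)) :
        Fin (q + 1) → Vars) := by
    intro L c
    congr 1
    funext t
    refine Fin.lastCases ?_ (fun t => ?_) t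
    · simp [hJ]
    · simp [hJ']
  simp only [h3, Fin.prod_univ_castSucc, snocEquiv_apply, Fin.snoc_castSucc, Fin.snoc_last, hx]
  unfold symB wordKer
  -- The normalisation missing from the q-linear kernel is the one supplied by the Weyl
  -- quantization; q ≥ 1 keeps the exponent q − 1 from being truncated.
  have hn : nrm ^ (q + 1 - 1) = nrm * nrm ^ (q - 1) := by
    rw [← pow_succ', Nat.sub_add_cancel hq]; rfl
  rw [hn]
  simp only [Finset.mul_sum, Finset.sum_mul]
  rw [Finset.sum_comm]
  refine Finset.sum_congr rfl fun L _ => ?_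
  rw [Finset.sum_comm]
  refine Finset.sum_congr rfl fun c _ => Finset.sum_congr rfl fun l _ => ?_
  simp only [hJ']
  ring

lemma abs_frq_le {q : ℕ} (J : Fin q → Idx) : |(frq J : ℝ)| ≤ q * ∏ t, jb (J t).2 := by
  unfold frq
  push_cast
  refine (Finset.abs_sum_le_sum_abs _ _).trans ?_
  have h : ∀ t ∈ (Finset.univ : Finset (Fin q)), |((J t).2 : ℝ)| ≤ ∏ t, jb (J t).2 := by
    intro t _
    rw [← Finset.mul_prod_erase _ _ (Finset.mem_univ t)]
    refine (abs_le_jb _).trans (le_mul_of_one_le_right (jb_nonneg _) ?_)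
    calc (1 : ℝ) = ∏ _t ∈ Finset.univ.erase t, (1 : ℝ) := by simp
      _ ≤ _ := Finset.prod_le_prod (fun _ _ => zero_le_one) fun _ _ => one_le_jb _
  refine (Finset.sum_le_sum h).trans_eq ?_
  simp

lemma exists_kerBdd_mainKer (P : MvPolynomial Vars ℂ) (i : Fin 2) :
    ∃ C : ℕ → ℝ, ∀ q, KerBdd (mainKer P i q) 2 (C q) := by
  choose C hC using fun q => kerBdd_wordKer i (wordCoeff P (p := q + 1))
  exact ⟨C, hC⟩

lemma norm_freq_pow_le {q : ℕ} (J : Fin q → Idx) (n : ℕ) (hn : n ≤ 2) :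
    ‖(-(Complex.I * frq J / 2)) ^ n‖ ≤ ((q : ℝ) + 1) ^ 2 * ∏ t, wt2 2 (J t) := by
  have h1 : (1 : ℝ) ≤ ∏ t, jb (J t).2 := by
    calc (1 : ℝ) = ∏ _t : Fin q, (1 : ℝ) := by simp
      _ ≤ _ := Finset.prod_le_prod (fun _ _ => zero_le_one) fun _ _ => one_le_jb _
  have h2 : ‖-(Complex.I * frq J / 2)‖ ≤ ((q : ℝ) + 1) * ∏ t, jb (J t).2 := by
    rw [norm_neg, norm_div, norm_mul, Complex.norm_I, one_mul, Complex.norm_intCast,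
      RCLike.norm_two]
    have := abs_frq_le J
    have := abs_nonneg (frq J : ℝ)
    linarith
  have h3 : (1 : ℝ) ≤ ((q : ℝ) + 1) * ∏ t, jb (J t).2 := by
    have : (0 : ℝ) ≤ (q : ℝ) := Nat.cast_nonneg q
    nlinarith
  have h4 : ∏ t, wt2 2 (J t) = (∏ t, jb (J t).2) ^ 2 := by
    rw [← Finset.prod_pow]
    exact Finset.prod_congr rfl fun t _ => Real.rpow_two _
  rw [norm_pow, h4, ← mul_pow]
  exact (pow_le_pow_left₀ (norm_nonneg _) h2 n).trans (pow_le_pow_right₀ h3 hn)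

/-- The exponent 4 is 2 for the derivatives in each slot plus 2 for the powers of the total
frequency coming from the Weyl shift. -/
lemma exists_kerBdd_symB (P : MvPolynomial Vars ℂ) (i e : Fin 2) :
    ∃ C : ℕ → ℝ, ∀ q l, KerBdd (symB P i e q l) 4 (C q) := by
  choose C hC using fun (q : ℕ) (L : Fin 3) => kerBdd_wordKer i
    (fun c : Fin q → Vars => wordCoeff P (Fin.snoc c (var L (e + i)) : Fin (q + 1) → Vars))
  refine ⟨fun q => ((q : ℝ) + 1) * ∑ L, 2 * ((q : ℝ) + 1) ^ 2 * C q L, fun q l =>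
    ⟨by norm_num, mul_nonneg (by positivity) (Finset.sum_nonneg fun L _ =>
      mul_nonneg (by positivity) (hC q L).const_nonneg), fun J => ?_⟩⟩
  unfold symB
  have hq : ‖(q : ℂ) + 1‖ = (q : ℝ) + 1 := by
    rw [← Nat.cast_succ, Complex.norm_natCast, Nat.cast_succ]
  rw [norm_mul, hq, mul_assoc, Finset.sum_mul]
  refine mul_le_mul_of_nonneg_left ((norm_sum_le _ _).trans (Finset.sum_le_sum fun L _ => ?_))
    (by positivity)
  have hch : ‖((L : ℕ).choose l : ℂ)‖ ≤ 2 := by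
    rw [Complex.norm_natCast]
    have : (L : ℕ).choose l ≤ 2 := by fin_cases L <;> fin_cases l <;> decide
    exact_mod_cast this
  have h4 : ∏ t, wt2 4 (J t) = (∏ t, wt2 2 (J t)) * ∏ t, wt2 2 (J t) := by
    rw [← Finset.prod_mul_distrib]
    refine Finset.prod_congr rfl fun t _ => ?_
    unfold wt2
    rw [← Real.rpow_add (jb_pos _)]; norm_num
  rw [norm_mul, norm_mul, h4]
  have hp := (prod_wt2_pos Finset.univ 2 J).le
  calc _ ≤ 2 * (((q : ℝ) + 1) ^ 2 * ∏ t, wt2 2 (J t)) * (C q L * ∏ t, wt2 2 (J t)) := by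
        refine mul_le_mul (mul_le_mul hch (norm_freq_pow_le J _ (by omega)) (norm_nonneg _)
          (by norm_num)) ((hC q L).bound J) (norm_nonneg _) (by positivity)
    _ = _ := by ring

lemma mainKer_comp_perm (P : MvPolynomial Vars ℂ) (i : Fin 2) (q : ℕ) (J : Fin (q + 1) → Idx)
    (e : Equiv.Perm (Fin (q + 1))) : mainKer P i q (J ∘ e) = mainKer P i q J :=
  wordKer_comp_perm i (b := wordCoeff P) (fun c f => wordCoeff_comp_perm P c f) J e

lemma symB_comp_perm (P : MvPolynomial Vars ℂ) (i e : Fin 2) (q : ℕ) (l : Fin 3)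
    (J : Fin q → Idx) (f : Equiv.Perm (Fin q)) : symB P i e q l (J ∘ f) = symB P i e q l J := by
  have h : ∀ L : Fin 3, wordKer i (fun c : Fin q → Vars =>
        wordCoeff P (Fin.snoc c (var L (e + i)) : Fin (q + 1) → Vars)) (J ∘ f) =
      wordKer i (fun c : Fin q → Vars =>
        wordCoeff P (Fin.snoc c (var L (e + i)) : Fin (q + 1) → Vars)) J := fun L => by
    refine wordKer_comp_perm i (fun c f => ?_) J f
    have h1 := snoc_comp_perm c (var L (e + i)) f
    exact (congrArg (wordCoeff P) h1).trans (wordCoeff_comp_perm P _ _)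
  unfold symB
  simp only [frq_comp_perm, h]

lemma mainKer_flipJ (P : MvPolynomial Vars ℂ) (i : Fin 2) (q : ℕ) (J : Fin (q + 1) → Idx) :
    mainKer P i q (flipJ J) = mainKer P (i + 1) q J := wordKer_flipJ i _ J

lemma fin_two_add_one_add_one (e i : Fin 2) : e + 1 + (i + 1) = e + i := by
  fin_cases e <;> fin_cases i <;> rfl

lemma symB_flipJ (P : MvPolynomial Vars ℂ) (i e : Fin 2) (q : ℕ) (l : Fin 3) (J : Fin q → Idx) :
    symB P i e q l (flipJ J) = symB P (i + 1) (e + 1) q l J := by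
  unfold symB
  simp only [frq_flipJ, wordKer_flipJ, fin_two_add_one_add_one]

/-! ### Symmetries of the kernels of an admissible nonlinearity -/

variable {P : MvPolynomial Vars ℂ}

lemma IsAdmissibleNonlinearity.conj_mainKer (hP : IsAdmissibleNonlinearity P) (i : Fin 2) (q : ℕ)
    (J : Fin (q + 1) → Idx) : conj (mainKer P i q (negJ J)) = mainKer P i q J :=
  conj_wordKer_negJ i hP.conj_wordCoeff J

lemma IsAdmissibleNonlinearity.mainKer_negJ (hP : IsAdmissibleNonlinearity P) (i : Fin 2) (q : ℕ)
    (J : Fin (q + 1) → Idx) : mainKer P i q (negJ J) = mainKer P i q J := by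
  unfold mainKer
  rw [wordKer_negJ i (s := 1) (fun c hc => hP.prod_sgV hc) J, one_mul]

lemma IsAdmissibleNonlinearity.conj_symB (hP : IsAdmissibleNonlinearity P) (i e : Fin 2) (q : ℕ)
    (l : Fin 3) (J : Fin q → Idx) : conj (symB P i e q l (negJ J)) = symB P i e q l J := by
  unfold symB
  rw [frq_negJ, map_mul, map_sum, map_add, map_one, Complex.conj_natCast]
  congr 1
  refine Finset.sum_congr rfl fun L _ => ?_
  rw [map_mul, map_mul, conj_wordKer_negJ i fun c => hP.conj_wordCoeff _, map_pow,
    Complex.conj_natCast]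
  simp [map_ofNat]

/-- The removed variable with L derivatives leaves words of parity (−1)^L, and the shift contributes
(−1)^{L−l}. The product (−1)^l compensates the sign of (iξ)^l under ξ ↦ −ξ. -/
lemma IsAdmissibleNonlinearity.symB_negJ (hP : IsAdmissibleNonlinearity P) (i e : Fin 2) (q : ℕ)
    (l : Fin 3) (J : Fin q → Idx) :
    symB P i e q l (negJ J) = (-1) ^ (l : ℕ) * symB P i e q l J := by
  unfold symB
  rw [frq_negJ, mul_left_comm, Finset.mul_sum _ _ ((-1) ^ (l : ℕ))]
  congr 1
  refine Finset.sum_congr rfl fun L _ => ?_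
  rw [wordKer_negJ i (s := (-1) ^ (L : ℕ)) (fun c hc => ?_) J]
  · have h1 : -(Complex.I * ((-frq J : ℤ) : ℂ) / 2) = -1 * -(Complex.I * (frq J : ℂ) / 2) := by
      push_cast; ring
    rw [h1, mul_pow]
    by_cases hl : (l : ℕ) ≤ L
    · have h2 : (-1 : ℂ) ^ ((L : ℕ) - l) * (-1) ^ (L : ℕ) = (-1) ^ (l : ℕ) := by
        obtain ⟨n, hn⟩ := Nat.exists_eq_add_of_le hl
        rw [hn, Nat.add_sub_cancel_left, pow_add, mul_left_comm, ← mul_pow]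
        simp
      linear_combination ((L : ℕ).choose l : ℂ) * (-(Complex.I * (frq J : ℂ) / 2)) ^ ((L : ℕ) - l) *
        wordKer i (fun c : Fin q → Vars =>
          wordCoeff P (Fin.snoc c (var L (e + i)) : Fin (q + 1) → Vars)) J * h2
    · rw [Nat.choose_eq_zero_of_lt (not_le.1 hl)]
      simp
  · have := hP.prod_sgV hc
    rw [Fin.prod_univ_castSucc] at this
    simp only [Fin.snoc_castSucc, Fin.snoc_last, sgV_var] at this
    have h3 : ((-1 : ℂ) ^ (L : ℕ)) * (-1) ^ (L : ℕ) = 1 := by rw [← mul_pow]; simp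
    calc _ = (∏ t, sgV (c t)) * ((-1) ^ (L : ℕ) * (-1) ^ (L : ℕ)) := by rw [h3, mul_one]
      _ = _ := by rw [← mul_assoc, this, one_mul]

/-! ### Real functions -/

lemma conj_evalFn (u : Fn) (x : ℝ) : conj (evalFn u x) = evalFn (conjFn u) x := by
  rw [evalFn_eq, evalFn_eq, map_mul, conj_nrm, Complex.conj_tsum]
  congr 1
  rw [← (Equiv.neg ℤ).tsum_eq]
  refine tsum_congr fun j => ?_
  rw [map_mul, ← Complex.exp_conj]
  simp [conjFn]

lemma dx_conjFn (u : Fn) : dx (conjFn u) = conjFn (dx u) := by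
  funext j
  simp [dx, conjFn]

lemma IsRealPair.conjFn_eq {U : Fn2} (h : IsRealPair U) (e : Fin 2) : conjFn (U e) = U (e + 1) := by
  have := congrFun h e
  fin_cases e <;> exact this.symm

lemma IsRealPair.varVal_zero {U : Fn2} (h : IsRealPair U) (x : ℝ) :
    varVal 0 U x = cpt (evalFn (U 0) x) (evalFn (dx (U 0)) x) (evalFn (dx (dx (U 0))) x) := by
  have h1 : U 1 = conjFn (U 0) := (h.conjFn_eq 0).symm
  funext v
  rcases v with l | l <;> fin_cases l <;>
    simp [varVal, cpt, h1, conj_evalFn, dx_conjFn]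

/-- The words of length 0 and 1 contribute nothing because f vanishes to order two, so q = 0 may be
omitted. -/
lemma IsAdmissibleNonlinearity.sum_evalFn_mainKer (hP : IsAdmissibleNonlinearity P) (i : Fin 2)
    {Q : ℕ} (hQ1 : 1 ≤ Q) (hQ : P.totalDegree ≤ Q) {U : Fn2} (hU : MemW (wt2 2) (un U)) (x : ℝ) :
    ∑ q ∈ Finset.Ico 1 Q, evalFn (mulT (mainKer P i q) fun _ => un U) x =
      MvPolynomial.eval (varVal i U x) P := by
  rw [eval_eq_sum_words P (Nat.lt_succ_of_le hQ), Finset.sum_range_succ']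
  have h0 : ∑ c : Fin 0 → Vars, wordCoeff P c * ∏ t, varVal i U x (c t) = 0 :=
    Finset.sum_eq_zero fun c _ => by rw [hP.wordCoeff_eq_zero (by norm_num), zero_mul]
  have h1 : ∑ c : Fin (0 + 1) → Vars, wordCoeff P c * ∏ t, varVal i U x (c t) = 0 :=
    Finset.sum_eq_zero fun c _ => by rw [hP.wordCoeff_eq_zero (by norm_num), zero_mul]
  rw [h0, add_zero, Finset.range_eq_Ico, Finset.sum_eq_sum_Ico_succ_bot hQ1, h1, zero_add]
  exact Finset.sum_congr rfl fun q _ => evalFn_wordKer (Nat.succ_pos q) i _ hU x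

/-- Only L = l = 2 contributes to (iξ)², without any Weyl correction, so the top coefficient is the
plain derivative in z₂. -/
lemma IsAdmissibleNonlinearity.sum_evalFn_symB_two (hP : IsAdmissibleNonlinearity P)
    {Q : ℕ} (hQ1 : 1 ≤ Q) (hQ : P.totalDegree ≤ Q) {U : Fn2} (hU : MemW (wt2 2) (un U)) (x : ℝ) :
    ∑ q ∈ Finset.Ico 1 Q, evalFn (mulT (symB P 0 0 q 2) fun _ => un U) x =
      MvPolynomial.eval (varVal 0 U x) (MvPolynomial.pderiv (Sum.inl 2) P) := by
  rw [eval_pderiv_eq P (Nat.lt_succ_of_le hQ), Finset.range_eq_Ico,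
    Finset.sum_eq_sum_Ico_succ_bot hQ1]
  have h0 : ∑ c : Fin 0 → Vars, wordCoeff P (Fin.snoc c (Sum.inl 2) : Fin (0 + 1) → Vars) *
      ∏ t, varVal 0 U x (c t) = 0 :=
    Finset.sum_eq_zero fun c _ => by rw [hP.wordCoeff_eq_zero (by norm_num), zero_mul]
  rw [h0, mul_zero, zero_add]
  refine Finset.sum_congr rfl fun q hq => ?_
  have h1 : symB P 0 0 q 2 = fun J => ((q : ℂ) + 1) * wordKer 0
      (fun c : Fin q → Vars => wordCoeff P (Fin.snoc c (Sum.inl 2) : Fin (q + 1) → Vars)) J := by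
    funext J
    unfold symB
    congr 1
    rw [Fin.sum_univ_three]
    simp [Nat.choose, var]
  rw [h1, mulT_smul_ker, evalFn_smul, evalFn_wordKer (Finset.mem_Ico.1 hq).1 0 _ hU x]

/-! ### Symmetries of multilinear Fourier multipliers -/

lemma flipJ_flipJ {p : ℕ} (J : Fin p → Idx) : flipJ (flipJ J) = J := by
  funext t
  refine Prod.ext ?_ rfl
  have h : ∀ a : Fin 2, a + 1 + 1 = a := by decide
  exact h _

lemma negJ_negJ {p : ℕ} (J : Fin p → Idx) : negJ (negJ J) = J := by
  funext t
  exact Prod.ext rfl (neg_neg _)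

/-- `flipJ` as a permutation. -/
def flipEquiv (p : ℕ) : (Fin p → Idx) ≃ (Fin p → Idx) where
  toFun := flipJ
  invFun := flipJ
  left_inv := flipJ_flipJ
  right_inv := flipJ_flipJ

/-- `negJ` as a permutation. -/
def negEquiv (p : ℕ) : (Fin p → Idx) ≃ (Fin p → Idx) where
  toFun := negJ
  invFun := negJ
  left_inv := negJ_negJ
  right_inv := negJ_negJ

lemma flipEquiv_apply {p : ℕ} (J : Fin p → Idx) : flipEquiv p J = flipJ J := rfl

lemma negEquiv_apply {p : ℕ} (J : Fin p → Idx) : negEquiv p J = negJ J := rfl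

lemma swapFn2_apply (U : Fn2) (e : Fin 2) : swapFn2 U e = U (e + 1) := by
  fin_cases e <;> rfl

lemma tens_swapFn2 {p : ℕ} (W : Fin p → Fn2) (J : Fin p → Idx) :
    tens (fun t => un (swapFn2 (W t))) J = tens (fun t => un (W t)) (flipJ J) := by
  refine Finset.prod_congr rfl fun t _ => ?_
  simp [un, swapFn2_apply, flipJ]

/-- Exchanging the components of the arguments is a change of variables in the multi-index, which is
transferred to the kernel; reflection and conjugation are treated likewise below. -/
lemma mulT_swapFn2 {p : ℕ} (𝒦 : (Fin p → Idx) → ℂ) (W : Fin p → Fn2) :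
    mulT 𝒦 (fun t => un (swapFn2 (W t))) =
      mulT (fun J => 𝒦 (flipJ J)) fun t => un (W t) := by
  funext k
  refine ((flipEquiv p).tsum_eq _).symm.trans (tsum_congr fun J => ?_)
  simp only [flipEquiv_apply, frq_flipJ, tens_swapFn2, flipJ_flipJ]

lemma tauFn_mulT {p : ℕ} (𝒦 : (Fin p → Idx) → ℂ) (W : Fin p → Fn2) :
    tauFn (mulT 𝒦 fun t => un (W t)) =
      mulT (fun J => 𝒦 (negJ J)) fun t => un (tauFn2 (W t)) := by
  funext k
  unfold mulT tauFn
  refine ((negEquiv p).tsum_eq _).symm.trans (tsum_congr fun J => ?_)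
  simp only [negEquiv_apply, frq_negJ, neg_inj]
  rfl

lemma conjFn_mulT {p : ℕ} (𝒦 : (Fin p → Idx) → ℂ) (W : Fin p → Fn2) :
    conjFn (mulT 𝒦 fun t => un (W t)) =
      mulT (fun J => conj (𝒦 (negJ J))) fun t => un (conjFn2 (W t)) := by
  funext k
  unfold mulT conjFn
  rw [Complex.conj_tsum]
  refine ((negEquiv p).tsum_eq _).symm.trans (tsum_congr fun J => ?_)
  simp only [negEquiv_apply, frq_negJ, neg_inj, apply_ite (starRingEnd ℂ), map_mul,
    map_zero]
  congr 2
  simp only [tens, map_prod]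
  rfl

lemma IsRealPair.conjFn2_eq {U : Fn2} (h : IsRealPair U) : conjFn2 U = swapFn2 U := h.symm

lemma swapFn2_swapFn2 (U : Fn2) : swapFn2 (swapFn2 U) = U := by
  funext e; fin_cases e <;> rfl

lemma conj_xiPow_neg (l : ℕ) (ξ : ℝ) : conj (xiPow l (-ξ)) = xiPow l ξ := by
  unfold xiPow
  simp

lemma xiPow_neg (l : ℕ) (ξ : ℝ) : xiPow l (-ξ) = (-1) ^ l * xiPow l ξ := by
  unfold xiPow
  rw [← mul_pow]
  congr 1
  push_cast; ring

lemma evalFn_neg (u : Fn) (x : ℝ) : evalFn u (-x) = evalFn (tauFn u) x := by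
  rw [evalFn_eq, evalFn_eq, ← (Equiv.neg ℤ).tsum_eq]
  congr 1
  refine tsum_congr fun j => ?_
  simp [tauFn]

lemma polySym_swap {q : ℕ} (𝒦 : Fin 3 → (Fin q → Idx) → ℂ) (U : Fn2) :
    polySym 𝒦 (fun _ => un (swapFn2 U)) = polySym (fun l J => 𝒦 l (flipJ J)) fun _ => un U := by
  funext x ξ
  unfold polySym
  simp only [mulT_swapFn2 _ fun _ => U]

lemma polySym_neg {q : ℕ} (𝒦 : Fin 3 → (Fin q → Idx) → ℂ) {U : Fn2} (h : tauFn2 U = U)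
    (x ξ : ℝ) : polySym 𝒦 (fun _ => un U) (-x) (-ξ) =
      polySym (fun l J => (-1) ^ (l : ℕ) * 𝒦 l (negJ J)) (fun _ => un U) x ξ := by
  unfold polySym
  simp only [evalFn_neg, tauFn_mulT _ fun _ => U, h, mulT_smul_ker, evalFn_smul, xiPow_neg]
  exact Finset.sum_congr rfl fun l _ => by ring

lemma rowArgs_eq (q : ℕ) (U V : Fn2) :
    rowArgs q U V = fun t => un ((Fin.snoc (fun _ => U) V : Fin (q + 1) → Fn2) t) := by
  funext t
  refine Fin.lastCases ?_ (fun t => ?_) t <;> simp [rowArgs]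

lemma comp_snoc_const {q : ℕ} (F : Fn2 → Fn2) (U V : Fn2) :
    (fun t => F ((Fin.snoc (fun _ => U) V : Fin (q + 1) → Fn2) t)) =
      (Fin.snoc (fun _ => F U) (F V) : Fin (q + 1) → Fn2) := by
  funext t
  refine Fin.lastCases ?_ (fun t => ?_) t <;> simp

lemma mulT_rowArgs_swap {q : ℕ} (𝒦 : (Fin (q + 1) → Idx) → ℂ) (U V : Fn2) :
    mulT 𝒦 (rowArgs q (swapFn2 U) (swapFn2 V)) =
      mulT (fun J => 𝒦 (flipJ J)) (rowArgs q U V) := by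
  rw [rowArgs_eq, rowArgs_eq, ← mulT_swapFn2, ← comp_snoc_const]

lemma tauFn_mulT_rowArgs {q : ℕ} (𝒦 : (Fin (q + 1) → Idx) → ℂ) (U V : Fn2) :
    tauFn (mulT 𝒦 (rowArgs q U V)) =
      mulT (fun J => 𝒦 (negJ J)) (rowArgs q (tauFn2 U) (tauFn2 V)) := by
  rw [rowArgs_eq, rowArgs_eq, tauFn_mulT, ← comp_snoc_const]

lemma conjFn_mulT_rowArgs {q : ℕ} (𝒦 : (Fin (q + 1) → Idx) → ℂ) (U V : Fn2) :
    conjFn (mulT 𝒦 (rowArgs q U V)) =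
      mulT (fun J => conj (𝒦 (negJ J))) (rowArgs q (conjFn2 U) (conjFn2 V)) := by
  rw [rowArgs_eq, rowArgs_eq, conjFn_mulT, ← comp_snoc_const]

/-! ### Expansions with polynomial symbols -/

lemma isSigmaSymbol_polyExp {I : Set ℝ} (hI : IsTimeInterval I) {m : ℝ} {K N Q : ℕ} (hN : 1 ≤ N)
    {r s₀ : ℝ} (hr : 0 < r) {𝒦 : (q : ℕ) → Fin 3 → (Fin q → Idx) → ℂ} {μ : ℝ} {C : ℕ → ℝ}
    (h : ∀ q l, KerBdd (𝒦 q l) μ (C q)) (hm : ∀ q (l : Fin 3), 𝒦 q l = 0 ∨ ((l : ℕ) : ℝ) ≤ m)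
    (hsymm : ∀ q l J (e : Equiv.Perm (Fin q)), 𝒦 q l (J ∘ e) = 𝒦 q l J)
    (hs₀ : 2 * K + μ + 1 ≤ s₀) : IsSigmaSymbol I m K 1 N r s₀ (polyExp N Q 𝒦) :=
  ⟨fun q hq => isHomSymbol_polyHom (Finset.mem_Ico.1 hq).1 (h q) (hm q) (hsymm q),
    IsNonhomSymbol.sum hr _ fun q hq =>
      isNonhomSymbol_polySym hI hN (Finset.mem_Ico.1 hq).1 hr (h q) (hm q) hs₀⟩

lemma polyExp_eval {N Q : ℕ} (hN : 1 ≤ N) (hQ : N ≤ Q)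
    {𝒦 : (q : ℕ) → Fin 3 → (Fin q → Idx) → ℂ} {μ : ℝ} {C : ℕ → ℝ}
    (h : ∀ q l, KerBdd (𝒦 q l) μ (C q)) {U : Fn2} (hU : MemW (wt2 μ) (un U)) (x ξ : ℝ) :
    (polyExp N Q 𝒦).eval 1 N U x ξ =
      ∑ q ∈ Finset.Ico 1 Q, polySym (𝒦 q) (fun _ => un U) x ξ := by
  rw [← Finset.sum_Ico_consecutive _ hN hQ]
  unfold SymExp.eval
  congr 1
  exact Finset.sum_congr rfl fun q hq => polyHom_eval (Finset.mem_Ico.1 hq).1 (h q) hU x ξ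

/-- Only the coefficient of `(iξ)⁰` is kept. -/
def constKer {q : ℕ} (g : (Fin q → Idx) → ℂ) : Fin 3 → (Fin q → Idx) → ℂ := Pi.single 0 g

lemma polySym_constKer {q : ℕ} (g : (Fin q → Idx) → ℂ) (v : Fin q → Idx → ℂ) (x ξ : ℝ) :
    polySym (constKer g) v x ξ = evalFn (mulT g v) x := by
  unfold polySym
  rw [Fin.sum_univ_three]
  have h1 : (constKer g) 1 = 0 := rfl
  have h2 : (constKer g) 2 = 0 := rfl
  have h0 : (constKer g) 0 = g := rfl
  rw [h0, h1, h2, mulT_zero_ker, evalFn_zero]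
  simp [xiPow]

lemma KerBdd.constKer {q : ℕ} {g : (Fin q → Idx) → ℂ} {μ C : ℝ} (h : KerBdd g μ C) (l : Fin 3) :
    KerBdd (ParaNLS.constKer g l) μ C := by
  fin_cases l
  · exact h
  · exact ⟨h.exp_nonneg, h.const_nonneg, fun J => by
      have : ‖ParaNLS.constKer g 1 J‖ = 0 := norm_zero
      refine this.trans_le (mul_nonneg h.const_nonneg (prod_wt2_pos _ _ _).le)⟩
  · exact ⟨h.exp_nonneg, h.const_nonneg, fun J => by
      have : ‖ParaNLS.constKer g 2 J‖ = 0 := norm_zero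
      refine this.trans_le (mul_nonneg h.const_nonneg (prod_wt2_pos _ _ _).le)⟩

lemma constKer_cases {q : ℕ} (g : (Fin q → Idx) → ℂ) (l : Fin 3) :
    constKer g l = 0 ∨ ((l : ℕ) : ℝ) ≤ 0 := by
  fin_cases l
  · right; simp
  · left; rfl
  · left; rfl

lemma constKer_comp_perm {q : ℕ} {g : (Fin q → Idx) → ℂ}
    (h : ∀ J (e : Equiv.Perm (Fin q)), g (J ∘ e) = g J) (l : Fin 3) (J : Fin q → Idx)
    (e : Equiv.Perm (Fin q)) : constKer g l (J ∘ e) = constKer g l J := by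
  fin_cases l
  · exact h J e
  · rfl
  · rfl

lemma isSigmaFunction_polyExp {I : Set ℝ} (hI : IsTimeInterval I) {K N Q : ℕ} (hN : 1 ≤ N)
    {r s₀ : ℝ} (hr : 0 < r) {g : (q : ℕ) → (Fin q → Idx) → ℂ} {μ : ℝ} {C : ℕ → ℝ}
    (h : ∀ q, KerBdd (g q) μ (C q))
    (hsymm : ∀ q J (e : Equiv.Perm (Fin q)), g q (J ∘ e) = g q J)
    (hs₀ : 2 * K + μ + 1 ≤ s₀) :
    IsSigmaFunction I K 1 N r s₀ (polyExp N Q fun q => constKer (g q)) := by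
  refine ⟨isSigmaSymbol_polyExp hI hN hr (fun q l => (h q).constKer l)
    (fun q l => constKer_cases _ l) (fun q l J e => constKer_comp_perm (hsymm q) l J e) hs₀,
    fun q hq U x ξ η => ?_, fun U _ _ x ξ η => ?_⟩
  · change polyHom q _ U x ξ = polyHom q _ U x η
    rw [polyHom_apply (Finset.mem_Ico.1 hq).1 fun l => (h q).constKer l]
    simp only [polySym_constKer]
  · simp only [polyExp, polySym_constKer]

/-- The smoothing remainder acting on the component `e`. -/
def smoothExp (N Q : ℕ) (e : Fin 2) (𝒦 : (q : ℕ) → (Fin (q + 1) → Idx) → ℂ) : OpExp where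
  hom q := opHom q e (𝒦 q)
  rem V u := ∑ q ∈ Finset.Ico N Q, mulT (𝒦 q) (opArgs q e V u)

lemma smoothExp_eval {N Q : ℕ} (hN : 1 ≤ N) (hQ : N ≤ Q) (e : Fin 2)
    {𝒦 : (q : ℕ) → (Fin (q + 1) → Idx) → ℂ} {μ : ℝ} {C : ℕ → ℝ}
    (h : ∀ q, 1 ≤ q → KerBdd (𝒦 q) μ (C q))
    {U : Fn2} {u : Fn} (hU : MemW (wt2 μ) (un U)) (hu : MemW (wt1 μ) u) :
    (smoothExp N Q e 𝒦).eval 1 N U u = ∑ q ∈ Finset.Ico 1 Q, mulT (𝒦 q) (opArgs q e U u) := by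
  rw [← Finset.sum_Ico_consecutive _ hN hQ]
  unfold OpExp.eval
  congr 1
  exact Finset.sum_congr rfl fun q hq => opHom_eval e (h q (Finset.mem_Ico.1 hq).1) hU hu

lemma isSigmaSmoothing_smoothExp {I : Set ℝ} (hI : IsTimeInterval I) {ρ : ℝ} (hρ : 0 < ρ)
    {K N Q : ℕ} (hN : 1 ≤ N) {r s₀ : ℝ} (e : Fin 2) {𝒦 : (q : ℕ) → (Fin (q + 1) → Idx) → ℂ}
    {μ : ℝ} {C R : ℕ → ℝ} (h : ∀ q, 1 ≤ q → KerBdd (𝒦 q) μ (C q)) (hR : ∀ q, 1 ≤ R q)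
    (hc : ∀ q, 1 ≤ q → Comparable (𝒦 q) (R q))
    (hsymm : ∀ q J (e : Equiv.Perm (Fin (q + 1))), 𝒦 q (J ∘ e) = 𝒦 q J)
    (hs₀ : 2 * K + 2 * μ + ρ + 2 ≤ s₀) :
    IsSigmaSmoothing I ρ K 1 N r s₀ (smoothExp N Q e 𝒦) := by
  have hsum : IsStrongSmoothing I ρ K N r s₀ (smoothExp N Q e 𝒦).rem :=
    IsStrongSmoothing.sum hI (Finset.Ico N Q)
      (R := fun q V u => mulT (𝒦 q) (opArgs q e V u)) fun q hq => by
        have hq1 := (Finset.mem_Ico.1 hq).1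
        exact isStrongSmoothing_mulT hI hρ hN hq1 e (h q (hN.trans hq1)) (hR q)
          (hc q (hN.trans hq1)) hs₀
  refine ⟨fun q hq => ?_, hsum.isNonhomSmoothing⟩
  have hq1 := (Finset.mem_Ico.1 hq).1
  exact isHomSmoothing_opHom hρ e (h q hq1) (hR q) (hc q hq1) (hsymm q)

lemma matOp_smoothExp {N Q : ℕ} (hN : 1 ≤ N) (hQ : N ≤ Q)
    {𝒦 : Fin 2 → (q : ℕ) → (Fin (q + 1) → Idx) → ℂ} {μ : ℝ} {C : Fin 2 → ℕ → ℝ}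
    (h : ∀ i q, 1 ≤ q → KerBdd (𝒦 i q) μ (C i q)) {U V : Fn2} {s : ℝ} (hs : μ + 1 ≤ s)
    (hU : MemHs2 s U) (hV : MemHs2 s V) (i : Fin 2) :
    matOp 1 N (Matrix.of fun i e => smoothExp N Q e (𝒦 i)) U V i =
      ∑ q ∈ Finset.Ico 1 Q, mulT (𝒦 i q) (rowArgs q U V) := by
  unfold matOp
  simp only [Matrix.of_apply]
  rw [Finset.sum_congr rfl fun e _ => smoothExp_eval hN hQ e (h i) (hU.memW hs).1
    ((hV e).memW hs).1, Finset.sum_comm]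
  refine Finset.sum_congr rfl fun q hq => sum_mulT_opArgs ?_
  exact (h i q (Finset.mem_Ico.1 hq).1).summable_norm (Nat.succ_pos q) (rowArgs_memW hs hU hV)

/-! ### The paralinearized system -/

/-- The matrix of paradifferential symbols. -/
def paraSym (P : MvPolynomial Vars ℂ) (N Q : ℕ) : Matrix (Fin 2) (Fin 2) SymExp :=
  Matrix.of fun i e => polyExp N Q (symB P i e)

/-- The coefficient of `(iξ)^l` in the matrix of symbols. -/
def paraCoef (P : MvPolynomial Vars ℂ) (N Q : ℕ) (l : Fin 3) : Matrix (Fin 2) (Fin 2) SymExp :=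
  Matrix.of fun i e => polyExp N Q fun q => constKer (symB P i e q l)

/-- The kernels of the smoothing remainder. -/
def remKer (χ : Cutoffs) (P : MvPolynomial Vars ℂ) (N : ℕ) (i : Fin 2) (q : ℕ) :
    (Fin (q + 1) → Idx) → ℂ := smoothKer (cutAt χ N q) (mainKer P i q)

/-- The matrix of smoothing remainders. -/
def paraOp (χ : Cutoffs) (P : MvPolynomial Vars ℂ) (N Q : ℕ) : Matrix (Fin 2) (Fin 2) OpExp :=
  Matrix.of fun i e => smoothExp N Q e (remKer χ P N i)

lemma MemHs2.swap {s : ℝ} {U : Fn2} (h : MemHs2 s U) : MemHs2 s (swapFn2 U) := fun i => by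
  rw [swapFn2_apply]; exact h _

lemma MemHs.tau {s : ℝ} {u : Fn} (h : MemHs s u) : MemHs s (tauFn u) := by
  unfold MemHs at *
  rw [← (Equiv.neg ℤ).summable_iff] at h
  refine h.congr fun j => ?_
  simp [tauFn, jb_neg]

lemma MemHs.conj {s : ℝ} {u : Fn} (h : MemHs s u) : MemHs s (conjFn u) := by
  refine Summable.congr h.tau fun j => ?_
  simp [tauFn, conjFn]

/-! ### Reality, reversibility and parity of the symbols, and their expansion in powers of iξ -/

section Symbols

variable {P : MvPolynomial Vars ℂ} {N Q : ℕ} {U : Fn2}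

lemma matEval_paraSym (hN : 1 ≤ N) (hQ : N ≤ Q) (hU : MemW (wt2 4) (un U)) (x ξ : ℝ)
    (i e : Fin 2) : matEval 1 N (paraSym P N Q) U x ξ i e =
      ∑ q ∈ Finset.Ico 1 Q, polySym (symB P i e q) (fun _ => un U) x ξ := by
  obtain ⟨C, hC⟩ := exists_kerBdd_symB P i e
  exact polyExp_eval hN hQ hC hU x ξ

lemma matEval_paraCoef (hN : 1 ≤ N) (hQ : N ≤ Q) (hU : MemW (wt2 4) (un U)) (l : Fin 3)
    (x ξ : ℝ) (i e : Fin 2) : matEval 1 N (paraCoef P N Q l) U x ξ i e =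
      ∑ q ∈ Finset.Ico 1 Q, evalFn (mulT (symB P i e q l) fun _ => un U) x := by
  obtain ⟨C, hC⟩ := exists_kerBdd_symB P i e
  simp only [← polySym_constKer _ _ x ξ]
  exact polyExp_eval hN hQ (fun q => (hC q l).constKer) hU x ξ

lemma IsAdmissibleNonlinearity.conj_evalFn_symB (hP : IsAdmissibleNonlinearity P)
    (h : IsRealPair U) (i e : Fin 2) (q : ℕ) (l : Fin 3) (x : ℝ) :
    conj (evalFn (mulT (symB P i e q l) fun _ => un U) x) =
      evalFn (mulT (symB P (i + 1) (e + 1) q l) fun _ => un U) x := by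
  simp only [conj_evalFn, conjFn_mulT _ fun _ => U, h.conjFn2_eq, mulT_swapFn2 _ fun _ => U,
    hP.conj_symB, symB_flipJ]

lemma swapMat_mul_apply (A : Matrix (Fin 2) (Fin 2) ℂ) (i e : Fin 2) :
    (swapMat * A) i e = A (i + 1) e := by
  fin_cases i <;> simp [swapMat, Matrix.mul_apply, Fin.sum_univ_two]

lemma mul_swapMat_apply (A : Matrix (Fin 2) (Fin 2) ℂ) (i e : Fin 2) :
    (A * swapMat) i e = A i (e + 1) := by
  fin_cases e <;> simp [swapMat, Matrix.mul_apply, Fin.sum_univ_two]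

/-- Multiplication by S on the left or right shifts the row or column index by one. The three
properties then become the behaviour of `symB` under conjugation with reversal, under `flipJ` and
under `negJ`. -/
lemma isRRPSymbol_paraSym (hP : IsAdmissibleNonlinearity P) (hN : 1 ≤ N) (hQ : N ≤ Q) {s r : ℝ}
    (hs : 5 ≤ s) : IsRRPSymbol s r (matEval 1 N (paraSym P N Q)) where
  reality U hU x ξ := by
    have hm := (hU.1.memW (σ := 4) (by linarith)).1
    ext i e
    rw [Matrix.map_apply, mul_swapMat_apply, swapMat_mul_apply, matEval_paraSym hN hQ hm,
      matEval_paraSym hN hQ hm, map_sum]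
    refine Finset.sum_congr rfl fun q _ => ?_
    unfold polySym
    simp only [map_sum, map_mul, conj_xiPow_neg, hP.conj_evalFn_symB hU.2.2]
  reversibility U hU x ξ := by
    have hm := (hU.1.memW (σ := 4) (by linarith)).1
    have hm' := (hU.1.swap.memW (σ := 4) (by linarith)).1
    ext i e
    rw [mul_swapMat_apply, swapMat_mul_apply, matEval_paraSym hN hQ hm,
      matEval_paraSym hN hQ hm']
    refine Finset.sum_congr rfl fun q _ => ?_
    have he : e + 1 + 1 = e := by revert e; decide
    rw [polySym_swap]
    simp only [symB_flipJ, he]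
  parity U hU hτ x ξ := by
    have hm := (hU.1.memW (σ := 4) (by linarith)).1
    ext i e
    rw [matEval_paraSym hN hQ hm, matEval_paraSym hN hQ hm]
    refine Finset.sum_congr rfl fun q _ => ?_
    rw [polySym_neg _ hτ]
    congr 1
    funext l J
    rw [hP.symB_negJ, ← mul_assoc, ← mul_pow]
    simp

lemma paraCoef_conj (hP : IsAdmissibleNonlinearity P) (hN : 1 ≤ N) (hQ : N ≤ Q)
    (hU : MemW (wt2 4) (un U)) (h : IsRealPair U) (l : Fin 3) (x ξ : ℝ) (i e : Fin 2) :
    matEval 1 N (paraCoef P N Q l) U x ξ (i + 1) (e + 1) =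
      star (matEval 1 N (paraCoef P N Q l) U x ξ i e) := by
  rw [matEval_paraCoef hN hQ hU, matEval_paraCoef hN hQ hU]
  change _ = conj _
  rw [map_sum]
  simp only [hP.conj_evalFn_symB h]

/-- On real pairs the coefficient is the Wirtinger derivative of f in z₂ at (u, u_x, u_xx). -/
lemma paraCoef_two_im (hP : IsAdmissibleNonlinearity P) (hN : 1 ≤ N) (hQ : N ≤ Q)
    (hdeg : P.totalDegree ≤ Q) (hU : MemW (wt2 4) (un U)) (h : IsRealPair U) (x ξ : ℝ) :
    (matEval 1 N (paraCoef P N Q 2) U x ξ 0 0).im = 0 := by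
  rw [matEval_paraCoef hN hQ hU,
    hP.sum_evalFn_symB_two (hN.trans hQ) hdeg (hU.wt2_mono (by norm_num)), h.varVal_zero,
    ← wirtinger_polyFun]
  exact hP.schrodinger _ _ _

lemma paraSym_hom_eq (i e : Fin 2) {q : ℕ} (hq : 1 ≤ q) (U : Fin q → CInf2) (x ξ : ℝ) :
    (paraSym P N Q i e).hom q U x ξ =
      ∑ l : Fin 3, (paraCoef P N Q l i e).hom q U x ξ * (Complex.I * ξ) ^ (l : ℕ) := by
  obtain ⟨C, hC⟩ := exists_kerBdd_symB P i e
  have h1 : (paraSym P N Q i e).hom q U x ξ =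
      polySym (symB P i e q) (fun t => un (U t).toFn2) x ξ :=
    congrFun (congrFun (polyHom_apply hq (hC q) U) x) ξ
  have h2 : ∀ l, (paraCoef P N Q l i e).hom q U x ξ =
      evalFn (mulT (symB P i e q l) fun t => un (U t).toFn2) x := fun l => by
    rw [← polySym_constKer _ _ x ξ]
    exact congrFun (congrFun (polyHom_apply hq (fun l' => (hC q l).constKer l') U) x) ξ
  rw [h1]
  simp only [h2]
  rfl

lemma paraSym_rem_eq (i e : Fin 2) (U : Fn2) (x ξ : ℝ) :
    (paraSym P N Q i e).rem U x ξ =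
      ∑ l : Fin 3, (paraCoef P N Q l i e).rem U x ξ * (Complex.I * ξ) ^ (l : ℕ) := by
  simp only [paraSym, paraCoef, Matrix.of_apply, polyExp, polySym_constKer, Finset.sum_mul]
  rw [Finset.sum_comm]
  rfl

lemma isSigmaSymbol_paraSym {I : Set ℝ} (hI : IsTimeInterval I) {K : ℕ} (hN : 1 ≤ N) {r s₀ : ℝ}
    (hr : 0 < r) (hs₀ : 2 * K + 5 ≤ s₀) (i e : Fin 2) :
    IsSigmaSymbol I 2 K 1 N r s₀ (paraSym P N Q i e) := by
  obtain ⟨C, hC⟩ := exists_kerBdd_symB P i e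
  refine isSigmaSymbol_polyExp hI hN hr hC (fun q l => Or.inr ?_)
    (fun q l J f => symB_comp_perm P i e q l J f) (by linarith)
  have : (l : ℕ) ≤ 2 := by omega
  exact_mod_cast this

lemma isSigmaFunction_paraCoef {I : Set ℝ} (hI : IsTimeInterval I) {K : ℕ} (hN : 1 ≤ N)
    {r s₀ : ℝ} (hr : 0 < r) (hs₀ : 2 * K + 5 ≤ s₀) (l : Fin 3) (i e : Fin 2) :
    IsSigmaFunction I K 1 N r s₀ (paraCoef P N Q l i e) := by
  obtain ⟨C, hC⟩ := exists_kerBdd_symB P i e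
  exact isSigmaFunction_polyExp hI hN hr (fun q => hC q l)
    (fun q J f => symB_comp_perm P i e q l J f) (by linarith)

end Symbols

/-! ### The smoothing remainder, and the recomposition of the nonlinearity -/

section Operators

variable {P : MvPolynomial Vars ℂ} {N Q : ℕ} {χ : Cutoffs} {δ : ℝ}

lemma exists_kerBdd_remKer (hχ : χ.Admissible δ) (P : MvPolynomial Vars ℂ) (N : ℕ) :
    ∃ C : Fin 2 → ℕ → ℝ, ∀ i q, 1 ≤ q → KerBdd (remKer χ P N i q) 2 (C i q) := by
  have h : ∀ i q, ∃ C, 1 ≤ q → KerBdd (remKer χ P N i q) 2 C := by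
    intro i q
    by_cases hq : 1 ≤ q
    · obtain ⟨C, hC⟩ := exists_kerBdd_mainKer P i
      obtain ⟨C', hC'⟩ := (hC q).smoothKer (isCut_cutAt hχ N hq)
      exact ⟨C', fun _ => hC'⟩
    · exact ⟨0, fun h => absurd h hq⟩
  choose C hC using h
  exact ⟨C, hC⟩

lemma isSigmaSmoothing_paraOp {I : Set ℝ} (hI : IsTimeInterval I) {ρ : ℝ} (hρ : 0 < ρ) {K : ℕ}
    (hN : 1 ≤ N) {r s₀ : ℝ} (hδ : 0 < δ) (hδ1 : δ < 1) (hχ : χ.Admissible δ)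
    (hs₀ : 2 * K + ρ + 6 ≤ s₀) (i e : Fin 2) :
    IsSigmaSmoothing I ρ K 1 N r s₀ (paraOp χ P N Q i e) := by
  obtain ⟨C, hC⟩ := exists_kerBdd_remKer hχ P N
  refine isSigmaSmoothing_smoothExp hI hρ hN e (hC i) (R := fun q => 16 * (q + 1) / δ)
    (fun q => ?_) (fun q hq => comparable_smoothKer hq hδ hδ1 (isCut_cutAt hχ N hq) _)
    (fun q J f => smoothKer_comp_perm _ (mainKer_comp_perm P i q) J f) (by linarith)
  rw [le_div_iff₀ hδ]
  have : (0 : ℝ) ≤ (q : ℝ) := Nat.cast_nonneg q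
  linarith

lemma matOp_paraOp (hN : 1 ≤ N) (hQ : N ≤ Q) (hχ : χ.Admissible δ) {U V : Fn2} {s : ℝ}
    (hs : 3 ≤ s) (hU : MemHs2 s U) (hV : MemHs2 s V) (i : Fin 2) :
    matOp 1 N (paraOp χ P N Q) U V i =
      ∑ q ∈ Finset.Ico 1 Q, mulT (remKer χ P N i q) (rowArgs q U V) := by
  obtain ⟨C, hC⟩ := exists_kerBdd_remKer hχ P N
  exact matOp_smoothExp hN hQ hC (by linarith) hU hV i

lemma remKer_flipJ (i : Fin 2) (q : ℕ) (J : Fin (q + 1) → Idx) :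
    remKer χ P N i q (flipJ J) = remKer χ P N (i + 1) q J := by
  unfold remKer smoothKer
  rw [symWt_flipJ, mainKer_flipJ]

lemma IsAdmissibleNonlinearity.remKer_negJ (hP : IsAdmissibleNonlinearity P)
    (hχ : χ.Admissible δ) (i : Fin 2) {q : ℕ} (hq : 1 ≤ q) (J : Fin (q + 1) → Idx) :
    remKer χ P N i q (negJ J) = remKer χ P N i q J := by
  unfold remKer smoothKer
  rw [symWt_negJ (isCut_cutAt hχ N hq), hP.mainKer_negJ]

lemma IsAdmissibleNonlinearity.conj_remKer (hP : IsAdmissibleNonlinearity P)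
    (hχ : χ.Admissible δ) (i : Fin 2) {q : ℕ} (hq : 1 ≤ q) (J : Fin (q + 1) → Idx) :
    conj (remKer χ P N i q (negJ J)) = remKer χ P N i q J := by
  unfold remKer smoothKer
  rw [symWt_negJ (isCut_cutAt hχ N hq), map_mul, Complex.conj_ofReal, hP.conj_mainKer]

lemma conjFn_sum {κ : Type*} (s : Finset κ) (f : κ → Fn) :
    conjFn (∑ q ∈ s, f q) = ∑ q ∈ s, conjFn (f q) := by
  funext j
  simp [conjFn, Finset.sum_apply]

lemma tauFn_sum {κ : Type*} (s : Finset κ) (f : κ → Fn) :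
    tauFn (∑ q ∈ s, f q) = ∑ q ∈ s, tauFn (f q) := by
  funext j
  simp [tauFn, Finset.sum_apply]

/-- The cut-off weight is real, even and blind to the components, so the remainder inherits the
symmetries of `mainKer`. -/
lemma isRRPOperator_paraOp (hP : IsAdmissibleNonlinearity P) (hN : 1 ≤ N) (hQ : N ≤ Q)
    (hχ : χ.Admissible δ) {s r : ℝ} (hs : 3 ≤ s) :
    IsRRPOperator s r (matOp 1 N (paraOp χ P N Q)) where
  reality U hU V hV := by
    have hV' : MemHs2 s (swapFn2 (conjFn2 V)) := MemHs2.swap fun i => (hV i).conj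
    funext i
    rw [swapFn2_apply, matOp_paraOp hN hQ hχ hs hU.1 hV']
    change conjFn _ = _
    rw [matOp_paraOp hN hQ hχ hs hU.1 hV, conjFn_sum]
    refine Finset.sum_congr rfl fun q hq => ?_
    have hq1 := (Finset.mem_Ico.1 hq).1
    rw [conjFn_mulT_rowArgs, hU.2.2.conjFn2_eq, ← swapFn2_swapFn2 (conjFn2 V), mulT_rowArgs_swap,
      swapFn2_swapFn2]
    simp only [hP.conj_remKer hχ i hq1, remKer_flipJ]
  reversibility U hU V hV := by
    funext i
    rw [swapFn2_apply, matOp_paraOp hN hQ hχ hs hU.1 hV,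
      matOp_paraOp hN hQ hχ hs hU.1.swap hV.swap]
    refine Finset.sum_congr rfl fun q hq => ?_
    rw [mulT_rowArgs_swap]
    simp only [remKer_flipJ]
  parity U hU hτ V hV := by
    have hV' : MemHs2 s (tauFn2 V) := fun i => (hV i).tau
    funext i
    change _ = tauFn _
    rw [matOp_paraOp hN hQ hχ hs hU.1 hV', matOp_paraOp hN hQ hχ hs hU.1 hV, tauFn_sum]
    refine Finset.sum_congr rfl fun q hq => ?_
    rw [tauFn_mulT_rowArgs, hτ]
    simp only [hP.remKer_negJ hχ i (Finset.mem_Ico.1 hq).1]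

/-- The operator acts here on U itself, so all arguments coincide and the cut-off may be replaced by
its symmetrization. -/
lemma matOpBW_paraSym (hN : 1 ≤ N) (hQ : N ≤ Q) (hχ : χ.Admissible δ) {U : Fn2} {s : ℝ}
    (hs : 5 ≤ s) (hU : MemHs2 s U) (i : Fin 2) :
    matOpBW χ 1 N (paraSym P N Q) U U i = ∑ q ∈ Finset.Ico 1 Q,
      mulT (fun J => (symWt (cutAt χ N q) J : ℂ) * mainKer P i q J) fun _ => un U := by
  obtain ⟨C', hC'⟩ := exists_kerBdd_mainKer P i
  have h1 : ∀ e, (paraSym P N Q i e).opBW χ 1 N U (U e) = ∑ q ∈ Finset.Ico 1 Q,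
      mulT (cutKer (cutAt χ N q) (mainKer P i q)) (opArgs q e U (U e)) := fun e => by
    obtain ⟨C, hC⟩ := exists_kerBdd_symB P i e
    exact polyExp_opBW hχ hN hQ (fun q hq => isWeylCoeff_symB P i e hq) hC hC'
      (by linarith) (by linarith) hU hU
  unfold matOpBW
  rw [Finset.sum_congr rfl fun e _ => h1 e, Finset.sum_comm]
  refine Finset.sum_congr rfl fun q hq => ?_
  have hq1 := (Finset.mem_Ico.1 hq).1
  have hcut := isCut_cutAt hχ N hq1
  obtain ⟨D, hD⟩ := (hC' q).cutKer hcut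
  rw [sum_mulT_opArgs (hD.summable_norm (Nat.succ_pos q) (rowArgs_memW (by linarith) hU hU)),
    rowArgs_self]
  exact mulT_cutWt_diag hcut (mainKer_comp_perm P i q)
    ((hC' q).summable_norm (Nat.succ_pos q) fun _ => (hU.memW (by linarith)).1)

/-- The weights symWt and 1 − symWt add up to 1. -/
lemma matOpBW_add_matOp (hN : 1 ≤ N) (hQ : N ≤ Q) (hχ : χ.Admissible δ) {U : Fn2} {s : ℝ}
    (hs : 5 ≤ s) (hU : MemHs2 s U) (i : Fin 2) :
    (matOpBW χ 1 N (paraSym P N Q) U U + matOp 1 N (paraOp χ P N Q) U U) i =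
      ∑ q ∈ Finset.Ico 1 Q, mulT (mainKer P i q) fun _ => un U := by
  obtain ⟨C', hC'⟩ := exists_kerBdd_mainKer P i
  obtain ⟨C, hC⟩ := exists_kerBdd_remKer hχ P N
  rw [Pi.add_apply, matOpBW_paraSym hN hQ hχ hs hU,
    matOp_paraOp hN hQ hχ (by linarith) hU hU, ← Finset.sum_add_distrib]
  refine Finset.sum_congr rfl fun q hq => ?_
  have hq1 := (Finset.mem_Ico.1 hq).1
  have hm : ∀ _ : Fin (q + 1), MemW (wt2 2) (un U) := fun _ => (hU.memW (by linarith)).1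
  obtain ⟨D, h0, hD⟩ := abs_symWt_le (isCut_cutAt hχ N hq1)
  rw [rowArgs_self, ← mulT_add_ker]
  · congr 1
    funext J
    unfold remKer smoothKer
    push_cast
    ring
  · refine ((hC' q).mul_left h0 (g := fun J => (symWt (cutAt χ N q) J : ℂ))
      fun J => ?_).summable_norm (Nat.succ_pos q) hm
    rw [Complex.norm_real]
    exact hD J
  · exact (hC i q hq1).summable_norm (Nat.succ_pos q) hm

lemma IsAdmissibleNonlinearity.nonlin_eq (hP : IsAdmissibleNonlinearity P) (hQ1 : 1 ≤ Q)
    (hdeg : P.totalDegree ≤ Q) {U : Fn2} {s : ℝ} (hs : 3 ≤ s) (hU : MemHs2 s U)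
    (h : IsRealPair U) :
    nonlin P (U 0) = ∑ q ∈ Finset.Ico 1 Q, mulT (mainKer P 0 q) fun _ => un U := by
  obtain ⟨C, hC⟩ := exists_kerBdd_mainKer P 0
  have hm := (hU.memW (σ := 2) (by linarith)).1
  have hG : ∀ q ∈ Finset.Ico 1 Q, MemW (wt1 0) (mulT (mainKer P 0 q) fun _ => un U) :=
    fun q _ => (hC q).memW (Nat.succ_pos q) le_rfl fun _ => by rw [zero_add]; exact hm
  rw [← fourierFn_evalFn (memW_sum hG)]
  unfold nonlin
  congr 1
  funext x
  rw [evalFn_sum hG, hP.sum_evalFn_mainKer 0 hQ1 hdeg hm, h.varVal_zero]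
  rfl

/-- The second component is the conjugate of the first one; on real pairs with real coefficients
conjugation exchanges the components of U, which gives the kernel with i = 1. -/
lemma IsAdmissibleNonlinearity.nlsField_eq (hP : IsAdmissibleNonlinearity P) (hN : 1 ≤ N)
    (hQ : N ≤ Q) (hdeg : P.totalDegree ≤ Q) (hχ : χ.Admissible δ) {M : ℕ} (m : Fin M → ℝ)
    {s r : ℝ} (hs : 5 ≤ s) {U : Fn2} (hU : MemPhase s r U) :
    nlsField m P U = paraField m χ 1 N (paraSym P N Q) (paraOp χ P N Q) U := by
  unfold nlsField paraField
  congr 1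
  funext i
  rw [matOpBW_add_matOp hN hQ hχ hs hU.1 i]
  have h0 := hP.nonlin_eq (hN.trans hQ) hdeg (by linarith) hU.1 hU.2.2
  fin_cases i
  · exact h0
  · change conjFn (nonlin P (U 0)) = _
    rw [h0, conjFn_sum]
    refine Finset.sum_congr rfl fun q _ => ?_
    simp only [conjFn_mulT _ fun _ => U, hU.2.2.conjFn2_eq, mulT_swapFn2 _ fun _ => U,
      hP.conj_mainKer, mainKer_flipJ]
    rfl

end Operators

lemma MemBall.memPhase {I : Set ℝ} {K : ℕ} {s r : ℝ} {U : ℝ → Fn2} (h : MemBall I K s r U)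
    {t : ℝ} (ht : t ∈ I) (hr : IsRealPair (U t)) : MemPhase s r (U t) := by
  obtain ⟨hU, r', hr', hle⟩ := h
  have h0 : dt2 I 0 U t = U t := by
    funext i j
    simp [dt2, dt]
  have hm : ∀ i, MemHs s (U t i) := fun i => by
    have h1 := ((hU i).2 0 (Nat.zero_le _) t ht).1
    have h2 : dt I 0 (fun τ => U τ i) t = U t i := congrFun h0 i
    rw [h2] at h1
    simpa using h1
  refine ⟨hm, lt_of_le_of_lt ?_ hr', hr⟩
  have h1 := hsNorm2_dt_le_normK2 (I := I) (Nat.zero_le K) s U t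
  rw [h0] at h1
  have h2 := h1.trans (hle t ht)
  simpa using h2

end ParaNLS

end

theorem theorem3p1
    (P : MvPolynomial (Fin 3 ⊕ Fin 3) ℂ) (hP : IsAdmissibleNonlinearity P)
    (M : ℕ) (m : Fin M → ℝ) (hm : ∀ k, m k ∈ Set.Icc (-(1 / 2) : ℝ) (1 / 2))
    (I : Set ℝ) (hI : IsTimeInterval I)
    (δ : ℝ) (hδ : 0 < δ) (hδ1 : δ < 1) (χ : Cutoffs) (hχ : χ.Admissible δ)
    (N : ℕ) (hN : 1 ≤ N) (K : ℕ) (r : ℝ) (hr : 0 < r) (ρ : ℝ) (hρ : 0 < ρ) :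
    ∃ (s₀ : ℝ) (A : Matrix (Fin 2) (Fin 2) SymExp) (R : Matrix (Fin 2) (Fin 2) OpExp)
      (B : Fin 3 → Matrix (Fin 2) (Fin 2) SymExp),
      2 * (K : ℝ) + 5 / 2 < s₀ ∧
      -- `A` is an (R,R,P) matrix of symbols and `R` an (R,R,P) matrix of smoothing operators
      (∀ i j, IsSigmaSymbol I 2 K 1 N r s₀ (A i j)) ∧
      IsRRPSymbol s₀ r (matEval 1 N A) ∧
      (∀ i j, IsSigmaSmoothing I ρ K 1 N r s₀ (R i j)) ∧
      IsRRPOperator s₀ r (matOp 1 N R) ∧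
      -- the vector NLS and the paralinearized system coincide
      (∀ U, MemPhase s₀ r U → nlsField m P U = paraField m χ 1 N A R U) ∧
      (∀ U : ℝ → Fn2, MemBall I K s₀ r U → (∀ t ∈ I, IsRealPair (U t)) →
        (IsSolution I (nlsField m P) U ↔ IsSolution I (paraField m χ 1 N A R) U)) ∧
      -- `A = A₂ (iξ)² + A₁ (iξ) + A₀` with matrices `A_l = B l` of functions
      (∀ l i j, IsSigmaFunction I K 1 N r s₀ (B l i j)) ∧
      (∀ i j, ∀ q ∈ Finset.Ico 1 N, ∀ U x ξ,
        (A i j).hom q U x ξ =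
          ∑ l : Fin 3, (B l i j).hom q U x ξ * (Complex.I * ξ) ^ (l : ℕ)) ∧
      (∀ i j U, MemHs2 s₀ U → hsNorm2 s₀ U < r → ∀ x ξ,
        (A i j).rem U x ξ =
          ∑ l : Fin 3, (B l i j).rem U x ξ * (Complex.I * ξ) ^ (l : ℕ)) ∧
      (∀ U, MemPhase s₀ r U → ∀ l x ξ,
        matEval 1 N (B l) U x ξ 1 0 = star (matEval 1 N (B l) U x ξ 0 1) ∧
        matEval 1 N (B l) U x ξ 1 1 = star (matEval 1 N (B l) U x ξ 0 0)) ∧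
      -- the diagonal entry `a₂` of `A₂` is real
      (∀ U, MemPhase s₀ r U → ∀ x ξ, (matEval 1 N (B 2) U x ξ 0 0).im = 0) := by
  have hK : (0 : ℝ) ≤ K := Nat.cast_nonneg K
  -- The bound Q = N + deg P on q is at least N, so that the range splits at N, and exceeds every q
  -- with q + 1 ≤ deg P.
  have hQ : N ≤ N + P.totalDegree := Nat.le_add_right _ _
  have hdeg : P.totalDegree ≤ N + P.totalDegree := Nat.le_add_left _ _
  have hm4 : ∀ U, MemHs2 (2 * K + ρ + 6) U → MemW (wt2 4) (un U) := fun U hU =>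
    (hU.memW (by linarith)).1
  have hfield : ∀ U, MemPhase (2 * K + ρ + 6) r U → nlsField m P U =
      paraField m χ 1 N (paraSym P N (N + P.totalDegree)) (paraOp χ P N (N + P.totalDegree)) U :=
    fun U hU => hP.nlsField_eq hN hQ hdeg hχ m (by linarith) hU
  -- The remainder requires 2K + 2μ + ρ + 2 with kernel growth μ = 2; the symbols, of growth 4,
  -- require only 2K + 5.
  refine ⟨2 * K + ρ + 6, paraSym P N (N + P.totalDegree), paraOp χ P N (N + P.totalDegree),
    paraCoef P N (N + P.totalDegree), by linarith, ?_, ?_, ?_, ?_, hfield, ?_, ?_, ?_, ?_, ?_, ?_⟩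
  · exact fun i j => isSigmaSymbol_paraSym hI hN hr (by linarith) i j
  · exact isRRPSymbol_paraSym hP hN hQ (by linarith)
  · exact fun i j => isSigmaSmoothing_paraOp hI hρ hN hδ hδ1 hχ le_rfl i j
  · exact isRRPOperator_paraOp hP hN hQ hχ (by linarith)
  -- The two vector fields agree at every time, because each U(t) lies in the phase space.
  · intro U hU hreal
    refine forall₂_congr fun t ht => ?_
    rw [hfield (U t) (hU.memPhase ht (hreal t ht))]
  · exact fun l i j => isSigmaFunction_paraCoef hI hN hr (by linarith) l i j
  · exact fun i j q hq U x ξ => paraSym_hom_eq i j (Finset.mem_Ico.1 hq).1 U x ξ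
  · exact fun i j U _ _ x ξ => paraSym_rem_eq i j U x ξ
  · exact fun U hU l x ξ =>
      ⟨paraCoef_conj hP hN hQ (hm4 U hU.1) hU.2.2 l x ξ 0 1,
        paraCoef_conj hP hN hQ (hm4 U hU.1) hU.2.2 l x ξ 0 0⟩
  · exact fun U hU x ξ => paraCoef_two_im hP hN hQ hdeg (hm4 U hU.1) hU.2.2 x ξ
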